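/- **Sharpness of the decay rates.** Let $\mathbb{S}^1=\mathbb{R}/2\pi\mathbb{Z}$ be parametrized by $[-\pi,\pi)$, let $\mathbb{T}^2=\mathbb{S}^1\times\mathbb{S}^1$ be the flat torus, and write $\langle t\rangle=(1+t^2)^{1/2}$. For a non-negative measurable damping $W$ on $\mathbb{T}^2$ consider the damped wave equation $$(\partial_t^2-\Delta+W\partial_t)u=0,\qquad (u,\partial_t u)|_{t=0}=(u_0,u_1)\in\mathcal{D},$$ with $\mathcal{D}=\{(u_0,u_1)\in H^1(\mathbb{T}^2)\times H^1(\mathbb{T}^2): -\Delta u_0+Wu_1\in L^2(\mathbb{T}^2)\}$. Its solution is understood as the differentiable curve $U=(u,\partial_tu):[0,\infty)\to H^1\times L^2$ with values in $\mathcal{D}$ satisfying $U'(t)=(\partial_tu,\Delta u-W\partial_tu)$ and $U(0)=(u_0,u_1)$; its energy is $E(u,t)=\frac12\int_{\mathbb{T}^2}|\nabla u|^2+|\partial_tu|^2$. Say that the rate $\langle t\rangle^{-\alpha}$ is *not improvable for $W$* if for all $C,\epsilon>0$ there are $t_0>0$ and initial data $(u_0,u_1)\in\mathcal{D}$ such that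 the (unique) solution $u$ with these data satisfies $$E(u,t_0)^{1/2}>C\langle t_0\rangle^{-\alpha-\epsilon}\left(\|\nabla u_0\|_{L^2}+\|u_1\|_{H^1}+\|-\Delta u_0+Wu_1\|_{L^2}\right).$$ For $\theta\in\mathbb{S}^1$ let $X^\beta_\theta$ be the set of measurable functions $f$ on $\mathbb{S}^1$ for which there are $C_0>0$ and $\sigma\in(0,\pi)$ with $C_0^{-1}V^\beta(x-\theta)\le f(x)\le C_0V^\beta(x-\theta)$ for almost every $x$, where $V^\beta(x)=0$ for $|x|\le\sigma$ and $V^\beta(x)=(|x|-\sigma)^\beta$ for $|x|>\sigma$. 1. For every $\beta\in(-1,\infty)$ there is a damping $W(x,y)=w(x)$, with $w\in X^\beta_\theta$ for some $\theta\in\mathbb{S}^1$, for which the rate $\langle t\rangle^{-\frac{\beta+2}{\beta+3}}$ is not improvable. 2. For every $\beta\in(-1,0)$ the rate $\langle t\rangle^{-\frac{\beta+2}{\beta+3}}$ is not improvable for $W(x,y)=\mathbf{1}_{|x|\ge\pi/2}\left((|x|-\tfrac{\pi}{2})^\beta+1\right)$. -/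

import Mathlib

open MeasureTheory Real Set

noncomputable section

namespace DampedWave

/-- The circle of length `2π`. For `|x| ≤ π` the norm of the class of `x` is `|x|`
(see `norm_coe_eq_abs` below), so `‖x‖` is the `|x|` of the usual parametrization by `[-π, π)`. -/
abbrev S1 : Type := AddCircle (2 * π)

theorem norm_coe_eq_abs (x : ℝ) (hx : |x| ≤ π) : ‖(x : S1)‖ = |x| := by
  refine (AddCircle.norm_coe_eq_abs_iff (2 * π) (by positivity)).2 ?_
  rw [abs_of_pos (by positivity : (0 : ℝ) < 2 * π)]
  linarith

instance factTwoPiPos : Fact ((0 : ℝ) < 2 * π) := ⟨by positivity⟩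

/-- The flat torus, with its Lebesgue measure `volume` (of total mass `(2π)²`). -/
abbrev Torus : Type := S1 × S1

/-- Complex-valued `L²` on the torus. -/
abbrev L2 : Type := Lp ℂ 2 (volume : Measure Torus)

/-- Smooth functions on the torus: those whose doubly periodic lift to `ℝ²` is smooth. -/
def IsTest (φ : Torus → ℂ) : Prop :=
  ContDiff ℝ ((⊤ : ℕ∞) : WithTop ℕ∞) (fun p : ℝ × ℝ => φ ((p.1 : S1), (p.2 : S1)))

/-- The classical derivative in the first variable. -/
def dx (φ : Torus → ℂ) (z : Torus) : ℂ := deriv (fun s : ℝ => φ (z.1 + (s : S1), z.2)) 0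

/-- The classical derivative in the second variable. -/
def dy (φ : Torus → ℂ) (z : Torus) : ℂ := deriv (fun s : ℝ => φ (z.1, z.2 + (s : S1))) 0

/-- The function `g` is the weak derivative of `u` in the first variable. -/
def HasWeakDx (u g : L2) : Prop :=
  ∀ φ : Torus → ℂ, IsTest φ → ∫ z, u z * dx φ z = - ∫ z, g z * φ z

/-- The function `g` is the weak derivative of `u` in the second variable. -/
def HasWeakDy (u g : L2) : Prop :=
  ∀ φ : Torus → ℂ, IsTest φ → ∫ z, u z * dy φ z = - ∫ z, g z * φ z

/-! Integrability of the products above, needed to see that weakly differentiable functions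
form a vector space. -/

theorem isOpenQuotientMap_lift :
    IsOpenQuotientMap (fun p : ℝ × ℝ => (((p.1 : S1), (p.2 : S1)) : Torus)) := by
  have h : IsOpenQuotientMap (fun x : ℝ => (x : S1)) :=
    QuotientAddGroup.isOpenQuotientMap_mk
  exact h.prodMap h

theorem continuous_of_lift {ψ : Torus → ℂ}
    (h : Continuous (fun p : ℝ × ℝ => ψ ((p.1 : S1), (p.2 : S1)))) : Continuous ψ :=
  isOpenQuotientMap_lift.isQuotientMap.continuous_iff.2 h

theorem IsTest.continuous {φ : Torus → ℂ} (h : IsTest φ) : Continuous φ :=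
  continuous_of_lift (ContDiff.continuous h)

theorem IsTest.continuous_dx {φ : Torus → ℂ} (h : IsTest φ) : Continuous (dx φ) := by
  apply continuous_of_lift
  set F : ℝ × ℝ → ℂ := fun p => φ ((p.1 : S1), (p.2 : S1)) with hF
  have hF' : ContDiff ℝ ((⊤ : ℕ∞) : WithTop ℕ∞) F := h
  have hd : Differentiable ℝ F := hF'.differentiable (by simp)
  have key : (fun p : ℝ × ℝ => dx φ ((p.1 : S1), (p.2 : S1)))
      = fun p => fderiv ℝ F p (1, 0) := by
    funext p
    have h1 : HasDerivAt (fun s : ℝ => ((p.1 + s, p.2) : ℝ × ℝ)) (1, 0) 0 :=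
      ((hasDerivAt_id (0 : ℝ)).const_add p.1).prodMk (hasDerivAt_const _ _)
    have h2 : HasFDerivAt F (fderiv ℝ F p) ((p.1 + 0, p.2) : ℝ × ℝ) := by
      simpa using (hd p).hasFDerivAt
    have h3 := (h2.comp_hasDerivAt (0 : ℝ) h1).deriv
    simpa [dx, hF, Function.comp_def] using h3
  rw [key]
  exact (hF'.continuous_fderiv (by simp)).clm_apply continuous_const

theorem IsTest.continuous_dy {φ : Torus → ℂ} (h : IsTest φ) : Continuous (dy φ) := by
  apply continuous_of_lift
  set F : ℝ × ℝ → ℂ := fun p => φ ((p.1 : S1), (p.2 : S1)) with hF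
  have hF' : ContDiff ℝ ((⊤ : ℕ∞) : WithTop ℕ∞) F := h
  have hd : Differentiable ℝ F := hF'.differentiable (by simp)
  have key : (fun p : ℝ × ℝ => dy φ ((p.1 : S1), (p.2 : S1)))
      = fun p => fderiv ℝ F p (0, 1) := by
    funext p
    have h1 : HasDerivAt (fun s : ℝ => ((p.1, p.2 + s) : ℝ × ℝ)) (0, 1) 0 :=
      (hasDerivAt_const _ _).prodMk ((hasDerivAt_id (0 : ℝ)).const_add p.2)
    have h2 : HasFDerivAt F (fderiv ℝ F p) ((p.1, p.2 + 0) : ℝ × ℝ) := by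
      simpa using (hd p).hasFDerivAt
    have h3 := (h2.comp_hasDerivAt (0 : ℝ) h1).deriv
    simpa [dy, hF, Function.comp_def] using h3
  rw [key]
  exact (hF'.continuous_fderiv (by simp)).clm_apply continuous_const

theorem integrable_mul_of_continuous (u : L2) {ψ : Torus → ℂ} (h : Continuous ψ) :
    Integrable (fun z => u z * ψ z) := by
  have hψ : MemLp ψ 2 (volume : Measure Torus) :=
    h.memLp_of_hasCompactSupport (HasCompactSupport.of_compactSpace ψ)
  exact (Lp.memLp u).integrable_mul hψ

theorem weak_pairing_add {u u' g g' : L2} {φ ψ : Torus → ℂ} (hφ : Continuous φ)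
    (hψ : Continuous ψ) (h : ∫ z, u z * ψ z = - ∫ z, g z * φ z)
    (h' : ∫ z, u' z * ψ z = - ∫ z, g' z * φ z) :
    ∫ z, (u + u') z * ψ z = - ∫ z, (g + g') z * φ z := by
  have e1 : ∫ z, (u + u') z * ψ z = ∫ z, (u z * ψ z + u' z * ψ z) := by
    refine integral_congr_ae ?_
    filter_upwards [Lp.coeFn_add u u'] with z hz
    rw [hz, Pi.add_apply, add_mul]
  have e2 : ∫ z, (g + g') z * φ z = ∫ z, (g z * φ z + g' z * φ z) := by
    refine integral_congr_ae ?_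
    filter_upwards [Lp.coeFn_add g g'] with z hz
    rw [hz, Pi.add_apply, add_mul]
  rw [e1, e2, integral_add (integrable_mul_of_continuous u hψ)
    (integrable_mul_of_continuous u' hψ), integral_add (integrable_mul_of_continuous g hφ)
    (integrable_mul_of_continuous g' hφ), h, h']
  ring

theorem weak_pairing_smul (c : ℂ) {u g : L2} {φ ψ : Torus → ℂ}
    (h : ∫ z, u z * ψ z = - ∫ z, g z * φ z) :
    ∫ z, (c • u) z * ψ z = - ∫ z, (c • g) z * φ z := by
  have e1 : ∫ z, (c • u) z * ψ z = ∫ z, c * (u z * ψ z) := by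
    refine integral_congr_ae ?_
    filter_upwards [Lp.coeFn_smul c u] with z hz
    rw [hz, Pi.smul_apply, smul_eq_mul, mul_assoc]
  have e2 : ∫ z, (c • g) z * φ z = ∫ z, c * (g z * φ z) := by
    refine integral_congr_ae ?_
    filter_upwards [Lp.coeFn_smul c g] with z hz
    rw [hz, Pi.smul_apply, smul_eq_mul, mul_assoc]
  rw [e1, e2, integral_const_mul, integral_const_mul, h]
  ring

theorem weak_pairing_zero {φ ψ : Torus → ℂ} :
    ∫ z, (0 : L2) z * ψ z = - ∫ z, (0 : L2) z * φ z := by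
  have e : ∀ χ : Torus → ℂ, ∫ z, (0 : L2) z * χ z = 0 := by
    intro χ
    rw [← integral_zero Torus ℂ (μ := volume)]
    refine integral_congr_ae ?_
    filter_upwards [Lp.coeFn_zero ℂ 2 (volume : Measure Torus)] with z hz
    rw [hz, Pi.zero_apply, zero_mul]
  rw [e, e, neg_zero]

/-- The Sobolev space `H¹` of the torus, realized as the space of triples `(u, ∂ₓu, ∂ᵧu)` in
`L² × L² × L²`; as weak derivatives are unique, such a triple is determined by `u`. It inherits
the norm `(‖u‖² + ‖∂ₓu‖² + ‖∂ᵧu‖²)^(1/2)`. -/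
def H1 : Submodule ℂ (PiLp 2 (fun _ : Fin 3 => L2)) where
  carrier := {w | HasWeakDx (w 0) (w 1) ∧ HasWeakDy (w 0) (w 2)}
  zero_mem' := ⟨fun _ _ => weak_pairing_zero, fun _ _ => weak_pairing_zero⟩
  add_mem' := fun {_ _} ha hb =>
    ⟨fun φ hφ => weak_pairing_add hφ.continuous hφ.continuous_dx (ha.1 φ hφ) (hb.1 φ hφ),
      fun φ hφ => weak_pairing_add hφ.continuous hφ.continuous_dy (ha.2 φ hφ) (hb.2 φ hφ)⟩
  smul_mem' := fun c _ ha =>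
    ⟨fun φ hφ => weak_pairing_smul c (ha.1 φ hφ), fun φ hφ => weak_pairing_smul c (ha.2 φ hφ)⟩

/-- The underlying `L²` function of an element of `H¹`. -/
def fn (u : H1) : L2 := (u : PiLp 2 (fun _ : Fin 3 => L2)) 0

/-- The first weak partial derivative of an element of `H¹`. -/
def wdx (u : H1) : L2 := (u : PiLp 2 (fun _ : Fin 3 => L2)) 1

/-- The second weak partial derivative of an element of `H¹`. -/
def wdy (u : H1) : L2 := (u : PiLp 2 (fun _ : Fin 3 => L2)) 2

/-- The `L²` norm of the gradient. -/
def gradNorm (u : H1) : ℝ := √(‖wdx u‖ ^ 2 + ‖wdy u‖ ^ 2)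

theorem norm_sq_H1 (u : H1) : ‖u‖ ^ 2 = ‖fn u‖ ^ 2 + ‖wdx u‖ ^ 2 + ‖wdy u‖ ^ 2 := by
  rw [Submodule.coe_norm, PiLp.norm_sq_eq_of_L2, Fin.sum_univ_three]
  rfl

/-- The energy space `H¹ × L²`. -/
abbrev EnergySpace : Type := H1 × L2

/-- The distribution `-Δu + W v` is the `L²` function `f`. -/
def HasDampedLaplacian (W : Torus → ℝ) (u v : H1) (f : L2) : Prop :=
  Integrable (fun z => (W z : ℂ) * fn v z) ∧
  ∀ φ : Torus → ℂ, IsTest φ →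
    ∫ z, (wdx u z * dx φ z + wdy u z * dy φ z + (W z : ℂ) * fn v z * φ z) = ∫ z, f z * φ z

/-- The damped wave operator, as a graph: `X = (u, v)` lies in its domain, that is,
`u, v ∈ H¹` and `-Δu + W v ∈ L²`, and `Y = (v, Δu - W v)`. -/
def WaveOperator (W : Torus → ℝ) (X Y : EnergySpace) : Prop :=
  fn Y.1 = X.2 ∧ HasDampedLaplacian W X.1 Y.1 (-Y.2)

/-- Solutions `U = (u, ∂ₜu)` on `[0, ∞)` of `(∂ₜ² - Δ + W ∂ₜ) u = 0` with initial data
`(u₀, u₁)`: at all times `U` lies in the domain of the damped wave operator, and `U` is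
differentiable in `H¹ × L²` with `U' = (v, Δu - W v)`, one-sidedly at time `0`. -/
def IsSolution (W : Torus → ℝ) (u₀ u₁ : H1) (U : ℝ → EnergySpace) : Prop :=
  U 0 = (u₀, fn u₁) ∧
  ∀ t : ℝ, 0 ≤ t → ∃ Y : EnergySpace, WaveOperator W (U t) Y ∧ HasDerivWithinAt U Y (Ici 0) t

/-- The energy `½ ∫ |∇u|² + |∂ₜu|²` of a state `(u, ∂ₜu)`. -/
def energy (X : EnergySpace) : ℝ := (1 / 2) * (gradNorm X.1 ^ 2 + ‖X.2‖ ^ 2)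

/-- The bracket `⟨t⟩ = (1 + t²)^(1/2)`. -/
def bracket (t : ℝ) : ℝ := √(1 + t ^ 2)

/-- For the damping `W`, the energy decay rate `⟨t⟩^(-α)` cannot be improved to
`⟨t⟩^(-α - ε)`, for any `ε > 0`. Here `(u₀, u₁)` are admissible initial data, with
`f = -Δu₀ + W u₁ ∈ L²`, and `U` is the solution with these data, unique on `[0, ∞)`. -/
def RateNotImprovable (W : Torus → ℝ) (α : ℝ) : Prop :=
  ∀ C : ℝ, 0 < C → ∀ ε : ℝ, 0 < ε →
    ∃ t₀ : ℝ, 0 < t₀ ∧ ∃ (u₀ u₁ : H1) (f : L2), HasDampedLaplacian W u₀ u₁ f ∧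
      ∃ U : ℝ → EnergySpace, IsSolution W u₀ u₁ U ∧
        (∀ U₂ : ℝ → EnergySpace, IsSolution W u₀ u₁ U₂ → EqOn U₂ U (Ici 0)) ∧
        √(energy (U t₀)) > C * bracket t₀ ^ (-α - ε) * (gradNorm u₀ + ‖u₁‖ + ‖f‖)

/-- The model function, equal to `0` for `|x| ≤ σ` and to `(|x| - σ)^β` for `|x| > σ`. -/
def modelDamping (β σ : ℝ) (x : S1) : ℝ := if ‖x‖ ≤ σ then 0 else (‖x‖ - σ) ^ β

/-- Polynomially controlled functions on the circle, centred at `θ`. -/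
def PolynomiallyControlled (β : ℝ) (θ : S1) (w : S1 → ℝ) : Prop :=
  Measurable w ∧ ∃ C₀ σ : ℝ, 0 < C₀ ∧ 0 < σ ∧ σ < π ∧
    ∀ᵐ x : S1, C₀⁻¹ * modelDamping β σ (x - θ) ≤ w x ∧ w x ≤ C₀ * modelDamping β σ (x - θ)

/-- The damping `1_{|x| ≥ π/2} ((|x| - π/2)^β + 1)` on the torus. -/
def singularDamping (β : ℝ) (z : Torus) : ℝ :=
  if π / 2 ≤ ‖z.1‖ then (‖z.1‖ - π / 2) ^ β + 1 else 0

end DampedWave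

end

/-! Since the damping depends on `x` only, variables separate. If `Y'' = -(s² + iτω) Y` on `[0, π]`
with `τ² = k² + s²` and `Y'` vanishes at `0` and `π`, then the even reflection of `Y` gives the
solution `e^{-iτt} e^{iky} Y(|x|)`, whose size changes in time only by the factor `e^{t Im τ}`. Put
`α = (β+2)/(β+3)`. It is enough to find such modes for all large `k` with `|Im τ| ≲ k^{-1/α}`: at
time `t₀ = k^{1/α}` the mode has lost at most a constant factor, the root of its energy is at least
of order `k ‖u‖`, and the norm of the data is at most of order `k² ‖u‖`. The quotient is of order at
least `k⁻¹ = t₀^{-α}`, so a gain of `ε` fails once `k` is large (`IsProfile.rateNotImprovable`).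

The modes concentrate in the undamped strip `|x| < π/2`, for which the damped side acts as an almost
Dirichlet wall at high frequency. Normalize the solution on the damped side by `Y'(π/2) = 1` and
`Y'(π) = 0`; it then enters only through the number `m(s) = Y(π/2)`. The layer which the mode
penetrates has the width `δ` at which `k x^β` balances `x^{-2}`, so `k δ^{β+2} = 1`. The energy
identity and Poincaré inequalities weighted by `ω` give `m = O(δ)`
(`IsProfile.exists_normalized_solution`). Matching with the free solution on `[0, π/2]` turns `Y'(0)
= 0` into `cos(sπ/2) + s m(s) sin(sπ/2) = 0`, a small perturbation of the Dirichlet condition, which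
has the root `s = 1`. A Newton-type contraction finds `s = 1 + O(δ)` (`exists_dispersion_root`); the
Lipschitz bound on `m` that it needs comes from a Wronskian. Finally `Im τ = Im s² / (2 Re τ) =
O(δ/k)`, which is the required rate (`IsProfile.exists_eigenmode`). On the side of `ω` this uses
only a lower bound by `(x - π/2)^β`, vanishing in the strip, local integrability and continuity off
the edge, so both dampings are covered at once.

The rest transfers this to the weak formulation: folding the circle onto `[0, π]` makes the mode an
element of the domain (`exists_torus_mode`), and solutions are unique (`IsSolution.eqOn`). As `ω`
may be unbounded, uniqueness rests on a trace estimate showing that `∫ W |v|²` is bounded on `H¹`.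
-/

noncomputable section

namespace DampedWave

/-! ### Linear second order equations with an integrable potential -/

section Volterra

theorem hasDerivAt_integral_left {E : Type*} [NormedAddCommGroup E] [NormedSpace ℝ E]
    [CompleteSpace E] {f : ℝ → E} (hf : ∀ a b : ℝ, IntervalIntegrable f volume a b) {x : ℝ}
    (hx : ContinuousAt f x) (b : ℝ) : HasDerivAt (fun u => ∫ v in u..b, f v) (-f x) x :=
  intervalIntegral.integral_hasDerivAt_left (hf x b)
    ⟨Ioc (x - 1) (x + 1), Ioc_mem_nhds (by linarith) (by linarith),
      (hf (x - 1) (x + 1)).aestronglyMeasurable⟩ hx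

theorem continuous_integral_left {E : Type*} [NormedAddCommGroup E] [NormedSpace ℝ E]
    {f : ℝ → E} (hf : ∀ a b : ℝ, IntervalIntegrable f volume a b) (b : ℝ) :
    Continuous fun u => ∫ v in u..b, f v := by
  simp_rw [fun u => intervalIntegral.integral_symm (f := f) (μ := volume) b u]
  exact (intervalIntegral.continuous_primitive hf b).neg

variable {q : ℝ → ℂ} {σ : ℝ}

/-- The integrand is the derivative of `-exp (l ∫ ‖q‖) / l`. This gains a factor `1 / l` when
integrating against `‖q‖`, which is what makes the Volterra map a contraction for an exponentially
weighted sup norm. -/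
theorem integral_norm_mul_exp_primitive (hq : ∀ a b : ℝ, IntervalIntegrable q volume a b)
    (hc : ∀ x, x ≠ σ → ContinuousAt q x) {l : ℝ} (hl : 0 < l) {t b : ℝ} (htb : t ≤ b) :
    ∫ u in t..b, ‖q u‖ * exp (l * ∫ v in u..b, ‖q v‖)
      = (exp (l * ∫ v in t..b, ‖q v‖) - 1) / l := by
  have hn : ∀ a b : ℝ, IntervalIntegrable (fun v => ‖q v‖) volume a b := fun a b => (hq a b).norm
  have hQ : Continuous fun u => ∫ v in u..b, ‖q v‖ := continuous_integral_left hn b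
  have hE : Continuous fun u => exp (l * ∫ v in u..b, ‖q v‖) := by fun_prop
  have key := MeasureTheory.integral_eq_of_hasDerivAt_off_countable_of_le
    (fun u => -exp (l * ∫ v in u..b, ‖q v‖) / l)
    (fun u => ‖q u‖ * exp (l * ∫ v in u..b, ‖q v‖)) htb (countable_singleton σ)
    (by fun_prop) (by
      rintro x ⟨-, hx⟩
      have h1 := hasDerivAt_integral_left hn (hc x hx).norm b
      have h2 := ((h1.const_mul l).exp.neg).div_const l
      refine h2.congr_deriv ?_
      rw [div_eq_iff hl.ne']
      ring)
    ((hn t b).mul_continuousOn hE.continuousOn)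
  rw [key]
  simp
  ring

/-- A linear second order equation with locally integrable potential has a solution with
Cauchy data `(1, 0)` at the right endpoint. -/
theorem exists_volterra_solution (hq : ∀ a b : ℝ, IntervalIntegrable q volume a b)
    (hc : ∀ x, x ≠ σ → ContinuousAt q x) {b : ℝ} (hb : 0 < b) :
    ∃ Y : ℝ → ℂ, Continuous Y ∧
      ∀ x ∈ Icc 0 b, Y x = 1 + ∫ t in x..b, ∫ u in t..b, q u * Y u := by
  -- The inner integration gains `1 / l` and the outer one costs at most the length `b`, so this
  -- choice gives contraction constant `1 / 2`.
  set l : ℝ := 2 * b with hl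
  have hl0 : 0 < l := by positivity
  have hn : ∀ a b : ℝ, IntervalIntegrable (fun v => ‖q v‖) volume a b := fun a b => (hq a b).norm
  set Q : ℝ → ℝ := fun u => ∫ v in u..b, ‖q v‖ with hQdef
  have hQ : Continuous Q := continuous_integral_left hn b
  have hQanti : ∀ x t, x ≤ t → t ≤ b → Q t ≤ Q x := by
    intro x t hxt htb
    have := intervalIntegral.integral_add_adjacent_intervals (hn x t) (hn t b)
    have h0 : 0 ≤ ∫ v in x..t, ‖q v‖ :=
      intervalIntegral.integral_nonneg hxt fun _ _ => norm_nonneg _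
    simp only [hQdef]
    linarith
  set e : ℝ → ℝ := fun u => exp (l * Q u) with he
  have hecont : Continuous e := by fun_prop
  have hepos : ∀ u, 0 < e u := fun u => exp_pos _
  have hint : ∀ (y : ℝ → ℂ), Continuous y → ∀ a b : ℝ,
      IntervalIntegrable (fun u => q u * y u) volume a b :=
    fun y hy a b => (hq a b).mul_continuousOn hy.continuousOn
  let X := C(Icc (0 : ℝ) b, ℂ)
  let ex : X → ℝ → ℂ := fun η => IccExtend hb.le η
  have hex : ∀ η, Continuous (ex η) := fun η => η.continuous.Icc_extend'
  let y : X → ℝ → ℂ := fun η u => (e u : ℂ) * ex η u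
  have hy : ∀ η, Continuous (y η) := fun η =>
    (Complex.continuous_ofReal.comp hecont).mul (hex η)
  let J : X → ℝ → ℂ := fun η x => 1 + ∫ t in x..b, ∫ u in t..b, q u * y η u
  have hin : ∀ η, Continuous fun t => ∫ u in t..b, q u * y η u :=
    fun η => continuous_integral_left (hint _ (hy η)) b
  have hJ : ∀ η, Continuous (J η) := fun η =>
    continuous_const.add (continuous_integral_left
      (fun a b => (hin η).intervalIntegrable a b) b)
  -- Instead of changing the norm on `C([0, b])`, the unknown is divided by the weight: `η = Y / e`,
  -- and the Volterra map is conjugated accordingly.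
  let Φ : X → X := fun η => ⟨fun x => ((e x)⁻¹ : ℝ) * J η x, by
    have : Continuous fun x => (e x)⁻¹ := hecont.inv₀ fun x => (hepos x).ne'
    exact ((Complex.continuous_ofReal.comp this).mul (hJ η)).comp continuous_subtype_val⟩
  have hdiff : ∀ η ζ : X, ∀ u ∈ Icc 0 b, ‖y η u - y ζ u‖ ≤ e u * dist η ζ := by
    intro η ζ u hu
    have : y η u - y ζ u = (e u : ℂ) * (η ⟨u, hu⟩ - ζ ⟨u, hu⟩) := by
      simp only [y, ex, IccExtend_of_mem hb.le _ hu]; ring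
    rw [this, norm_mul, Complex.norm_real, norm_of_nonneg (hepos u).le, ← dist_eq_norm]
    exact mul_le_mul_of_nonneg_left (ContinuousMap.dist_apply_le_dist _) (hepos u).le
  have hcontr : ∀ η ζ : X, dist (Φ η) (Φ ζ) ≤ (1 / 2) * dist η ζ := by
    intro η ζ
    rw [ContinuousMap.dist_le (by positivity)]
    rintro ⟨x, hx⟩
    set D := dist η ζ with hD
    have hD0 : 0 ≤ D := dist_nonneg
    have inner : ∀ t ∈ Icc 0 b,
        ‖(∫ u in t..b, q u * y η u) - ∫ u in t..b, q u * y ζ u‖ ≤ D * (e t / l) := by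
      intro t ht
      rw [← intervalIntegral.integral_sub (hint _ (hy η) t b) (hint _ (hy ζ) t b)]
      have h1 := intervalIntegral.norm_integral_le_of_norm_le (μ := volume)
        (f := fun u => q u * y η u - q u * y ζ u)
        (g := fun u => D * (‖q u‖ * e u)) ht.2 (by
          refine Filter.Eventually.of_forall fun u hu => ?_
          rw [← mul_sub, norm_mul]
          have := hdiff η ζ u ⟨ht.1.trans hu.1.le, hu.2⟩
          calc ‖q u‖ * ‖y η u - y ζ u‖ ≤ ‖q u‖ * (e u * D) := by gcongr
            _ = _ := by ring)
        (((hn t b).mul_continuousOn hecont.continuousOn).const_mul D)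
      refine h1.trans ?_
      rw [intervalIntegral.integral_const_mul]
      refine mul_le_mul_of_nonneg_left ?_ hD0
      simp only [he, hQdef]
      rw [integral_norm_mul_exp_primitive hq hc hl0 ht.2]
      gcongr
      linarith
    have outer : ‖J η x - J ζ x‖ ≤ D * (e x / l) * b := by
      have : J η x - J ζ x = ∫ t in x..b,
          ((∫ u in t..b, q u * y η u) - ∫ u in t..b, q u * y ζ u) := by
        rw [intervalIntegral.integral_sub ((hin η).intervalIntegrable _ _)
          ((hin ζ).intervalIntegrable _ _)]
        simp [J]
      rw [this]
      refine (intervalIntegral.norm_integral_le_of_norm_le_const (C := D * (e x / l)) ?_).trans ?_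
      · intro t ht
        rw [uIoc_of_le hx.2] at ht
        refine (inner t ⟨hx.1.trans ht.1.le, ht.2⟩).trans ?_
        have : e t ≤ e x := exp_le_exp.2
          (mul_le_mul_of_nonneg_left (hQanti x t ht.1.le ht.2) hl0.le)
        gcongr
      · rw [abs_of_nonneg (by linarith [hx.2])]
        have := hepos x
        gcongr
        linarith [hx.1]
    have : dist (Φ η ⟨x, hx⟩) (Φ ζ ⟨x, hx⟩) = (e x)⁻¹ * ‖J η x - J ζ x‖ := by
      rw [dist_eq_norm]
      change ‖((e x)⁻¹ : ℝ) * J η x - ((e x)⁻¹ : ℝ) * J ζ x‖ = _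
      rw [← mul_sub, norm_mul, Complex.norm_real, norm_of_nonneg (inv_nonneg.2 (hepos x).le)]
    rw [this]
    calc (e x)⁻¹ * ‖J η x - J ζ x‖ ≤ (e x)⁻¹ * (D * (e x / l) * b) := by
          have := hepos x
          gcongr
      _ = 1 / 2 * D := by
          have := (hepos x).ne'
          rw [hl]; field_simp
  have hC : ContractingWith (1 / 2 : NNReal) Φ :=
    ⟨by rw [← NNReal.coe_lt_coe]; norm_num,
      LipschitzWith.of_dist_le_mul fun η ζ => by simpa using hcontr η ζ⟩
  have hfix : Φ (hC.fixedPoint Φ) = hC.fixedPoint Φ := hC.fixedPoint_isFixedPt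
  set η := hC.fixedPoint Φ
  refine ⟨y η, hy η, fun x hx => ?_⟩
  have h1 : η ⟨x, hx⟩ = ((e x)⁻¹ : ℝ) * J η x := by
    conv_lhs => rw [← hfix]
    rfl
  have h2 : y η x = e x * η ⟨x, hx⟩ := by
    simp only [y, ex, IccExtend_of_mem hb.le _ hx]
  rw [h2, h1, ← mul_assoc, ← Complex.ofReal_mul, mul_inv_cancel₀ (hepos x).ne']
  simp [J]

/-- Solutions of `Y'' = q Y` on `[0, b]` in the class of continuously differentiable functions,
with Neumann condition at `b`. -/
structure IsNeumannSolution (q : ℝ → ℂ) (σ b : ℝ) (Y Z : ℝ → ℂ) : Prop where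
  cont : Continuous Y
  cont' : Continuous Z
  deriv : ∀ x ∈ Ioo 0 b, HasDerivAt Y (Z x) x
  deriv' : ∀ x ∈ Ioo 0 b, x ≠ σ → HasDerivAt Z (q x * Y x) x
  deriv_right : Z b = 0

theorem exists_isNeumannSolution (hq : ∀ a b : ℝ, IntervalIntegrable q volume a b)
    (hc : ∀ x, x ≠ σ → ContinuousAt q x) {b : ℝ} (hb : 0 < b) :
    ∃ Y Z : ℝ → ℂ, IsNeumannSolution q σ b Y Z ∧ Y b = 1 := by
  obtain ⟨Y, hY, hYeq⟩ := exists_volterra_solution hq hc hb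
  have hint : ∀ a b : ℝ, IntervalIntegrable (fun u => q u * Y u) volume a b :=
    fun a b => (hq a b).mul_continuousOn hY.continuousOn
  have hin : Continuous fun t => ∫ u in t..b, q u * Y u := continuous_integral_left hint b
  refine ⟨Y, fun t => -∫ u in t..b, q u * Y u, ⟨hY, hin.neg, fun x hx => ?_, fun x hx hxs => ?_,
    by simp⟩, by simpa using hYeq b ⟨hb.le, le_rfl⟩⟩
  · have h := (hasDerivAt_integral_left (fun a b => hin.intervalIntegrable a b)
      hin.continuousAt b (x := x)).const_add 1
    refine h.congr_of_eventuallyEq ?_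
    filter_upwards [Icc_mem_nhds hx.1 hx.2] with u hu using hYeq u hu
  · have h := (hasDerivAt_integral_left hint ((hc x hxs).mul hY.continuousAt) b).neg
    rw [neg_neg] at h
    exact h

theorem IsNeumannSolution.const_mul {b : ℝ} {Y Z : ℝ → ℂ} (h : IsNeumannSolution q σ b Y Z)
    (c : ℂ) : IsNeumannSolution q σ b (fun x => c * Y x) (fun x => c * Z x) where
  cont := continuous_const.mul h.cont
  cont' := continuous_const.mul h.cont'
  deriv x hx := (h.deriv x hx).const_mul c
  deriv' x hx hxs := ((h.deriv' x hx hxs).const_mul c).congr_deriv (by ring)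
  deriv_right := by simp [h.deriv_right]

end Volterra

/-! ### Poincaré inequalities with a weight -/

section WeightedInequalities

/-- Cauchy–Schwarz, obtained from the nonnegativity of the variance of `g` on `[x, y]`. -/
theorem sq_integral_le {g : ℝ → ℝ} (hg : Continuous g) {x y : ℝ} (hxy : x ≤ y) :
    (∫ t in x..y, g t) ^ 2 ≤ (y - x) * ∫ t in x..y, g t ^ 2 := by
  rcases hxy.eq_or_lt with rfl | hlt
  · simp
  set I := ∫ t in x..y, g t
  set m := I / (y - x) with hm
  have h0 : 0 ≤ ∫ t in x..y, (g t - m) ^ 2 :=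
    intervalIntegral.integral_nonneg hxy fun _ _ => sq_nonneg _
  have h1 : ∫ t in x..y, (g t - m) ^ 2
      = (∫ t in x..y, g t ^ 2) - 2 * m * I + m ^ 2 * (y - x) := by
    have e : ∀ t, (g t - m) ^ 2 = (g t ^ 2 - 2 * m * g t) + m ^ 2 := fun t => by ring
    simp_rw [e]
    rw [intervalIntegral.integral_add, intervalIntegral.integral_sub,
      intervalIntegral.integral_const_mul, intervalIntegral.integral_const, smul_eq_mul]
    · ring
    all_goals exact Continuous.intervalIntegrable (by fun_prop) _ _
  have hpos : 0 < y - x := sub_pos.2 hlt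
  have h2 : I = m * (y - x) := by rw [hm]; field_simp
  rw [h1] at h0
  rw [h2] at h0 ⊢
  nlinarith

variable {f g : ℝ → ℂ} {a b : ℝ}

theorem sq_norm_sub_le (hf : Continuous f) (hg : Continuous g)
    (hd : ∀ x ∈ Ioo a b, HasDerivAt f (g x) x) {x y : ℝ} (hax : a ≤ x) (hxy : x ≤ y)
    (hyb : y ≤ b) : ‖f y - f x‖ ^ 2 ≤ (y - x) * ∫ t in x..y, ‖g t‖ ^ 2 := by
  rw [← intervalIntegral.integral_eq_sub_of_hasDerivAt_of_le hxy hf.continuousOn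
    (fun t ht => hd t ⟨hax.trans_lt ht.1, ht.2.trans_le hyb⟩) (hg.intervalIntegrable _ _)]
  calc ‖∫ t in x..y, g t‖ ^ 2 ≤ (∫ t in x..y, ‖g t‖) ^ 2 := by
        gcongr
        exact intervalIntegral.norm_integral_le_integral_norm hxy
    _ ≤ _ := sq_integral_le hg.norm hxy

theorem sq_norm_le_of_mem (hf : Continuous f) (hg : Continuous g)
    (hd : ∀ x ∈ Ioo a b, HasDerivAt f (g x) x) {p r x y : ℝ} (hap : a ≤ p) (hrb : r ≤ b)
    (hx : x ∈ Icc p r) (hy : y ∈ Icc p r) :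
    ‖f x‖ ^ 2 ≤ 2 * ‖f y‖ ^ 2 + 2 * ((r - p) * ∫ t in a..b, ‖g t‖ ^ 2) := by
  have hint : ∀ u v : ℝ, IntervalIntegrable (fun t => ‖g t‖ ^ 2) volume u v :=
    fun u v => Continuous.intervalIntegrable (by fun_prop) _ _
  have key : ∀ u v : ℝ, p ≤ u → u ≤ v → v ≤ r →
      ‖f v - f u‖ ^ 2 ≤ (r - p) * ∫ t in a..b, ‖g t‖ ^ 2 := by
    intro u v hu huv hv
    refine (sq_norm_sub_le hf hg hd (hap.trans hu) huv (hv.trans hrb)).trans ?_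
    refine mul_le_mul (by linarith) ?_
      (intervalIntegral.integral_nonneg huv fun _ _ => sq_nonneg _) (by linarith)
    refine intervalIntegral.integral_mono_interval (hap.trans hu) huv (hv.trans hrb) ?_ (hint _ _)
    exact Filter.Eventually.of_forall fun _ => sq_nonneg _
  have h1 : ‖f x - f y‖ ^ 2 ≤ (r - p) * ∫ t in a..b, ‖g t‖ ^ 2 := by
    rcases le_total x y with h | h
    · rw [norm_sub_rev]; exact key x y hx.1 h hy.2
    · exact key y x hy.1 h hx.2
  have h2 : ‖f x‖ ≤ ‖f y‖ + ‖f x - f y‖ := by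
    simpa using norm_add_le (f y) (f x - f y)
  have h3 : ‖f x‖ ^ 2 ≤ (‖f y‖ + ‖f x - f y‖) ^ 2 := by gcongr
  nlinarith [sq_nonneg (‖f y‖ - ‖f x - f y‖)]

/-- On a window `[p, r]` the value at `x` differs from any other value by the derivative term;
averaging the resulting inequality against `ω` over the window replaces the other value by the
damping integral. -/
theorem weight_mul_sq_norm_le {ω : ℝ → ℝ} (h0 : ∀ x, 0 ≤ ω x)
    (hω : ∀ a b : ℝ, IntervalIntegrable ω volume a b) (hf : Continuous f) (hg : Continuous g)
    (hd : ∀ x ∈ Ioo a b, HasDerivAt f (g x) x) {p r x : ℝ} (hap : a ≤ p) (hrb : r ≤ b)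
    (hx : x ∈ Icc p r) :
    ‖f x‖ ^ 2 * ∫ t in p..r, ω t ≤ 2 * (∫ t in a..b, ω t * ‖f t‖ ^ 2)
      + 2 * ((r - p) * ∫ t in a..b, ‖g t‖ ^ 2) * ∫ t in p..r, ω t := by
  have hpr : p ≤ r := hx.1.trans hx.2
  have hfi : ∀ u v : ℝ, IntervalIntegrable (fun t => ω t * ‖f t‖ ^ 2) volume u v :=
    fun u v => (hω u v).mul_continuousOn (by fun_prop)
  set D := 2 * ((r - p) * ∫ t in a..b, ‖g t‖ ^ 2)
  have h1 : ∫ t in p..r, ‖f x‖ ^ 2 * ω t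
      ≤ ∫ t in p..r, (2 * (ω t * ‖f t‖ ^ 2) + D * ω t) := by
    refine intervalIntegral.integral_mono_on hpr ((hω _ _).const_mul _)
      (((hfi _ _).const_mul _).add ((hω _ _).const_mul _)) fun t ht => ?_
    have := sq_norm_le_of_mem hf hg hd hap hrb hx ht
    nlinarith [h0 t]
  rw [intervalIntegral.integral_const_mul,
    intervalIntegral.integral_add ((hfi _ _).const_mul _) ((hω _ _).const_mul _),
    intervalIntegral.integral_const_mul, intervalIntegral.integral_const_mul] at h1
  refine h1.trans ?_
  gcongr
  exact intervalIntegral.integral_mono_interval hap hpr hrb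
    (Filter.Eventually.of_forall fun t => mul_nonneg (h0 t) (sq_nonneg _)) (hfi _ _)

end WeightedInequalities

/-- Radial profiles of the dampings considered: they vanish on `[0, π/2)`, and are bounded below
by a multiple of `(x - π/2) ^ β` on `(π/2, π]`. -/
structure IsProfile (β : ℝ) (ω : ℝ → ℝ) : Prop where
  meas : Measurable ω
  nonneg : ∀ x, 0 ≤ ω x
  zero : ∀ x, x < π / 2 → ω x = 0
  cont : ∀ x, x ≠ π / 2 → ContinuousAt ω x
  int : ∀ a b : ℝ, IntervalIntegrable ω volume a b
  lower : ∃ c, 0 < c ∧ ∀ x ∈ Ioc (π / 2) π, c * (x - π / 2) ^ β ≤ ω x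

/-! ### Control of a function by the damping term -/

namespace IsProfile

variable {β : ℝ} {ω : ℝ → ℝ}

theorem pos (h : IsProfile β ω) {x : ℝ} (hx : x ∈ Ioc (π / 2) π) : 0 < ω x := by
  obtain ⟨c, hc, hl⟩ := h.lower
  exact (mul_pos hc (rpow_pos_of_pos (sub_pos.2 hx.1) _)).trans_le (hl x hx)

/-- The mass of `ω` in a window of fixed length depends continuously on the window and is positive,
so it attains a positive minimum over the compact set of positions. -/
theorem exists_window_bound (h : IsProfile β ω) {d : ℝ} (hd : 0 < d) (hd' : d ≤ π / 2) :
    ∃ m, 0 < m ∧ ∀ p ∈ Icc (π / 2) (π - d), m ≤ ∫ t in p..p + d, ω t := by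
  have hcont : Continuous fun p => ∫ t in p..p + d, ω t := by
    have h1 := intervalIntegral.continuous_primitive h.int 0
    have : (fun p => ∫ t in p..p + d, ω t)
        = fun p => (∫ t in (0 : ℝ)..p + d, ω t) - ∫ t in (0 : ℝ)..p, ω t := by
      funext p
      rw [intervalIntegral.integral_interval_sub_left (h.int _ _) (h.int _ _)]
    rw [this]
    fun_prop
  obtain ⟨p, hp, hmin⟩ := (isCompact_Icc (a := π / 2) (b := π - d)).exists_isMinOn
    ⟨π / 2, le_rfl, by linarith⟩ hcont.continuousOn
  refine ⟨∫ t in p..p + d, ω t, ?_, fun r hr => hmin hr⟩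
  refine intervalIntegral.intervalIntegral_pos_of_pos_on (h.int _ _) (fun x hx => ?_) (by linarith)
  exact h.pos ⟨hp.1.trans_lt hx.1, by linarith [hx.2, hp.2]⟩

/-- Away from a thin layer the damping controls the function. -/
theorem exists_pointwise_bound (h : IsProfile β ω) :
    ∃ k₀ : ℝ, 0 < k₀ ∧ ∀ k, k₀ ≤ k → ∀ f g : ℝ → ℂ, Continuous f → Continuous g →
      (∀ x ∈ Ioo (π / 2) π, HasDerivAt f (g x) x) → ∀ x ∈ Icc (π / 2) π,
        ‖f x‖ ^ 2 ≤ (1 / 32) * ((∫ t in (π / 2)..π, ‖g t‖ ^ 2)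
          + k * ∫ t in (π / 2)..π, ω t * ‖f t‖ ^ 2) := by
  obtain ⟨m, hm, hmin⟩ := h.exists_window_bound (d := 1 / 64) (by norm_num)
    (by linarith [pi_gt_three])
  -- A window of length `1 / 64` makes the derivative term exactly `A / 32`; with `k ≥ 64 / m` the
  -- damping term is at most `k B / 32`.
  refine ⟨64 / m, by positivity, fun k hk f g hf hg hd x hx => ?_⟩
  have hB : 0 ≤ ∫ t in (π / 2)..π, ω t * ‖f t‖ ^ 2 :=
    intervalIntegral.integral_nonneg (by linarith [pi_pos])
      fun t _ => mul_nonneg (h.nonneg t) (sq_nonneg _)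
  set A := ∫ t in (π / 2)..π, ‖g t‖ ^ 2
  set B := ∫ t in (π / 2)..π, ω t * ‖f t‖ ^ 2
  obtain ⟨p, hp, hxp⟩ : ∃ p ∈ Icc (π / 2) (π - 1 / 64), x ∈ Icc p (p + 1 / 64) := by
    rcases le_total x (π - 1 / 64) with h1 | h1
    · exact ⟨x, ⟨hx.1, h1⟩, le_rfl, by linarith⟩
    · exact ⟨π - 1 / 64, ⟨by linarith [pi_gt_three], le_rfl⟩, h1, by linarith [hx.2]⟩
  have h1 := weight_mul_sq_norm_le h.nonneg h.int hf hg hd hp.1 (by linarith [hp.2]) hxp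
  have h2 := hmin p hp
  set O := ∫ t in p..p + 1 / 64, ω t
  have hO : 0 < O := hm.trans_le h2
  rw [add_sub_cancel_left] at h1
  have h3 : ‖f x‖ ^ 2 ≤ 2 * B / O + A / 32 := by
    rw [← sub_le_iff_le_add, le_div_iff₀ hO]
    linarith
  have h4 : 2 * B / O ≤ k * B / 32 := by
    have : 64 ≤ k * O := by
      rw [div_le_iff₀ hm] at hk
      have hk0 : 0 < k := by
        by_contra! hneg
        nlinarith
      nlinarith
    rw [div_le_iff₀ hO]
    nlinarith
  linarith

/-- The trace at the edge of the damping, when `k` is matched to the boundary layer `δ`. -/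
theorem exists_trace_bound (h : IsProfile β ω) (hβ : -1 < β) :
    ∃ K : ℝ, 0 < K ∧ ∀ k δ, 0 < k → 0 < δ → δ ≤ π / 2 → k * δ ^ (β + 2) = 1 →
      ∀ f g : ℝ → ℂ, Continuous f → Continuous g →
      (∀ x ∈ Ioo (π / 2) π, HasDerivAt f (g x) x) →
        ‖f (π / 2)‖ ^ 2 ≤ K * δ * ((∫ t in (π / 2)..π, ‖g t‖ ^ 2)
          + k * ∫ t in (π / 2)..π, ω t * ‖f t‖ ^ 2) := by
  obtain ⟨c, hc, hl⟩ := h.lower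
  have hβ1 : 0 < β + 1 := by linarith
  refine ⟨2 + 2 * (β + 1) / c, by positivity, fun k δ hk hδ hδ' hkδ f g hf hg hd => ?_⟩
  have hB : 0 ≤ ∫ t in (π / 2)..π, ω t * ‖f t‖ ^ 2 :=
    intervalIntegral.integral_nonneg (by linarith [pi_pos])
      fun t _ => mul_nonneg (h.nonneg t) (sq_nonneg _)
  have hA : 0 ≤ ∫ t in (π / 2)..π, ‖g t‖ ^ 2 :=
    intervalIntegral.integral_nonneg (by linarith [pi_pos]) fun t _ => sq_nonneg _
  have h1 := weight_mul_sq_norm_le h.nonneg h.int hf hg hd le_rfl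
    (by linarith : π / 2 + δ ≤ π) (x := π / 2) ⟨le_rfl, by linarith⟩
  set A := ∫ t in (π / 2)..π, ‖g t‖ ^ 2
  set B := ∫ t in (π / 2)..π, ω t * ‖f t‖ ^ 2
  -- The mass of the damping in the layer of width `δ` next to the edge, bounded below by the
  -- integral of the model power.
  have h2 : c / (β + 1) * δ ^ (β + 1) ≤ ∫ t in (π / 2)..(π / 2 + δ), ω t := by
    have hi : ∫ t in (π / 2)..(π / 2 + δ), c * (t - π / 2) ^ β = c / (β + 1) * δ ^ (β + 1) := by
      rw [intervalIntegral.integral_const_mul,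
        intervalIntegral.integral_comp_sub_right (fun t => t ^ β) (π / 2)]
      simp only [sub_self, add_sub_cancel_left]
      rw [integral_rpow (Or.inl hβ), zero_rpow hβ1.ne']
      ring
    rw [← hi]
    refine intervalIntegral.integral_mono_on_of_le_Ioo (by linarith) ?_ (h.int _ _)
      fun t ht => hl t ⟨ht.1, by linarith [ht.2]⟩
    have := ((intervalIntegral.intervalIntegrable_rpow' hβ (a := 0) (b := δ)).comp_sub_right
      (π / 2)).const_mul c
    simpa [add_comm] using this
  set O := ∫ t in (π / 2)..(π / 2 + δ), ω t
  have hδβ : 0 < δ ^ (β + 1) := rpow_pos_of_pos hδ _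
  have hO : 0 < O := lt_of_lt_of_le (by positivity) h2
  rw [add_sub_cancel_left] at h1
  have h3 : ‖f (π / 2)‖ ^ 2 ≤ 2 * B / O + 2 * (δ * A) := by
    rw [← sub_le_iff_le_add, le_div_iff₀ hO]
    linarith
  -- Here the width is matched to the frequency: `1 / δ ^ (β + 1) = k δ`, so both terms carry the
  -- same factor `δ`.
  have h4 : 2 * B / O ≤ 2 * (β + 1) / c * δ * (k * B) := by
    have e : k * δ * δ ^ (β + 1) = 1 := by
      have e' : δ * δ ^ (β + 1) = δ ^ (β + 2) := by
        rw [← rpow_one_add' hδ.le (by linarith)]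
        congr 1
        ring
      rw [mul_assoc, e', hkδ]
    have h5 : 1 ≤ (β + 1) / c * δ * k * O := by
      calc (1 : ℝ) = k * δ * δ ^ (β + 1) := e.symm
        _ = (β + 1) / c * δ * k * (c / (β + 1) * δ ^ (β + 1)) := by field_simp
        _ ≤ _ := by gcongr
    rw [div_le_iff₀ hO]
    calc 2 * B = 2 * B * 1 := by ring
      _ ≤ 2 * B * ((β + 1) / c * δ * k * O) := by gcongr
      _ = _ := by ring
  calc ‖f (π / 2)‖ ^ 2 ≤ 2 * (β + 1) / c * δ * (k * B) + 2 * (δ * A) := by linarith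
    _ ≤ (2 + 2 * (β + 1) / c) * δ * (A + k * B) := by
      have h6 : 0 ≤ 2 * (β + 1) / c * δ * A := by positivity
      have h7 : 0 ≤ 2 * δ * (k * B) := by positivity
      nlinarith

end IsProfile

/-! ### Integral identities for Neumann solutions -/

section Identities

variable {q q₁ q₂ : ℝ → ℂ} {σ b : ℝ} {Y Z Y₁ Z₁ Y₂ Z₂ : ℝ → ℂ}

/-- The integrand is the derivative of `Z conj(Y)`, and the boundary term at `b` vanishes by the
Neumann condition. -/
theorem IsNeumannSolution.energy_identity (h : IsNeumannSolution q σ b Y Z)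
    (hq : ∀ a b : ℝ, IntervalIntegrable q volume a b) {a : ℝ} (ha : 0 ≤ a) (hab : a ≤ b) :
    ∫ x in a..b, (((‖Z x‖ ^ 2 : ℝ) : ℂ) + q x * ((‖Y x‖ ^ 2 : ℝ) : ℂ))
      = -(Z a * (starRingEnd ℂ) (Y a)) := by
  have hY := h.cont
  have hZ := h.cont'
  rw [MeasureTheory.integral_eq_of_hasDerivAt_off_countable_of_le
    (fun x => Z x * (starRingEnd ℂ) (Y x)) _ hab (countable_singleton σ)
    (Continuous.continuousOn (by fun_prop))]
  · simp [h.deriv_right]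
  · rintro x ⟨hx, hxs⟩
    have hx0 : x ∈ Ioo 0 b := ⟨ha.trans_lt hx.1, hx.2⟩
    have h1 : HasDerivAt (fun x => (starRingEnd ℂ) (Y x)) ((starRingEnd ℂ) (Z x)) x :=
      (h.deriv x hx0).star
    refine ((h.deriv' x hx0 hxs).mul h1).congr_deriv ?_
    have e : ∀ z : ℂ, ((‖z‖ ^ 2 : ℝ) : ℂ) = z * (starRingEnd ℂ) z := fun z => by
      rw [Complex.mul_conj, Complex.normSq_eq_norm_sq]
    rw [e, e]
    ring
  · exact (Continuous.intervalIntegrable (by fun_prop) _ _).add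
      ((hq _ _).mul_continuousOn (Continuous.continuousOn (by fun_prop)))

/-- The derivative of the Wronskian is the difference of the potentials times the product of the
solutions. This is how the dependence of a solution on the spectral parameter is estimated below,
without differentiating in the parameter. -/
theorem IsNeumannSolution.wronskian_identity (h₁ : IsNeumannSolution q₁ σ b Y₁ Z₁)
    (h₂ : IsNeumannSolution q₂ σ b Y₂ Z₂) (hq₁ : ∀ a b : ℝ, IntervalIntegrable q₁ volume a b)
    (hq₂ : ∀ a b : ℝ, IntervalIntegrable q₂ volume a b) {a : ℝ} (ha : 0 ≤ a) (hab : a ≤ b) :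
    ∫ x in a..b, (q₁ x - q₂ x) * (Y₁ x * Y₂ x) = Y₁ a * Z₂ a - Z₁ a * Y₂ a := by
  have hY₁ := h₁.cont
  have hZ₁ := h₁.cont'
  have hY₂ := h₂.cont
  have hZ₂ := h₂.cont'
  rw [MeasureTheory.integral_eq_of_hasDerivAt_off_countable_of_le
    (fun x => Z₁ x * Y₂ x - Y₁ x * Z₂ x) _ hab (countable_singleton σ)
    (Continuous.continuousOn (by fun_prop))]
  · simp [h₁.deriv_right, h₂.deriv_right]
  · rintro x ⟨hx, hxs⟩
    have hx0 : x ∈ Ioo 0 b := ⟨ha.trans_lt hx.1, hx.2⟩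
    refine (((h₁.deriv' x hx0 hxs).mul (h₂.deriv x hx0)).sub
      ((h₁.deriv x hx0).mul (h₂.deriv' x hx0 hxs))).congr_deriv ?_
    ring
  · exact ((hq₁ _ _).sub (hq₂ _ _)).mul_continuousOn (Continuous.continuousOn (by fun_prop))

/-- Where the potential is the constant `-s²`, the solution is transported explicitly. -/
theorem IsNeumannSolution.deriv_zero_eq (h : IsNeumannSolution q σ b Y Z) {s : ℂ}
    (hσ : 0 ≤ σ) (hσb : σ ≤ b) (hq : ∀ x, x < σ → q x = -s ^ 2) :
    Z 0 = Z σ * Complex.cos (s * σ) + s * Y σ * Complex.sin (s * σ) := by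
  have hY := h.cont
  have hZ := h.cont'
  -- For `Y'' = -s² Y` the quantity `Z cos(sx) + s Y sin(sx)` is conserved, and at `x = 0` it is `Z
  -- 0`.
  have key := MeasureTheory.integral_eq_of_hasDerivAt_off_countable_of_le
    (fun x : ℝ => Z x * Complex.cos (s * x) + s * Y x * Complex.sin (s * x)) (fun _ => 0) hσ
    (countable_singleton σ) (Continuous.continuousOn (by fun_prop)) (by
      rintro x ⟨hx, hxs⟩
      have hx0 : x ∈ Ioo 0 b := ⟨hx.1, hx.2.trans_le hσb⟩
      have hl : HasDerivAt (fun x : ℝ => s * (x : ℂ)) s x := by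
        simpa using (Complex.ofRealCLM.hasDerivAt (x := x)).const_mul s
      have hcos := (Complex.hasDerivAt_cos (s * x)).comp x hl
      have hsin := (Complex.hasDerivAt_sin (s * x)).comp x hl
      refine (((h.deriv' x hx0 hxs).mul hcos).add
        (((h.deriv x hx0).const_mul s).mul hsin)).congr_deriv ?_
      simp only [Function.comp_apply, hq x hx.2]
      ring) (by simp)
  simp only [intervalIntegral.integral_zero, Complex.ofReal_zero, mul_zero, Complex.cos_zero,
    mul_one, Complex.sin_zero, add_zero] at key
  linear_combination key

end Identities

/-! ### The potential of the damped strip and its spectral parameters -/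

theorem intervalIntegrable_ofReal {f : ℝ → ℝ} {a b : ℝ} (h : IntervalIntegrable f volume a b) :
    IntervalIntegrable (fun x => (f x : ℂ)) volume a b :=
  ⟨h.1.ofReal, h.2.ofReal⟩

/-- The potential `-(s² + i τ ω)`. -/
def potential (ω : ℝ → ℝ) (s τ : ℂ) (x : ℝ) : ℂ := -(s ^ 2 + Complex.I * τ * ω x)

namespace IsProfile

variable {β : ℝ} {ω : ℝ → ℝ}

theorem intervalIntegrable_potential (h : IsProfile β ω) (s τ : ℂ) (a b : ℝ) :
    IntervalIntegrable (potential ω s τ) volume a b :=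
  (intervalIntegrable_const.add ((intervalIntegrable_ofReal (h.int a b)).const_mul _)).neg

theorem continuousAt_potential (h : IsProfile β ω) (s τ : ℂ) (x : ℝ) (hx : x ≠ π / 2) :
    ContinuousAt (potential ω s τ) x :=
  (continuousAt_const.add (continuousAt_const.mul
    (Complex.continuous_ofReal.continuousAt.comp (h.cont x hx)))).neg

theorem energy_identity (h : IsProfile β ω) {s τ : ℂ} {Y Z : ℝ → ℂ}
    (hYZ : IsNeumannSolution (potential ω s τ) (π / 2) π Y Z) {a : ℝ} (ha : 0 ≤ a) (hab : a ≤ π) :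
    ((∫ x in a..π, ‖Z x‖ ^ 2 : ℝ) : ℂ) - s ^ 2 * (∫ x in a..π, ‖Y x‖ ^ 2 : ℝ)
      - Complex.I * τ * (∫ x in a..π, ω x * ‖Y x‖ ^ 2 : ℝ)
      = -(Z a * (starRingEnd ℂ) (Y a)) := by
  have hY := hYZ.cont
  have hZ := hYZ.cont'
  rw [← hYZ.energy_identity (h.intervalIntegrable_potential s τ) ha hab,
    ← intervalIntegral.integral_ofReal, ← intervalIntegral.integral_ofReal,
    ← intervalIntegral.integral_ofReal, ← intervalIntegral.integral_const_mul,
    ← intervalIntegral.integral_const_mul, ← intervalIntegral.integral_sub,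
    ← intervalIntegral.integral_sub]
  · refine intervalIntegral.integral_congr fun x _ => ?_
    simp only [potential]
    push_cast
    ring
  · exact Continuous.intervalIntegrable (by fun_prop) _ _
  · refine IntervalIntegrable.const_mul ?_ _
    exact intervalIntegrable_ofReal
      ((h.int _ _).mul_continuousOn (g := fun x => ‖Y x‖ ^ 2)
        (Continuous.continuousOn (by fun_prop)))
  · exact Continuous.intervalIntegrable (by fun_prop) _ _
  · exact Continuous.intervalIntegrable (by fun_prop) _ _

end IsProfile

/-- Spectral parameters near the first Dirichlet eigenvalue of the undamped strip, at
frequency `k`. -/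
structure IsAdmissible (k : ℝ) (s τ : ℂ) : Prop where
  near : ‖s - 1‖ ≤ 1 / 4
  sq_eq : τ ^ 2 = k ^ 2 + s ^ 2
  re_nonneg : 0 ≤ τ.re

namespace IsAdmissible

variable {k : ℝ} {s τ s₁ τ₁ s₂ τ₂ : ℂ}

theorem norm_le (h : IsAdmissible k s τ) : ‖s‖ ≤ 5 / 4 := by
  have := norm_add_le (s - 1) 1
  rw [sub_add_cancel, norm_one] at this
  linarith [h.near]

theorem norm_sq_le (h : IsAdmissible k s τ) : ‖s ^ 2‖ ≤ 2 := by
  rw [norm_pow]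
  nlinarith [h.norm_le, norm_nonneg s]

theorem re_sq_nonneg (h : IsAdmissible k s τ) : 0 ≤ (s ^ 2).re := by
  have h1 := (Complex.abs_re_le_norm (s - 1)).trans h.near
  have h2 := (Complex.abs_im_le_norm (s - 1)).trans h.near
  simp only [Complex.sub_re, Complex.one_re, Complex.sub_im, Complex.one_im, abs_le] at h1 h2
  have : (s ^ 2).re = s.re * s.re - s.im * s.im := by rw [sq, Complex.mul_re]
  rw [this]
  nlinarith

theorem re_sq_eq (h : IsAdmissible k s τ) : τ.re ^ 2 - τ.im ^ 2 = k ^ 2 + (s ^ 2).re := by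
  have := congrArg Complex.re h.sq_eq
  rw [sq τ, Complex.mul_re, Complex.add_re, ← Complex.ofReal_pow, Complex.ofReal_re] at this
  linarith

theorem im_sq_eq (h : IsAdmissible k s τ) : 2 * τ.re * τ.im = (s ^ 2).im := by
  have := congrArg Complex.im h.sq_eq
  rw [sq τ, Complex.mul_im, Complex.add_im, ← Complex.ofReal_pow, Complex.ofReal_im] at this
  linarith

/-- Because `s` is near `1`, `Re s² ≥ 0`, hence `(Re τ)² ≥ k²`. -/
theorem le_re (h : IsAdmissible k s τ) : k ≤ τ.re := by
  refine le_of_sq_le_sq ?_ h.re_nonneg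
  nlinarith [h.re_sq_eq, h.re_sq_nonneg, sq_nonneg τ.im]
where
  le_of_sq_le_sq {a b : ℝ} (h : a ^ 2 ≤ b ^ 2) (hb : 0 ≤ b) : a ≤ b := abs_le_of_sq_le_sq' h hb |>.2

/-- From `2 Re τ Im τ = Im s²` and `Re τ ≥ k`. Through this factor `1 / k`, a displacement of `s` by
`δ` becomes a decay rate of order `δ / k`. -/
theorem abs_im_le (h : IsAdmissible k s τ) (hk : 0 < k) : |τ.im| ≤ |(s ^ 2).im| / (2 * k) := by
  rw [le_div_iff₀ (by positivity), ← h.im_sq_eq, abs_mul, abs_of_nonneg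
    (by linarith [h.le_re] : (0 : ℝ) ≤ 2 * τ.re)]
  nlinarith [h.le_re, abs_nonneg τ.im]

theorem abs_im_le_inv (h : IsAdmissible k s τ) (hk : 0 < k) : |τ.im| ≤ 1 / k := by
  refine (h.abs_im_le hk).trans ?_
  have := (Complex.abs_im_le_norm (s ^ 2)).trans h.norm_sq_le
  rw [div_le_div_iff₀ (by positivity) hk]
  nlinarith

/-- Since `s₁² - s₂² = (τ₁ - τ₂)(τ₁ + τ₂)` and `Re (τ₁ + τ₂) ≥ 2k`, the root `τ` varies in a
Lipschitz way with `s²`; the condition `0 ≤ Re τ` fixes the branch. -/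
theorem norm_sub_le (h₁ : IsAdmissible k s₁ τ₁) (h₂ : IsAdmissible k s₂ τ₂) (hk : 0 < k) :
    ‖τ₁ - τ₂‖ ≤ ‖s₁ ^ 2 - s₂ ^ 2‖ / (2 * k) := by
  rw [le_div_iff₀ (by positivity)]
  have e : s₁ ^ 2 - s₂ ^ 2 = (τ₁ - τ₂) * (τ₁ + τ₂) := by
    linear_combination h₂.sq_eq - h₁.sq_eq
  rw [e, norm_mul]
  gcongr
  refine le_trans ?_ (Complex.re_le_norm _)
  rw [Complex.add_re]
  linarith [h₁.le_re, h₂.le_re]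

theorem norm_sq_sub_le (h₁ : IsAdmissible k s₁ τ₁) (h₂ : IsAdmissible k s₂ τ₂) :
    ‖s₁ ^ 2 - s₂ ^ 2‖ ≤ 5 / 2 * ‖s₁ - s₂‖ := by
  rw [sq_sub_sq, norm_mul]
  gcongr
  linarith [norm_add_le s₁ s₂, h₁.norm_le, h₂.norm_le]

end IsAdmissible

theorem exists_isAdmissible (k : ℝ) {s : ℂ} (hs : ‖s - 1‖ ≤ 1 / 4) : ∃ τ, IsAdmissible k s τ := by
  obtain ⟨z, hz⟩ := IsAlgClosed.exists_pow_nat_eq ((k : ℂ) ^ 2 + s ^ 2) (n := 2) (by norm_num)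
  rcases le_total 0 z.re with h | h
  · exact ⟨z, hs, hz, h⟩
  · exact ⟨-z, hs, by rw [neg_sq, hz], by simpa using h⟩

/-- Solutions of the damped problem on the strip, normalized at the edge of the damping, are small
in the boundary layer. -/
theorem IsProfile.exists_normalized_solution {β : ℝ} {ω : ℝ → ℝ} (h : IsProfile β ω)
    (hβ : -1 < β) :
    ∃ K k₀ : ℝ, 0 < K ∧ 2 ≤ k₀ ∧ ∀ k δ, k₀ ≤ k → 0 < δ → δ ≤ π / 2 → k * δ ^ (β + 2) = 1 →
      ∀ s τ, IsAdmissible k s τ → ∃ Y Z : ℝ → ℂ,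
        IsNeumannSolution (potential ω s τ) (π / 2) π Y Z ∧ Z (π / 2) = 1 ∧ Y π ≠ 0 ∧
        ‖Y (π / 2)‖ ≤ K * δ ∧ ∫ x in (π / 2)..π, ‖Y x‖ ^ 2 ≤ K * δ ∧
        k * ∫ x in (π / 2)..π, ω x * ‖Y x‖ ^ 2 ≤ K * δ := by
  obtain ⟨k₁, hk₁, hpt⟩ := h.exists_pointwise_bound
  obtain ⟨K, hK, htr⟩ := h.exists_trace_bound hβ
  refine ⟨9 * K, max 2 k₁, by positivity, le_max_left _ _,
    fun k δ hk hδ hδ' hkδ s τ hst => ?_⟩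
  have hk2 : 2 ≤ k := (le_max_left _ _).trans hk
  have hk0 : 0 < k := by linarith
  have hpi := pi_pos
  have hpi' : π / 2 ≤ π := by linarith
  obtain ⟨Y₀, Z₀, hYZ₀, hY₀⟩ := exists_isNeumannSolution (h.intervalIntegrable_potential s τ)
    (h.continuousAt_potential s τ) pi_pos
  have hd₀ : ∀ {Y Z : ℝ → ℂ}, IsNeumannSolution (potential ω s τ) (π / 2) π Y Z →
      ∀ x ∈ Ioo (π / 2) π, HasDerivAt Y (Z x) x :=
    fun hYZ x hx => hYZ.deriv x ⟨by linarith [hx.1], hx.2⟩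
  -- The a priori estimate: derivative and damping integrals are bounded by the boundary term at the
  -- edge, and the `L²` mass is absorbed.
  have main : ∀ Y Z : ℝ → ℂ, IsNeumannSolution (potential ω s τ) (π / 2) π Y Z →
      (∫ x in (π / 2)..π, ‖Z x‖ ^ 2) + k * (∫ x in (π / 2)..π, ω x * ‖Y x‖ ^ 2)
        ≤ 3 * (‖Z (π / 2)‖ * ‖Y (π / 2)‖) ∧
      ∫ x in (π / 2)..π, ‖Y x‖ ^ 2 ≤ (1 / 16) * ((∫ x in (π / 2)..π, ‖Z x‖ ^ 2)
        + k * (∫ x in (π / 2)..π, ω x * ‖Y x‖ ^ 2)) := by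
    intro Y Z hYZ
    have hY := hYZ.cont
    have hid := h.energy_identity hYZ (a := π / 2) (by positivity) hpi'
    have hp := hpt k ((le_max_right _ _).trans hk) Y Z hYZ.cont hYZ.cont' (hd₀ hYZ)
    have hB : 0 ≤ ∫ x in (π / 2)..π, ω x * ‖Y x‖ ^ 2 :=
      intervalIntegral.integral_nonneg hpi' fun t _ => mul_nonneg (h.nonneg t) (sq_nonneg _)
    have hA : 0 ≤ ∫ x in (π / 2)..π, ‖Z x‖ ^ 2 :=
      intervalIntegral.integral_nonneg hpi' fun t _ => sq_nonneg _
    have hM : 0 ≤ ∫ x in (π / 2)..π, ‖Y x‖ ^ 2 :=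
      intervalIntegral.integral_nonneg hpi' fun t _ => sq_nonneg _
    set A := ∫ x in (π / 2)..π, ‖Z x‖ ^ 2
    set B := ∫ x in (π / 2)..π, ω x * ‖Y x‖ ^ 2
    have hMle : ∫ x in (π / 2)..π, ‖Y x‖ ^ 2 ≤ (1 / 16) * (A + k * B) := by
      have := intervalIntegral.integral_mono_on hpi'
        (Continuous.intervalIntegrable (μ := volume) (by fun_prop) _ _)
        intervalIntegrable_const hp
      rw [intervalIntegral.integral_const, smul_eq_mul] at this
      have hkB : 0 ≤ k * B := by positivity
      nlinarith [pi_lt_d2]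
    set M := ∫ x in (π / 2)..π, ‖Y x‖ ^ 2
    refine ⟨?_, hMle⟩
    -- The real part of the energy identity controls `A` and its imaginary part controls `kB`;
    -- multiplying by `1 + i` takes both at once, with norm `√2 ≤ 3 / 2`.
    have hre := congrArg (fun z => ((1 + Complex.I) * z).re) hid
    have hR : ((1 + Complex.I) * -(Z (π / 2) * (starRingEnd ℂ) (Y (π / 2)))).re
        ≤ 3 / 2 * (‖Z (π / 2)‖ * ‖Y (π / 2)‖) := by
      refine (Complex.re_le_norm _).trans ?_
      rw [norm_mul, norm_neg, norm_mul, RCLike.norm_conj]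
      gcongr
      rw [Complex.norm_def, sqrt_le_left (by norm_num), Complex.normSq_apply]
      norm_num
    have hs := hst.norm_sq_le
    have hs1 := abs_le.1 ((Complex.abs_re_le_norm (s ^ 2)).trans hs)
    have hs2 := abs_le.1 ((Complex.abs_im_le_norm (s ^ 2)).trans hs)
    have ht := abs_le.1 (hst.abs_im_le_inv hk0)
    -- Uses `k ≥ 2`; then `Re τ + Im τ ≥ k - 1 / k ≥ 3k / 4`.
    have hkk : 1 / k ≤ k / 4 := by
      rw [div_le_div_iff₀ hk0 (by norm_num)]
      nlinarith
    have hL : ((1 + Complex.I) * ((A : ℂ) - s ^ 2 * M - Complex.I * τ * B)).re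
        = A - ((s ^ 2).re - (s ^ 2).im) * M + (τ.re + τ.im) * B := by
      simp only [Complex.mul_re, Complex.mul_im, Complex.add_re, Complex.add_im, Complex.sub_re,
        Complex.sub_im, Complex.one_re, Complex.one_im, Complex.I_re, Complex.I_im,
        Complex.ofReal_re, Complex.ofReal_im]
      ring
    rw [hL] at hre
    rw [← hre] at hR
    have h1 : ((s ^ 2).re - (s ^ 2).im) * M ≤ 4 * M := by
      gcongr
      linarith
    have h2 : 3 / 4 * k * B ≤ (τ.re + τ.im) * B := by
      gcongr
      linarith [hst.le_re]
    linarith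
  -- With both endpoint derivatives zero the estimate forces `A + kB ≤ 0`, and the pointwise bound
  -- at `π` then contradicts `Y₀ π = 1`. So normalizing by the derivative at the edge is possible.
  have hZ₀ : Z₀ (π / 2) ≠ 0 := by
    intro hz
    obtain ⟨h1, -⟩ := main Y₀ Z₀ hYZ₀
    have h2 := hpt k ((le_max_right _ _).trans hk) Y₀ Z₀ hYZ₀.cont hYZ₀.cont' (hd₀ hYZ₀) π
      ⟨hpi', le_rfl⟩
    rw [hz, norm_zero, zero_mul, mul_zero] at h1
    rw [hY₀, norm_one] at h2
    linarith
  obtain ⟨Y, Z, hYZ, hZ1, hYπ⟩ : ∃ Y Z : ℝ → ℂ,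
      IsNeumannSolution (potential ω s τ) (π / 2) π Y Z ∧ Z (π / 2) = 1 ∧ Y π ≠ 0 :=
    ⟨_, _, hYZ₀.const_mul (Z₀ (π / 2))⁻¹, inv_mul_cancel₀ hZ₀, by simp [hY₀, hZ₀]⟩
  refine ⟨Y, Z, hYZ, hZ1, hYπ, ?_⟩
  obtain ⟨h1, h2⟩ := main _ _ hYZ
  have h3 := htr k δ hk0 hδ hδ' hkδ _ _ hYZ.cont hYZ.cont' (hd₀ hYZ)
  rw [hZ1, norm_one, one_mul] at h1
  have hA : 0 ≤ ∫ x in (π / 2)..π, ‖Z x‖ ^ 2 :=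
    intervalIntegral.integral_nonneg hpi' fun t _ => sq_nonneg _
  have hB : 0 ≤ k * ∫ x in (π / 2)..π, ω x * ‖Y x‖ ^ 2 :=
    mul_nonneg hk0.le
      (intervalIntegral.integral_nonneg hpi' fun t _ => mul_nonneg (h.nonneg t) (sq_nonneg _))
  -- The trace bound and the estimate above give `‖Y‖² ≤ 3Kδ ‖Y‖` at the edge; one power cancels.
  have h4 : ‖Y (π / 2)‖ ≤ 3 * (K * δ) := by
    rcases (norm_nonneg (Y (π / 2))).eq_or_lt with h0 | h0
    · rw [← h0]; positivity
    · have : ‖Y (π / 2)‖ ^ 2 ≤ K * δ * (3 * ‖Y (π / 2)‖) := h3.trans (by gcongr)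
      nlinarith
  have hKδ : 0 < K * δ := by positivity
  refine ⟨by linarith, by linarith, by linarith⟩

/-! ### The perturbed Dirichlet condition -/

section Dispersion

theorem norm_cos_sub_one_le {z : ℂ} (hz : ‖z‖ ≤ 1) : ‖Complex.cos z - 1‖ ≤ ‖z‖ ^ 2 := by
  have h1 := Complex.norm_exp_sub_one_sub_id_le (x := z * Complex.I) (by simpa using hz)
  have h2 := Complex.norm_exp_sub_one_sub_id_le (x := -z * Complex.I) (by simpa using hz)
  have e : Complex.cos z - 1 = ((Complex.exp (z * Complex.I) - 1 - z * Complex.I)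
      + (Complex.exp (-z * Complex.I) - 1 - -z * Complex.I)) / 2 := by
    rw [Complex.cos]; ring
  rw [e, norm_div, Complex.norm_ofNat, div_le_iff₀ (by norm_num)]
  simp only [norm_mul, norm_neg, Complex.norm_I, mul_one] at h1 h2
  linarith [norm_add_le (Complex.exp (z * Complex.I) - 1 - z * Complex.I)
    (Complex.exp (-z * Complex.I) - 1 - -z * Complex.I)]

theorem hasDerivAt_mul_half_pi (s : ℂ) :
    HasDerivAt (fun s : ℂ => s * (π / 2 : ℝ)) ((π / 2 : ℝ) : ℂ) s := by
  simpa using (hasDerivAt_id s).mul_const ((π / 2 : ℝ) : ℂ)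

/-- The factor `2 / π` is minus the inverse of the derivative of `cos(sπ/2)` at its zero `s = 1`, so
the map has derivative `1 - cos((s - 1)π/2)`, which is quadratically small near `1`. -/
theorem norm_newton_cos_sub_le {s t : ℂ} (hs : s ∈ Metric.closedBall (1 : ℂ) (1 / 4))
    (ht : t ∈ Metric.closedBall (1 : ℂ) (1 / 4)) :
    ‖(s + ((2 / π : ℝ) : ℂ) * Complex.cos (s * (π / 2 : ℝ)))
      - (t + ((2 / π : ℝ) : ℂ) * Complex.cos (t * (π / 2 : ℝ)))‖ ≤ 1 / 4 * ‖s - t‖ := by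
  refine Convex.norm_image_sub_le_of_norm_hasDerivWithin_le
    (f := fun s : ℂ => s + ((2 / π : ℝ) : ℂ) * Complex.cos (s * (π / 2 : ℝ)))
    (f' := fun s => 1 - Complex.sin (s * (π / 2 : ℝ)))
    (fun x _ => ?_) (fun x hx => ?_) (convex_closedBall (1 : ℂ) (1 / 4)) ht hs
  · have h1 := (Complex.hasDerivAt_cos (x * (π / 2 : ℝ))).comp x (hasDerivAt_mul_half_pi x)
    refine (((hasDerivAt_id x).add (h1.const_mul ((2 / π : ℝ) : ℂ))).congr_deriv ?_).hasDerivWithinAt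
    have : ((π : ℝ) : ℂ) ≠ 0 := Complex.ofReal_ne_zero.2 pi_ne_zero
    push_cast
    field_simp
    ring
  · rw [Metric.mem_closedBall, dist_eq_norm] at hx
    have e : Complex.sin (x * (π / 2 : ℝ)) = Complex.cos ((x - 1) * (π / 2 : ℝ)) := by
      rw [← Complex.cos_sub_pi_div_two]
      congr 1
      push_cast
      ring
    have hn : ‖(x - 1) * ((π / 2 : ℝ) : ℂ)‖ ≤ 1 / 2 := by
      rw [norm_mul, Complex.norm_real, norm_of_nonneg (by positivity)]
      nlinarith [pi_pos, pi_lt_d2, norm_nonneg (x - 1)]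
    rw [e, norm_sub_rev]
    refine (norm_cos_sub_one_le (hn.trans (by norm_num))).trans ?_
    nlinarith [norm_nonneg ((x - 1) * ((π / 2 : ℝ) : ℂ))]

theorem exists_bound_mul_sin : ∃ C : ℝ, 0 < C ∧
    ∀ s ∈ Metric.closedBall (1 : ℂ) (1 / 4), ∀ t ∈ Metric.closedBall (1 : ℂ) (1 / 4),
      ‖((2 / π : ℝ) : ℂ) * (s * Complex.sin (s * (π / 2 : ℝ)))‖ ≤ C ∧
      ‖((2 / π : ℝ) : ℂ) * (s * Complex.sin (s * (π / 2 : ℝ)))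
        - ((2 / π : ℝ) : ℂ) * (t * Complex.sin (t * (π / 2 : ℝ)))‖ ≤ C * ‖s - t‖ := by
  set F : ℂ → ℂ := fun s => ((2 / π : ℝ) : ℂ) * (s * Complex.sin (s * (π / 2 : ℝ))) with hF
  set F' : ℂ → ℂ := fun s => ((2 / π : ℝ) : ℂ) * (1 * Complex.sin (s * (π / 2 : ℝ))
    + s * (Complex.cos (s * (π / 2 : ℝ)) * (π / 2 : ℝ))) with hF'
  have hd : ∀ s, HasDerivAt F (F' s) s := fun s =>
    ((hasDerivAt_id s).mul ((Complex.hasDerivAt_sin (s * (π / 2 : ℝ))).comp s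
      (hasDerivAt_mul_half_pi s))).const_mul _
  have hc' : Continuous F' := by fun_prop
  have hc : Continuous F := by fun_prop
  obtain ⟨C₁, h₁⟩ := (isCompact_closedBall (1 : ℂ) (1 / 4)).exists_bound_of_continuousOn
    hc.continuousOn
  obtain ⟨C₂, h₂⟩ := (isCompact_closedBall (1 : ℂ) (1 / 4)).exists_bound_of_continuousOn
    hc'.continuousOn
  refine ⟨max 1 (max C₁ C₂), by positivity, fun s hs t ht =>
    ⟨(h₁ s hs).trans ((le_max_left _ _).trans (le_max_right _ _)), ?_⟩⟩
  refine (Convex.norm_image_sub_le_of_norm_hasDerivWithin_le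
    (fun x _ => (hd x).hasDerivWithinAt) h₂ (convex_closedBall (1 : ℂ) (1 / 4)) ht hs).trans ?_
  gcongr
  exact (le_max_right _ _).trans (le_max_right _ _)

/-- A small Lipschitz perturbation of the Dirichlet condition `cos (s π / 2) = 0` still has a
root near `1`. -/
theorem exists_dispersion_root : ∃ η : ℝ, 0 < η ∧ ∀ (m : ℂ → ℂ) (ε : ℝ), 0 < ε → ε ≤ η →
    (∀ s, ‖s - 1‖ ≤ 1 / 4 → ‖m s‖ ≤ ε) →
    (∀ s t, ‖s - 1‖ ≤ 1 / 4 → ‖t - 1‖ ≤ 1 / 4 → ‖m s - m t‖ ≤ ε * ‖s - t‖) →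
    ∃ s, ‖s - 1‖ ≤ 2 * ε ∧
      Complex.cos (s * (π / 2 : ℝ)) + s * m s * Complex.sin (s * (π / 2 : ℝ)) = 0 := by
  obtain ⟨C, hC, hF⟩ := exists_bound_mul_sin
  refine ⟨min (1 / 8) (1 / (8 * C)), by positivity, fun m ε hε hεη hm hlip => ?_⟩
  have hε8 : 2 * ε ≤ 1 / 4 := by linarith [hεη.trans (min_le_left _ _)]
  have hεC : C * ε ≤ 1 / 8 := by
    have := hεη.trans (min_le_right _ _)
    rw [le_div_iff₀ (by positivity)] at this
    linarith
  have hball : ∀ s ∈ Metric.closedBall (1 : ℂ) (2 * ε), s ∈ Metric.closedBall (1 : ℂ) (1 / 4) :=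
    fun s hs => Metric.closedBall_subset_closedBall hε8 hs
  have hmem : ∀ s ∈ Metric.closedBall (1 : ℂ) (1 / 4), ‖s - 1‖ ≤ 1 / 4 := fun s hs => by
    rwa [Metric.mem_closedBall, dist_eq_norm] at hs
  set F : ℂ → ℂ := fun s => ((2 / π : ℝ) : ℂ) * (s * Complex.sin (s * (π / 2 : ℝ))) with hFdef
  set N : ℂ → ℂ := fun s => s + ((2 / π : ℝ) : ℂ) * Complex.cos (s * (π / 2 : ℝ)) with hN
  -- Fixed points of `G` are the roots sought. The Newton part has Lipschitz constant `1 / 4` and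
  -- the perturbation at most `2 C ε ≤ 1 / 4`.
  set G : ℂ → ℂ := fun s => N s + F s * m s with hG
  have hGlip : ∀ s ∈ Metric.closedBall (1 : ℂ) (2 * ε), ∀ t ∈ Metric.closedBall (1 : ℂ) (2 * ε),
      ‖G s - G t‖ ≤ 1 / 2 * ‖s - t‖ := by
    intro s hs t ht
    have h1 := norm_newton_cos_sub_le (hball s hs) (hball t ht)
    obtain ⟨h2, h3⟩ := hF s (hball s hs) t (hball t ht)
    have h4 := hm t (hmem t (hball t ht))
    have h5 := hlip s t (hmem s (hball s hs)) (hmem t (hball t ht))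
    have e : G s - G t = (N s - N t) + (F s * (m s - m t) + (F s - F t) * m t) := by
      simp only [hG]; ring
    rw [e]
    calc ‖(N s - N t) + (F s * (m s - m t) + (F s - F t) * m t)‖
        ≤ ‖N s - N t‖ + (‖F s‖ * ‖m s - m t‖ + ‖F s - F t‖ * ‖m t‖) := by
          refine (norm_add_le _ _).trans (add_le_add le_rfl ((norm_add_le _ _).trans ?_))
          exact add_le_add (norm_mul_le _ _) (norm_mul_le _ _)
      _ ≤ 1 / 4 * ‖s - t‖ + (C * (ε * ‖s - t‖) + C * ‖s - t‖ * ε) := by gcongr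
      _ ≤ 1 / 2 * ‖s - t‖ := by nlinarith [norm_nonneg (s - t)]
  have h1mem : (1 : ℂ) ∈ Metric.closedBall (1 : ℂ) (2 * ε) :=
    Metric.mem_closedBall_self (by positivity)
  have hG1 : ‖G 1 - 1‖ ≤ ε := by
    have e : G 1 - 1 = ((2 / π : ℝ) : ℂ) * m 1 := by
      simp only [hG, hN, hFdef, one_mul]
      rw [← Complex.ofReal_cos, ← Complex.ofReal_sin, cos_pi_div_two, sin_pi_div_two]
      simp
    rw [e, norm_mul, Complex.norm_real, norm_of_nonneg (by positivity)]
    have h2 : 2 / π ≤ 1 := by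
      rw [div_le_one pi_pos]; linarith [pi_gt_three]
    calc 2 / π * ‖m 1‖ ≤ 1 * ε := by
          gcongr
          exact hm 1 (by norm_num)
      _ = ε := one_mul _
  -- The center moves by at most `ε` and distances are halved, whence the radius `2 ε`.
  have hmaps : MapsTo G (Metric.closedBall (1 : ℂ) (2 * ε)) (Metric.closedBall (1 : ℂ) (2 * ε)) := by
    intro s hs
    have h1 := hGlip s hs 1 h1mem
    have h2 := hs
    rw [Metric.mem_closedBall, dist_eq_norm] at h2 ⊢
    have h3 := norm_add_le (G s - G 1) (G 1 - 1)
    rw [sub_add_sub_cancel] at h3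
    linarith
  have hcontr : ContractingWith (1 / 2 : NNReal) (hmaps.restrict G _ _) :=
    ⟨by rw [← NNReal.coe_lt_coe]; norm_num, LipschitzWith.of_dist_le_mul fun s t => by
      have := hGlip s s.2 t t.2
      rw [← dist_eq_norm, ← dist_eq_norm] at this
      have e : (((1 / 2 : NNReal) : NNReal) : ℝ) = 1 / 2 := by norm_num
      rw [e]
      exact this⟩
  obtain ⟨s, hs, hfix, -⟩ := hcontr.exists_fixedPoint'
    (Metric.isClosed_closedBall.isComplete) hmaps h1mem (edist_ne_top _ _)
  refine ⟨s, by rwa [Metric.mem_closedBall, dist_eq_norm] at hs, ?_⟩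
  have hfix' : G s = s := hfix
  have hpi : ((2 / π : ℝ) : ℂ) ≠ 0 := Complex.ofReal_ne_zero.2 (by positivity)
  refine (mul_eq_zero.1 ?_).resolve_left hpi
  simp only [hG, hN, hFdef] at hfix'
  linear_combination hfix'

end Dispersion

/-- Eigenmodes of the damped problem at frequency `k`, exponentially damped at a rate at most of
order `k ^ (-(β + 3) / (β + 2))`. -/
theorem IsProfile.exists_eigenmode {β : ℝ} {ω : ℝ → ℝ} (h : IsProfile β ω) (hβ : -1 < β) :
    ∃ K : ℝ, 0 < K ∧ ∀ᶠ k : ℝ in Filter.atTop, ∃ (s τ : ℂ) (Y Z : ℝ → ℂ), IsAdmissible k s τ ∧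
      IsNeumannSolution (potential ω s τ) (π / 2) π Y Z ∧ Z 0 = 0 ∧ Y π ≠ 0 ∧
      |τ.im| ≤ K * k ^ (-((β + 3) / (β + 2))) := by
  obtain ⟨K, k₀, hK, hk₀, hsol⟩ := h.exists_normalized_solution hβ
  obtain ⟨η, hη, hroot⟩ := exists_dispersion_root
  have hβ2 : 0 < β + 2 := by linarith
  refine ⟨12 * K, by positivity, ?_⟩
  have hlim : Filter.Tendsto (fun k : ℝ => k ^ (-(1 / (β + 2)))) Filter.atTop (nhds 0) :=
    tendsto_rpow_neg_atTop (by positivity)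
  -- The three bounds keep the layer inside the damped side, the root within `1 / 4` of `1`, and the
  -- perturbation `5Kδ` below the threshold `η`.
  have hsmall : ∀ᶠ k : ℝ in Filter.atTop,
      k ^ (-(1 / (β + 2))) < min (π / 2) (min (1 / (40 * K)) (η / (5 * K))) :=
    hlim.eventually (gt_mem_nhds (by positivity))
  filter_upwards [hsmall, Filter.eventually_ge_atTop k₀] with k hδ hk
  have hk0 : 0 < k := by linarith
  set δ := k ^ (-(1 / (β + 2))) with hδdef
  have hδ0 : 0 < δ := rpow_pos_of_pos hk0 _
  obtain ⟨hδ1, hδ2⟩ := lt_min_iff.1 hδ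
  obtain ⟨hδ2, hδ3⟩ := lt_min_iff.1 hδ2
  rw [lt_div_iff₀ (by positivity)] at hδ2 hδ3
  have hkδ : k * δ ^ (β + 2) = 1 := by
    rw [hδdef, ← rpow_mul hk0.le]
    have : -(1 / (β + 2)) * (β + 2) = -1 := by field_simp
    rw [this, rpow_neg_one, mul_inv_cancel₀ hk0.ne']
  have hex : ∀ s : ℂ, ‖s - 1‖ ≤ 1 / 4 → ∃ (τ : ℂ) (Y Z : ℝ → ℂ), IsAdmissible k s τ ∧
        IsNeumannSolution (potential ω s τ) (π / 2) π Y Z ∧ Z (π / 2) = 1 ∧ Y π ≠ 0 ∧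
        ‖Y (π / 2)‖ ≤ K * δ ∧ ∫ x in (π / 2)..π, ‖Y x‖ ^ 2 ≤ K * δ ∧
        k * ∫ x in (π / 2)..π, ω x * ‖Y x‖ ^ 2 ≤ K * δ := by
    intro s hs
    obtain ⟨τ, hτ⟩ := exists_isAdmissible k hs
    obtain ⟨Y, Z, hYZ⟩ := hsol k δ hk hδ0 hδ1.le hkδ s τ hτ
    exact ⟨τ, Y, Z, hτ, hYZ⟩
  -- The root `τ` and the solution are chosen for each `s` separately; regularity in `s` is
  -- recovered by the next estimate.
  choose! τ Y Z hadm hYZ hZ hYπ hY hM hB using hex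
  -- With both derivatives at the edge equal to `1`, the Wronskian there is the difference of the
  -- traces. The potentials differ by at most `a + (a / 2k) ω` with `a = ‖s² - t²‖`, and the product
  -- of the two solutions is split by the arithmetic–geometric mean into integrals that are `O(δ)`.
  have hlip : ∀ s t, ‖s - 1‖ ≤ 1 / 4 → ‖t - 1‖ ≤ 1 / 4 →
      ‖Y s (π / 2) - Y t (π / 2)‖ ≤ 5 * K * δ * ‖s - t‖ := by
    intro s t hs ht
    have hYs := (hYZ s hs).cont
    have hYt := (hYZ t ht).cont
    have hw := (hYZ s hs).wronskian_identity (hYZ t ht) (h.intervalIntegrable_potential _ _)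
      (h.intervalIntegrable_potential _ _) (a := π / 2) (by positivity) (by linarith [pi_pos])
    rw [hZ s hs, hZ t ht, mul_one, one_mul] at hw
    rw [← hw]
    set a := ‖s ^ 2 - t ^ 2‖ with ha
    have ha0 : 0 ≤ a := norm_nonneg _
    have hτ : ‖τ s - τ t‖ ≤ a / (2 * k) := (hadm s hs).norm_sub_le (hadm t ht) hk0
    have hiY : ∀ y : ℝ → ℂ, Continuous y →
        IntervalIntegrable (fun x => ‖y x‖ ^ 2) volume (π / 2) π :=
      fun y hy => Continuous.intervalIntegrable (by fun_prop) _ _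
    have hiω : ∀ y : ℝ → ℂ, Continuous y →
        IntervalIntegrable (fun x => ω x * ‖y x‖ ^ 2) volume (π / 2) π :=
      fun y hy => (h.int _ _).mul_continuousOn (Continuous.continuousOn (by fun_prop))
    have hle := intervalIntegral.norm_integral_le_of_norm_le (μ := volume) (a := π / 2) (b := π)
      (f := fun x => (potential ω s (τ s) x - potential ω t (τ t) x) * (Y s x * Y t x))
      (g := fun x => a / 2 * (‖Y s x‖ ^ 2 + ‖Y t x‖ ^ 2)
        + a / (4 * k) * (ω x * ‖Y s x‖ ^ 2 + ω x * ‖Y t x‖ ^ 2)) (by linarith [pi_pos]) (by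
        refine Filter.Eventually.of_forall fun x _ => ?_
        have h1 : ‖potential ω s (τ s) x - potential ω t (τ t) x‖ ≤ a + a / (2 * k) * ω x := by
          have e : potential ω s (τ s) x - potential ω t (τ t) x
              = -((s ^ 2 - t ^ 2) + Complex.I * (τ s - τ t) * ω x) := by
            simp only [potential]; ring
          rw [e, norm_neg]
          refine (norm_add_le _ _).trans ?_
          rw [norm_mul, norm_mul, Complex.norm_I, one_mul, Complex.norm_real,
            norm_of_nonneg (h.nonneg x)]
          have := h.nonneg x
          gcongr
        have h2 : ‖Y s x * Y t x‖ ≤ (‖Y s x‖ ^ 2 + ‖Y t x‖ ^ 2) / 2 := by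
          rw [norm_mul]
          nlinarith [sq_nonneg (‖Y s x‖ - ‖Y t x‖)]
        rw [norm_mul]
        have := h.nonneg x
        calc _ ≤ (a + a / (2 * k) * ω x) * ((‖Y s x‖ ^ 2 + ‖Y t x‖ ^ 2) / 2) := by gcongr
          _ = _ := by field_simp; ring)
      ((((hiY _ hYs).add (hiY _ hYt)).const_mul _).add
        (((hiω _ hYs).add (hiω _ hYt)).const_mul _))
    refine hle.trans ?_
    rw [intervalIntegral.integral_add (((hiY _ hYs).add (hiY _ hYt)).const_mul _)
        (((hiω _ hYs).add (hiω _ hYt)).const_mul _),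
      intervalIntegral.integral_const_mul, intervalIntegral.integral_const_mul,
      intervalIntegral.integral_add (hiY _ hYs) (hiY _ hYt),
      intervalIntegral.integral_add (hiω _ hYs) (hiω _ hYt)]
    have hMs := hM s hs
    have hMt := hM t ht
    have hBs := hB s hs
    have hBt := hB t ht
    set Ms := ∫ x in (π / 2)..π, ‖Y s x‖ ^ 2
    set Mt := ∫ x in (π / 2)..π, ‖Y t x‖ ^ 2
    set Bs := ∫ x in (π / 2)..π, ω x * ‖Y s x‖ ^ 2
    set Bt := ∫ x in (π / 2)..π, ω x * ‖Y t x‖ ^ 2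
    have hBB : a / (4 * k) * (Bs + Bt) ≤ a / 2 * (K * δ) := by
      have : Bs + Bt ≤ 2 * (K * δ) / k := by
        rw [le_div_iff₀ hk0]; linarith
      calc a / (4 * k) * (Bs + Bt) ≤ a / (4 * k) * (2 * (K * δ) / k) := by gcongr
        _ = a / 2 * (K * δ) / k ^ 2 := by field_simp; ring
        _ ≤ a / 2 * (K * δ) := div_le_self (by positivity) (by nlinarith)
    have hMM : a / 2 * (Ms + Mt) ≤ a * (K * δ) := by
      calc a / 2 * (Ms + Mt) ≤ a / 2 * (K * δ + K * δ) := by gcongr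
        _ = _ := by ring
    have has := (hadm s hs).norm_sq_sub_le (hadm t ht)
    have hKδ : 0 < K * δ := by positivity
    calc _ ≤ a * (K * δ) + a / 2 * (K * δ) := add_le_add hMM hBB
      _ = 3 / 2 * a * (K * δ) := by ring
      _ ≤ 3 / 2 * (5 / 2 * ‖s - t‖) * (K * δ) := by gcongr
      _ ≤ 5 * K * δ * ‖s - t‖ := by nlinarith [norm_nonneg (s - t)]
  obtain ⟨s, hs, hdisp⟩ := hroot (fun s => Y s (π / 2)) (5 * K * δ) (by positivity) (by linarith)
    (fun s hs => (hY s hs).trans (by nlinarith)) hlip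
  have hs4 : ‖s - 1‖ ≤ 1 / 4 := by linarith
  refine ⟨s, τ s, Y s, Z s, hadm s hs4, hYZ s hs4, ?_, hYπ s hs4, ?_⟩
  · rw [(hYZ s hs4).deriv_zero_eq (s := s) (by positivity) (by linarith [pi_pos])
      (fun x hx => by simp [potential, h.zero x hx]), hZ s hs4, one_mul]
    exact hdisp
  -- The real number `1` can be subtracted from `s²`, so the imaginary part is of the order of `s -
  -- 1`, which is `O(δ)`.
  · have him : |(s ^ 2).im| ≤ 24 * K * δ := by
      have e : (s ^ 2).im = ((s - 1) * (s + 1)).im := by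
        have : (s - 1) * (s + 1) = s ^ 2 - 1 := by ring
        rw [this, Complex.sub_im, Complex.one_im, sub_zero]
      rw [e]
      refine (Complex.abs_im_le_norm _).trans ?_
      rw [norm_mul]
      have h2 : ‖s + 1‖ ≤ 12 / 5 := by
        refine (norm_add_le _ _).trans ?_
        rw [norm_one]
        linarith [(hadm s hs4).norm_le]
      calc ‖s - 1‖ * ‖s + 1‖ ≤ (2 * (5 * K * δ)) * (12 / 5) := by gcongr
        _ = _ := by ring
    refine ((hadm s hs4).abs_im_le hk0).trans ?_
    have e : k ^ (-((β + 3) / (β + 2))) = δ / k := by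
      rw [hδdef, ← rpow_sub_one hk0.ne']
      congr 1
      field_simp
      ring
    rw [e]
    calc |(s ^ 2).im| / (2 * k) ≤ 24 * K * δ / (2 * k) := by gcongr
      _ = 12 * K * (δ / k) := by ring

/-! ### Calculus of test functions on the torus -/

section TestFunctions

theorem IsTest.contDiff_fst {φ : Torus → ℂ} (h : IsTest φ) (y : S1) :
    ContDiff ℝ ((⊤ : ℕ∞) : WithTop ℕ∞) fun x : ℝ => φ ((x : S1), y) := by
  obtain ⟨y, rfl⟩ := QuotientAddGroup.mk_surjective y
  have hF : ContDiff ℝ ((⊤ : ℕ∞) : WithTop ℕ∞) fun p : ℝ × ℝ => φ ((p.1 : S1), (p.2 : S1)) := h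
  exact hF.comp (contDiff_id.prodMk contDiff_const)

theorem IsTest.contDiff_snd {φ : Torus → ℂ} (h : IsTest φ) (x : S1) :
    ContDiff ℝ ((⊤ : ℕ∞) : WithTop ℕ∞) fun y : ℝ => φ (x, (y : S1)) := by
  obtain ⟨x, rfl⟩ := QuotientAddGroup.mk_surjective x
  have hF : ContDiff ℝ ((⊤ : ℕ∞) : WithTop ℕ∞) fun p : ℝ × ℝ => φ ((p.1 : S1), (p.2 : S1)) := h
  exact hF.comp (contDiff_const.prodMk contDiff_id)

theorem dx_coe (φ : Torus → ℂ) (x : ℝ) (y : S1) :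
    dx φ ((x : S1), y) = deriv (fun s : ℝ => φ ((s : S1), y)) x := by
  have := deriv_comp_const_add (f := fun s : ℝ => φ ((s : S1), y)) x 0
  rw [add_zero] at this
  rw [← this]
  simp [dx]

theorem dy_coe (φ : Torus → ℂ) (x : S1) (y : ℝ) :
    dy φ (x, (y : S1)) = deriv (fun s : ℝ => φ (x, (s : S1))) y := by
  have := deriv_comp_const_add (f := fun s : ℝ => φ (x, (s : S1))) y 0
  rw [add_zero] at this
  rw [← this]
  simp [dy]

theorem IsTest.hasDerivAt_dx {φ : Torus → ℂ} (h : IsTest φ) (x : ℝ) (y : S1) :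
    HasDerivAt (fun s : ℝ => φ ((s : S1), y)) (dx φ ((x : S1), y)) x := by
  rw [dx_coe]
  exact ((h.contDiff_fst y).differentiable (by simp) x).hasDerivAt

theorem IsTest.hasDerivAt_dy {φ : Torus → ℂ} (h : IsTest φ) (x : S1) (y : ℝ) :
    HasDerivAt (fun s : ℝ => φ (x, (s : S1))) (dy φ (x, (y : S1))) y := by
  rw [dy_coe]
  exact ((h.contDiff_snd x).differentiable (by simp) y).hasDerivAt

theorem coe_neg_pi_add : ((-π + 2 * π : ℝ) : S1) = ((-π : ℝ) : S1) := by
  rw [AddCircle.coe_add, AddCircle.coe_period, add_zero]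

theorem IsTest.integral_dx_eq_zero {φ : Torus → ℂ} (h : IsTest φ) (y : S1) :
    ∫ x : S1, dx φ (x, y) = 0 := by
  rw [← AddCircle.intervalIntegral_preimage (2 * π) (-π) fun x => dx φ (x, y),
    intervalIntegral.integral_eq_sub_of_hasDerivAt (fun x _ => h.hasDerivAt_dx x y), coe_neg_pi_add,
    sub_self]
  refine Continuous.intervalIntegrable ?_ _ _
  exact h.continuous_dx.comp
    ((AddCircle.continuous_mk' (2 * π)).prodMk continuous_const)

theorem IsTest.integral_dy_eq_zero {φ : Torus → ℂ} (h : IsTest φ) (x : S1) :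
    ∫ y : S1, dy φ (x, y) = 0 := by
  rw [← AddCircle.intervalIntegral_preimage (2 * π) (-π) fun y => dy φ (x, y),
    intervalIntegral.integral_eq_sub_of_hasDerivAt (fun y _ => h.hasDerivAt_dy x y), coe_neg_pi_add,
    sub_self]
  refine Continuous.intervalIntegrable ?_ _ _
  exact h.continuous_dy.comp
    (continuous_const.prodMk (AddCircle.continuous_mk' (2 * π)))

theorem integrable_of_continuous {φ : Torus → ℂ} (h : Continuous φ) : Integrable φ := by
  simpa using h.integrable_of_hasCompactSupport (HasCompactSupport.of_compactSpace φ)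

theorem IsTest.mul {φ ψ : Torus → ℂ} (hφ : IsTest φ) (hψ : IsTest ψ) :
    IsTest fun z => φ z * ψ z := ContDiff.mul hφ hψ

theorem IsTest.add {φ ψ : Torus → ℂ} (hφ : IsTest φ) (hψ : IsTest ψ) :
    IsTest fun z => φ z + ψ z := ContDiff.add hφ hψ

theorem IsTest.const_mul {φ : Torus → ℂ} (hφ : IsTest φ) (c : ℂ) :
    IsTest fun z => c * φ z := ContDiff.mul contDiff_const hφ

theorem IsTest.conj {φ : Torus → ℂ} (hφ : IsTest φ) :
    IsTest fun z => (starRingEnd ℂ) (φ z) :=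
  Complex.conjCLE.contDiff.comp hφ

theorem dx_mul {φ ψ : Torus → ℂ} (hφ : IsTest φ) (hψ : IsTest ψ) (z : Torus) :
    dx (fun z => φ z * ψ z) z = dx φ z * ψ z + φ z * dx ψ z := by
  obtain ⟨x, y⟩ := z
  obtain ⟨x, rfl⟩ := QuotientAddGroup.mk_surjective x
  exact (dx_coe _ x y).trans ((hφ.hasDerivAt_dx x y).mul (hψ.hasDerivAt_dx x y)).deriv

theorem dy_mul {φ ψ : Torus → ℂ} (hφ : IsTest φ) (hψ : IsTest ψ) (z : Torus) :
    dy (fun z => φ z * ψ z) z = dy φ z * ψ z + φ z * dy ψ z := by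
  obtain ⟨x, y⟩ := z
  obtain ⟨y, rfl⟩ := QuotientAddGroup.mk_surjective y
  exact (dy_coe _ x y).trans ((hφ.hasDerivAt_dy x y).mul (hψ.hasDerivAt_dy x y)).deriv

theorem dx_add {φ ψ : Torus → ℂ} (hφ : IsTest φ) (hψ : IsTest ψ) (z : Torus) :
    dx (fun z => φ z + ψ z) z = dx φ z + dx ψ z := by
  obtain ⟨x, y⟩ := z
  obtain ⟨x, rfl⟩ := QuotientAddGroup.mk_surjective x
  exact (dx_coe _ x y).trans ((hφ.hasDerivAt_dx x y).add (hψ.hasDerivAt_dx x y)).deriv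

theorem dy_add {φ ψ : Torus → ℂ} (hφ : IsTest φ) (hψ : IsTest ψ) (z : Torus) :
    dy (fun z => φ z + ψ z) z = dy φ z + dy ψ z := by
  obtain ⟨x, y⟩ := z
  obtain ⟨y, rfl⟩ := QuotientAddGroup.mk_surjective y
  exact (dy_coe _ x y).trans ((hφ.hasDerivAt_dy x y).add (hψ.hasDerivAt_dy x y)).deriv

theorem dx_const_mul {φ : Torus → ℂ} (hφ : IsTest φ) (c : ℂ) (z : Torus) :
    dx (fun z => c * φ z) z = c * dx φ z := by
  obtain ⟨x, y⟩ := z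
  obtain ⟨x, rfl⟩ := QuotientAddGroup.mk_surjective x
  exact (dx_coe _ x y).trans ((hφ.hasDerivAt_dx x y).const_mul c).deriv

theorem dy_const_mul {φ : Torus → ℂ} (hφ : IsTest φ) (c : ℂ) (z : Torus) :
    dy (fun z => c * φ z) z = c * dy φ z := by
  obtain ⟨x, y⟩ := z
  obtain ⟨y, rfl⟩ := QuotientAddGroup.mk_surjective y
  exact (dy_coe _ x y).trans ((hφ.hasDerivAt_dy x y).const_mul c).deriv

theorem dx_conj {φ : Torus → ℂ} (hφ : IsTest φ) (z : Torus) :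
    dx (fun z => (starRingEnd ℂ) (φ z)) z = (starRingEnd ℂ) (dx φ z) := by
  obtain ⟨x, y⟩ := z
  obtain ⟨x, rfl⟩ := QuotientAddGroup.mk_surjective x
  exact (dx_coe _ x y).trans (hφ.hasDerivAt_dx x y).star.deriv

theorem dy_conj {φ : Torus → ℂ} (hφ : IsTest φ) (z : Torus) :
    dy (fun z => (starRingEnd ℂ) (φ z)) z = (starRingEnd ℂ) (dy φ z) := by
  obtain ⟨x, y⟩ := z
  obtain ⟨y, rfl⟩ := QuotientAddGroup.mk_surjective y
  exact (dy_coe _ x y).trans (hφ.hasDerivAt_dy x y).star.deriv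

theorem IsTest.integral_mul_dx {φ ψ : Torus → ℂ} (hφ : IsTest φ) (hψ : IsTest ψ) :
    ∫ z, φ z * dx ψ z = -∫ z, dx φ z * ψ z := by
  have h := hφ.mul hψ
  have h0 : ∫ z, dx (fun z => φ z * ψ z) z = 0 := by
    rw [Measure.volume_eq_prod, integral_prod_symm _ (integrable_of_continuous h.continuous_dx)]
    simp [h.integral_dx_eq_zero]
  simp_rw [dx_mul hφ hψ] at h0
  have e := integral_add (integrable_of_continuous (hφ.continuous_dx.mul hψ.continuous))
    (integrable_of_continuous (hφ.continuous.mul hψ.continuous_dx))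
  simp only [Pi.mul_apply] at e
  linear_combination h0 - e

theorem IsTest.integral_mul_dy {φ ψ : Torus → ℂ} (hφ : IsTest φ) (hψ : IsTest ψ) :
    ∫ z, φ z * dy ψ z = -∫ z, dy φ z * ψ z := by
  have h := hφ.mul hψ
  have h0 : ∫ z, dy (fun z => φ z * ψ z) z = 0 := by
    rw [Measure.volume_eq_prod, integral_prod _ (integrable_of_continuous h.continuous_dy)]
    simp [h.integral_dy_eq_zero]
  simp_rw [dy_mul hφ hψ] at h0
  have e := integral_add (integrable_of_continuous (hφ.continuous_dy.mul hψ.continuous))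
    (integrable_of_continuous (hφ.continuous.mul hψ.continuous_dy))
  simp only [Pi.mul_apply] at e
  linear_combination h0 - e

end TestFunctions

/-! ### Completeness of the trigonometric monomials -/

section Monomials

/-- Trigonometric monomials on the torus. -/
def monomial (m n : ℤ) : C(Torus, ℂ) where
  toFun z := fourier m z.1 * fourier n z.2
  continuous_toFun := by fun_prop

theorem fourier_two_pi (n : ℤ) (x : ℝ) :
    fourier n (x : S1) = Complex.exp (Complex.I * n * x) := by
  rw [fourier_coe_apply]
  congr 1
  have : ((π : ℝ) : ℂ) ≠ 0 := Complex.ofReal_ne_zero.2 pi_ne_zero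
  push_cast
  field_simp

theorem hasDerivAt_exp_I_mul (n : ℤ) (x : ℝ) :
    HasDerivAt (fun x : ℝ => Complex.exp (Complex.I * n * x))
      (Complex.I * n * Complex.exp (Complex.I * n * x)) x := by
  have h : HasDerivAt (fun x : ℝ => Complex.I * n * (x : ℂ)) (Complex.I * n) x := by
    simpa using (Complex.ofRealCLM.hasDerivAt (x := x)).const_mul (Complex.I * n)
  simpa [mul_comm] using h.cexp

theorem isTest_monomial (m n : ℤ) : IsTest (monomial m n) := by
  change ContDiff ℝ _ fun p : ℝ × ℝ => fourier m (p.1 : S1) * fourier n (p.2 : S1)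
  simp_rw [fourier_two_pi]
  have h1 : ContDiff ℝ ((⊤ : ℕ∞) : WithTop ℕ∞) fun p : ℝ × ℝ => (p.1 : ℂ) :=
    Complex.ofRealCLM.contDiff.comp contDiff_fst
  have h2 : ContDiff ℝ ((⊤ : ℕ∞) : WithTop ℕ∞) fun p : ℝ × ℝ => (p.2 : ℂ) :=
    Complex.ofRealCLM.contDiff.comp contDiff_snd
  exact (contDiff_const.mul h1).cexp.mul (contDiff_const.mul h2).cexp

theorem dx_monomial (m n : ℤ) (z : Torus) :
    dx (monomial m n) z = Complex.I * m * monomial m n z := by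
  obtain ⟨x, y⟩ := z
  obtain ⟨x, rfl⟩ := QuotientAddGroup.mk_surjective x
  refine (dx_coe _ x y).trans ?_
  change deriv (fun s : ℝ => fourier m (s : S1) * fourier n y) x
    = Complex.I * m * (fourier m (x : S1) * fourier n y)
  simp_rw [fourier_two_pi]
  rw [((hasDerivAt_exp_I_mul m x).mul_const _).deriv]
  ring

theorem dy_monomial (m n : ℤ) (z : Torus) :
    dy (monomial m n) z = Complex.I * n * monomial m n z := by
  obtain ⟨x, y⟩ := z
  obtain ⟨y, rfl⟩ := QuotientAddGroup.mk_surjective y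
  refine (dy_coe _ x y).trans ?_
  change deriv (fun s : ℝ => fourier m x * fourier n (s : S1)) y
    = Complex.I * n * (fourier m x * fourier n (y : S1))
  simp_rw [fourier_two_pi]
  rw [((hasDerivAt_exp_I_mul n y).const_mul _).deriv]
  ring

theorem conj_monomial (m n : ℤ) (z : Torus) :
    (starRingEnd ℂ) (monomial m n z) = monomial (-m) (-n) z := by
  simp [monomial]

/-- The star subalgebra of trigonometric polynomials. -/
def trigSubalgebra : StarSubalgebra ℂ C(Torus, ℂ) where
  toSubalgebra := Algebra.adjoin ℂ (range fun p : ℤ × ℤ => monomial p.1 p.2)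
  star_mem' := by
    change Algebra.adjoin ℂ (range fun p : ℤ × ℤ => monomial p.1 p.2)
      ≤ star (Algebra.adjoin ℂ (range fun p : ℤ × ℤ => monomial p.1 p.2))
    refine Algebra.adjoin_le ?_
    rintro _ ⟨p, rfl⟩
    refine Algebra.subset_adjoin ⟨-p, ?_⟩
    ext1 z
    simp [conj_monomial]

theorem trigSubalgebra_coe : trigSubalgebra.toSubalgebra.toSubmodule
    = Submodule.span ℂ (range fun p : ℤ × ℤ => monomial p.1 p.2) := by
  apply Algebra.adjoin_eq_span_of_subset
  refine .trans (fun x ↦ Submonoid.closure_induction (fun _ ↦ id) ⟨0, ?_⟩ ?_)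
    Submodule.subset_span
  · ext z
    simp [monomial]
  · rintro _ _ _ _ ⟨p, rfl⟩ ⟨r, rfl⟩
    refine ⟨p + r, ?_⟩
    ext z
    simp only [monomial, Prod.fst_add, Prod.snd_add, ContinuousMap.coe_mk, ContinuousMap.mul_apply,
      fourier_add]
    ring

theorem trigSubalgebra_separatesPoints : trigSubalgebra.SeparatesPoints := by
  intro x y hxy
  by_cases h : x.1 = y.1
  · refine ⟨_, ⟨monomial 0 1, Algebra.subset_adjoin ⟨(0, 1), rfl⟩, rfl⟩, fun he => hxy ?_⟩
    refine Prod.ext h (AddCircle.injective_toCircle (T := 2 * π) (by positivity) ?_)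
    exact Subtype.ext (by simpa [monomial] using he)
  · refine ⟨_, ⟨monomial 1 0, Algebra.subset_adjoin ⟨(1, 0), rfl⟩, rfl⟩, fun he => h ?_⟩
    refine AddCircle.injective_toCircle (T := 2 * π) (by positivity) ?_
    exact Subtype.ext (by simpa [monomial] using he)

theorem span_monomial_closure_eq_top :
    (Submodule.span ℂ (range fun p : ℤ × ℤ => monomial p.1 p.2)).topologicalClosure = ⊤ := by
  rw [← trigSubalgebra_coe]
  exact congrArg (Subalgebra.toSubmodule <| StarSubalgebra.toSubalgebra ·)
    (ContinuousMap.starSubalgebra_topologicalClosure_eq_top_of_separatesPoints _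
      trigSubalgebra_separatesPoints)

theorem inner_eq_integral (f g : L2) :
    inner ℂ f g = ∫ z, g z * (starRingEnd ℂ) (f z) := by
  rw [L2.inner_def]
  rfl

/-- By Stone–Weierstrass the monomials span a dense subspace of the continuous functions, hence of
`L²`; a function orthogonal to all of them vanishes. -/
theorem eq_zero_of_integral_monomial_eq_zero {u : L2}
    (h : ∀ m n : ℤ, ∫ z, u z * monomial m n z = 0) : u = 0 := by
  set T := ContinuousMap.toLp (E := ℂ) 2 (volume : Measure Torus) ℂ with hT
  have hd : ((Submodule.span ℂ (range fun p : ℤ × ℤ => monomial p.1 p.2)).map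
      (T : C(Torus, ℂ) →ₗ[ℂ] L2)).topologicalClosure = ⊤ :=
    (ContinuousMap.toLp_denseRange ℂ (volume : Measure Torus) ℂ
      (by simp)).topologicalClosure_map_submodule span_monomial_closure_eq_top
  rw [Submodule.map_span, Submodule.topologicalClosure_eq_top_iff] at hd
  have hu : u ∈ (Submodule.span ℂ ((T : C(Torus, ℂ) →ₗ[ℂ] L2) ''
      range fun p : ℤ × ℤ => monomial p.1 p.2))ᗮ := by
    rw [Submodule.mem_orthogonal]
    intro v hv
    induction hv using Submodule.span_induction with
    | mem v hv =>
      obtain ⟨_, ⟨p, rfl⟩, rfl⟩ := hv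
      rw [inner_eq_integral, ← h (-p.1) (-p.2)]
      refine integral_congr_ae ?_
      filter_upwards [ContinuousMap.coeFn_toLp (p := 2) (𝕜 := ℂ) (volume : Measure Torus)
        (monomial p.1 p.2)] with z hz
      rw [ContinuousLinearMap.coe_coe, hz, conj_monomial]
    | zero => simp
    | add a b _ _ ha hb => rw [inner_add_left, ha, hb, add_zero]
    | smul c a _ ha => rw [inner_smul_left, ha, mul_zero]
  rw [hd] at hu
  simpa using hu

end Monomials

/-! ### Density of smooth functions in the Sobolev space -/

section Density

theorem memLp_of_continuous {φ : Torus → ℂ} (h : Continuous φ) :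
    MemLp φ 2 (volume : Measure Torus) :=
  h.memLp_of_hasCompactSupport (HasCompactSupport.of_compactSpace φ)

theorem continuous_integral_mul {ψ : Torus → ℂ} (h : Continuous ψ) :
    Continuous fun u : L2 => ∫ z, u z * ψ z := by
  have hc : Continuous fun z => (starRingEnd ℂ) (ψ z) := Complex.continuous_conj.comp h
  have e : (fun u : L2 => ∫ z, u z * ψ z)
      = fun u : L2 => inner ℂ ((memLp_of_continuous hc).toLp _) u := by
    funext u
    rw [inner_eq_integral]
    refine integral_congr_ae ?_
    filter_upwards [(memLp_of_continuous hc).coeFn_toLp] with z hz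
    rw [hz, Complex.conj_conj]
  rw [e]
  fun_prop

/-- Each weak derivative relation is a closed condition, because pairing with a fixed continuous
function is continuous on `L²`. Completeness follows, which the criterion of density by
orthogonality requires. -/
theorem isClosed_H1 : IsClosed (H1 : Set (PiLp 2 (fun _ : Fin 3 => L2))) := by
  have e : (H1 : Set (PiLp 2 (fun _ : Fin 3 => L2)))
      = (⋂ φ : {φ : Torus → ℂ // IsTest φ}, {w | ∫ z, w 0 z * dx φ.1 z = -∫ z, w 1 z * φ.1 z})
        ∩ ⋂ φ : {φ : Torus → ℂ // IsTest φ},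
            {w | ∫ z, w 0 z * dy φ.1 z = -∫ z, w 2 z * φ.1 z} := by
    ext w
    simp only [mem_inter_iff, mem_iInter, mem_ofPred_eq, Subtype.forall]
    rfl
  rw [e]
  refine (isClosed_iInter fun φ => ?_).inter (isClosed_iInter fun φ => ?_)
  · exact isClosed_eq ((continuous_integral_mul φ.2.continuous_dx).comp (by fun_prop))
      ((continuous_integral_mul φ.2.continuous).comp (by fun_prop)).neg
  · exact isClosed_eq ((continuous_integral_mul φ.2.continuous_dy).comp (by fun_prop))
      ((continuous_integral_mul φ.2.continuous).comp (by fun_prop)).neg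

instance completeSpace_H1 : CompleteSpace H1 := isClosed_H1.completeSpace_coe

theorem inner_H1 (u v : H1) : inner ℂ u v
    = inner ℂ (fn u) (fn v) + inner ℂ (wdx u) (wdx v) + inner ℂ (wdy u) (wdy v) := by
  rw [Submodule.coe_inner, PiLp.inner_apply, Fin.sum_univ_three]
  rfl

theorem ext_H1 {u v : H1} (h₀ : fn u = fn v) (h₁ : wdx u = wdx v) (h₂ : wdy u = wdy v) :
    u = v := by
  refine Subtype.ext (PiLp.ext fun i => ?_)
  fin_cases i
  exacts [h₀, h₁, h₂]

/-- The element `v` of `H¹` is represented by the smooth function `φ`. -/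
structure IsSmoothRep (v : H1) (φ : Torus → ℂ) : Prop where
  test : IsTest φ
  fn_eq : fn v =ᵐ[volume] φ
  wdx_eq : wdx v =ᵐ[volume] dx φ
  wdy_eq : wdy v =ᵐ[volume] dy φ

theorem exists_isSmoothRep {φ : Torus → ℂ} (h : IsTest φ) : ∃ v : H1, IsSmoothRep v φ := by
  have h0 := memLp_of_continuous h.continuous
  have h1 := memLp_of_continuous h.continuous_dx
  have h2 := memLp_of_continuous h.continuous_dy
  refine ⟨⟨WithLp.toLp 2 ![h0.toLp, h1.toLp, h2.toLp], ?_, ?_⟩,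
    h, h0.coeFn_toLp, h1.coeFn_toLp, h2.coeFn_toLp⟩
  · intro ψ hψ
    refine Eq.trans ?_ ((h.integral_mul_dx hψ).trans (congrArg Neg.neg ?_))
    · refine integral_congr_ae ?_
      filter_upwards [h0.coeFn_toLp] with z hz using congrArg (· * dx ψ z) hz
    · refine integral_congr_ae ?_
      filter_upwards [h1.coeFn_toLp] with z hz using (congrArg (· * ψ z) hz).symm
  · intro ψ hψ
    refine Eq.trans ?_ ((h.integral_mul_dy hψ).trans (congrArg Neg.neg ?_))
    · refine integral_congr_ae ?_
      filter_upwards [h0.coeFn_toLp] with z hz using congrArg (· * dy ψ z) hz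
    · refine integral_congr_ae ?_
      filter_upwards [h2.coeFn_toLp] with z hz using (congrArg (· * ψ z) hz).symm

theorem IsSmoothRep.add {u v : H1} {φ ψ : Torus → ℂ} (hu : IsSmoothRep u φ)
    (hv : IsSmoothRep v ψ) : IsSmoothRep (u + v) fun z => φ z + ψ z where
  test := hu.test.add hv.test
  fn_eq := by
    filter_upwards [Lp.coeFn_add (fn u) (fn v), hu.fn_eq, hv.fn_eq] with z h1 h2 h3
    exact h1.trans (by rw [Pi.add_apply, h2, h3])
  wdx_eq := by
    filter_upwards [Lp.coeFn_add (wdx u) (wdx v), hu.wdx_eq, hv.wdx_eq] with z h1 h2 h3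
    exact h1.trans (by rw [Pi.add_apply, h2, h3, dx_add hu.test hv.test])
  wdy_eq := by
    filter_upwards [Lp.coeFn_add (wdy u) (wdy v), hu.wdy_eq, hv.wdy_eq] with z h1 h2 h3
    exact h1.trans (by rw [Pi.add_apply, h2, h3, dy_add hu.test hv.test])

theorem IsSmoothRep.smul {u : H1} {φ : Torus → ℂ} (hu : IsSmoothRep u φ) (c : ℂ) :
    IsSmoothRep (c • u) fun z => c * φ z where
  test := hu.test.const_mul c
  fn_eq := by
    filter_upwards [Lp.coeFn_smul c (fn u), hu.fn_eq] with z h1 h2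
    exact h1.trans (by rw [Pi.smul_apply, h2, smul_eq_mul])
  wdx_eq := by
    filter_upwards [Lp.coeFn_smul c (wdx u), hu.wdx_eq] with z h1 h2
    exact h1.trans (by rw [Pi.smul_apply, h2, smul_eq_mul, dx_const_mul hu.test])
  wdy_eq := by
    filter_upwards [Lp.coeFn_smul c (wdy u), hu.wdy_eq] with z h1 h2
    exact h1.trans (by rw [Pi.smul_apply, h2, smul_eq_mul, dy_const_mul hu.test])

/-- The smooth elements of `H¹`. -/
def smoothSubmodule : Submodule ℂ H1 where
  carrier := {v | ∃ φ, IsSmoothRep v φ}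
  zero_mem' := by
    obtain ⟨v, hv⟩ := exists_isSmoothRep (φ := fun _ => 0) contDiff_const
    have := hv.smul 0
    rw [zero_smul] at this
    exact ⟨_, this⟩
  add_mem' := fun ⟨_, hu⟩ ⟨_, hv⟩ => ⟨_, hu.add hv⟩
  smul_mem' := fun c _ ⟨_, hu⟩ => ⟨_, hu.smul c⟩

theorem hasWeakDx (u : H1) : HasWeakDx (fn u) (wdx u) := u.2.1

theorem hasWeakDy (u : H1) : HasWeakDy (fn u) (wdy u) := u.2.2

theorem inner_smooth_left {f g : L2} {φ : Torus → ℂ} (h : f =ᵐ[volume] φ) :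
    inner ℂ f g = ∫ z, g z * (starRingEnd ℂ) (φ z) := by
  rw [inner_eq_integral]
  refine integral_congr_ae ?_
  filter_upwards [h] with z hz
  rw [hz]

/-- An element orthogonal to the smooth functions is tested against monomials: moving the
derivatives multiplies the Fourier coefficient by `1 + m² + n²`, so all coefficients vanish. Its
weak derivatives vanish with it. -/
theorem smoothSubmodule_closure_eq_top : smoothSubmodule.topologicalClosure = ⊤ := by
  rw [Submodule.topologicalClosure_eq_top_iff, Submodule.eq_bot_iff]
  intro q hq
  rw [Submodule.mem_orthogonal] at hq
  have hfn : fn q = 0 := by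
    refine eq_zero_of_integral_monomial_eq_zero fun m n => ?_
    obtain ⟨v, hv⟩ := exists_isSmoothRep (isTest_monomial (-m) (-n))
    have h0 := hq v ⟨_, hv⟩
    rw [inner_H1, inner_smooth_left hv.fn_eq, inner_smooth_left hv.wdx_eq,
      inner_smooth_left hv.wdy_eq] at h0
    simp only [dx_monomial, dy_monomial, map_mul, conj_monomial, neg_neg, Complex.conj_I,
      map_intCast] at h0
    have hx := hasWeakDx q _ ((isTest_monomial m n).const_mul (Complex.I * m))
    have hy := hasWeakDy q _ ((isTest_monomial m n).const_mul (Complex.I * n))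
    simp only [dx_const_mul (isTest_monomial m n), dy_const_mul (isTest_monomial m n),
      dx_monomial, dy_monomial] at hx hy
    have ex : ∀ (f : L2) (c : ℂ), ∫ z, f z * (c * monomial m n z)
        = c * ∫ z, f z * monomial m n z := fun f c => by
      rw [← integral_const_mul]
      congr 1
      funext z
      ring
    have ex2 : ∀ (f : L2) (c : ℂ), ∫ z, f z * (c * (c * monomial m n z))
        = c * (c * ∫ z, f z * monomial m n z) := fun f c => by
      rw [← integral_const_mul, ← integral_const_mul]
      congr 1
      funext z
      ring
    simp only [Int.cast_neg, mul_neg, neg_mul, neg_neg] at h0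
    rw [ex, ex] at h0
    rw [ex2, ex] at hx hy
    have key : ((1 + m ^ 2 + n ^ 2 : ℝ) : ℂ) * ∫ z, fn q z * monomial m n z = 0 := by
      push_cast
      linear_combination h0 - hx - hy + (m ^ 2 + n ^ 2) * (∫ z, fn q z * monomial m n z)
        * Complex.I_sq
    exact (mul_eq_zero.1 key).resolve_left (Complex.ofReal_ne_zero.2 (by positivity))
  have hzero : ∀ χ : Torus → ℂ, ∫ z, fn q z * χ z = 0 := fun χ => by
    rw [hfn]
    rw [← integral_zero Torus ℂ (μ := volume)]
    refine integral_congr_ae ?_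
    filter_upwards [Lp.coeFn_zero ℂ 2 (volume : Measure Torus)] with z hz
    rw [hz, Pi.zero_apply, zero_mul]
  refine ext_H1 hfn ?_ ?_
  · refine eq_zero_of_integral_monomial_eq_zero fun m n => ?_
    have := hasWeakDx q _ (isTest_monomial m n)
    rwa [hzero, eq_comm, neg_eq_zero] at this
  · refine eq_zero_of_integral_monomial_eq_zero fun m n => ?_
    have := hasWeakDy q _ (isTest_monomial m n)
    rwa [hzero, eq_comm, neg_eq_zero] at this

theorem exists_seq_smooth_tendsto (v : H1) : ∃ (w : ℕ → H1) (φ : ℕ → Torus → ℂ),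
    (∀ n, IsSmoothRep (w n) (φ n)) ∧ Filter.Tendsto w Filter.atTop (nhds v) := by
  have hv : v ∈ closure (smoothSubmodule : Set H1) := by
    rw [← Submodule.topologicalClosure_coe, smoothSubmodule_closure_eq_top]
    trivial
  obtain ⟨w, hw, hlim⟩ := mem_closure_iff_seq_limit.1 hv
  choose φ hφ using hw
  exact ⟨w, φ, hφ, hlim⟩

end Density

/-! ### The damping form on smooth functions -/

section Trace

/-- Pointwise bound along the first variable. -/
theorem IsTest.sq_norm_le {φ : Torus → ℂ} (h : IsTest φ) (x y : S1) :
    ‖φ (x, y)‖ ^ 2 ≤ (1 / π) * (∫ t : S1, ‖φ (t, y)‖ ^ 2)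
      + 4 * π * ∫ t : S1, ‖dx φ (t, y)‖ ^ 2 := by
  have hpi := pi_pos
  have hcy : Continuous fun t : ℝ => ((t : S1), y) :=
    (AddCircle.continuous_mk' (2 * π)).prodMk continuous_const
  have hf : Continuous fun t : ℝ => φ ((t : S1), y) := h.continuous.comp hcy
  have hg : Continuous fun t : ℝ => dx φ ((t : S1), y) := h.continuous_dx.comp hcy
  obtain ⟨x', hx', rfl⟩ : ∃ x' ∈ Icc (-π) (-π + 2 * π), ((x' : ℝ) : S1) = x := by
    obtain ⟨b, hb, hbx⟩ := (AddCircle.coe_image_Icc_eq (2 * π) (-π)).symm ▸ mem_univ x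
    exact ⟨b, hb, hbx⟩
  rw [← AddCircle.intervalIntegral_preimage (2 * π) (-π) fun t : S1 => ‖φ (t, y)‖ ^ 2,
    ← AddCircle.intervalIntegral_preimage (2 * π) (-π) fun t : S1 => ‖dx φ (t, y)‖ ^ 2]
  -- The weighted inequality with weight `1` on a full period is the one-dimensional Sobolev bound.
  have key := weight_mul_sq_norm_le (ω := fun _ => 1) (fun _ => zero_le_one)
    (fun _ _ => intervalIntegrable_const) hf hg (a := -π) (b := -π + 2 * π)
    (fun t _ => h.hasDerivAt_dx t y) le_rfl le_rfl hx'
  simp only [one_mul, intervalIntegral.integral_const, smul_eq_mul, mul_one,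
    add_sub_cancel_left] at key
  set A := ∫ t in (-π)..(-π + 2 * π), ‖φ ((t : S1), y)‖ ^ 2
  set B := ∫ t in (-π)..(-π + 2 * π), ‖dx φ ((t : S1), y)‖ ^ 2
  refine le_of_mul_le_mul_right ?_ (by positivity : 0 < 2 * π)
  refine key.trans (le_of_eq ?_)
  field_simp
  ring

theorem norm_sq_L2 (f : L2) : ‖f‖ ^ 2 = ∫ z, ‖f z‖ ^ 2 := by
  have h := inner_self_eq_norm_sq_to_K (𝕜 := ℂ) f
  rw [inner_eq_integral] at h
  have e : ∀ z, f z * (starRingEnd ℂ) (f z) = ((‖f z‖ ^ 2 : ℝ) : ℂ) := fun z => by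
    rw [Complex.mul_conj, Complex.normSq_eq_norm_sq]
  simp_rw [e] at h
  rw [integral_complex_ofReal] at h
  refine Complex.ofReal_injective (Eq.trans ?_ h.symm)
  push_cast
  rfl

variable {w : S1 → ℝ}

/-- The supremum in `x` on each horizontal slice is controlled by the slice's `H¹` norm, so a merely
integrable weight in `x` can be integrated out. This handles singular dampings. -/
theorem IsSmoothRep.weighted_integral_le (hw : ∀ x, 0 ≤ w x) (hwi : Integrable w) {v : H1}
    {φ : Torus → ℂ} (h : IsSmoothRep v φ) :
    ∫ z : Torus, w z.1 * ‖fn v z‖ ^ 2 ≤ (1 / π + 4 * π) * (∫ x, w x) * ‖v‖ ^ 2 := by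
  have hpi := pi_pos
  have hφ : Continuous fun z => ‖φ z‖ ^ 2 := h.test.continuous.norm.pow 2
  have hdφ : Continuous fun z => ‖dx φ z‖ ^ 2 := h.test.continuous_dx.norm.pow 2
  have hi : ∀ {g : Torus → ℝ}, Continuous g → Integrable g := fun {g} hg =>
    hg.integrable_of_hasCompactSupport (HasCompactSupport.of_compactSpace g)
  set Ψ : S1 → ℝ := fun y => (1 / π) * (∫ t : S1, ‖φ (t, y)‖ ^ 2)
      + 4 * π * ∫ t : S1, ‖dx φ (t, y)‖ ^ 2 with hΨ
  have i1 : Integrable fun y : S1 => ∫ t : S1, ‖φ (t, y)‖ ^ 2 := (hi hφ).integral_prod_right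
  have i2 : Integrable fun y : S1 => ∫ t : S1, ‖dx φ (t, y)‖ ^ 2 := (hi hdφ).integral_prod_right
  have hΨi : Integrable Ψ := (i1.const_mul _).add (i2.const_mul _)
  have hΨint : ∫ y, Ψ y = (1 / π) * ‖fn v‖ ^ 2 + 4 * π * ‖wdx v‖ ^ 2 := by
    rw [hΨ, integral_add (i1.const_mul _) (i2.const_mul _), integral_const_mul, integral_const_mul,
      norm_sq_L2, norm_sq_L2]
    congr 2
    · rw [integral_congr_ae (g := fun z => ‖φ z‖ ^ 2)
        (by filter_upwards [h.fn_eq] with z hz using by rw [hz]), Measure.volume_eq_prod,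
        integral_prod_symm _ (hi hφ)]
    · rw [integral_congr_ae (g := fun z => ‖dx φ z‖ ^ 2)
        (by filter_upwards [h.wdx_eq] with z hz using by rw [hz]), Measure.volume_eq_prod,
        integral_prod_symm _ (hi hdφ)]
  have h1 : ∫ z : Torus, w z.1 * ‖fn v z‖ ^ 2 ≤ ∫ z : Torus, w z.1 * Ψ z.2 := by
    refine integral_mono_of_nonneg (Filter.Eventually.of_forall fun z =>
      mul_nonneg (hw _) (sq_nonneg _)) (hwi.mul_prod hΨi) ?_
    filter_upwards [h.fn_eq] with z hz
    simp only [hz]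
    exact mul_le_mul_of_nonneg_left (h.test.sq_norm_le z.1 z.2) (hw _)
  refine h1.trans ?_
  have hv := norm_sq_H1 v
  have hw0 : 0 ≤ ∫ x, w x := integral_nonneg hw
  have hprod : ∫ z : Torus, w z.1 * Ψ z.2 = (∫ x, w x) * ∫ y, Ψ y := by
    rw [Measure.volume_eq_prod]
    exact integral_prod_mul _ _
  rw [hprod, hΨint, hv]
  have e : (1 / π) * ‖fn v‖ ^ 2 + 4 * π * ‖wdx v‖ ^ 2
      ≤ (1 / π + 4 * π) * (‖fn v‖ ^ 2 + ‖wdx v‖ ^ 2 + ‖wdy v‖ ^ 2) := by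
    have h3 : 0 ≤ (1 / π) * (‖wdx v‖ ^ 2 + ‖wdy v‖ ^ 2) := by positivity
    have h4 : 0 ≤ 4 * π * (‖fn v‖ ^ 2 + ‖wdy v‖ ^ 2) := by positivity
    linarith
  calc _ ≤ (∫ x, w x) * ((1 / π + 4 * π) * (‖fn v‖ ^ 2 + ‖wdx v‖ ^ 2 + ‖wdy v‖ ^ 2)) := by
        gcongr
    _ = _ := by ring

end Trace

/-! ### The damping form on the whole Sobolev space -/

section Trace

variable {w : S1 → ℝ}

theorem exists_norm_bound {φ : Torus → ℂ} (h : Continuous φ) : ∃ C, ∀ z, ‖φ z‖ ≤ C := by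
  obtain ⟨C, hC⟩ := isCompact_univ.exists_bound_of_continuousOn h.continuousOn
  exact ⟨C, fun z => hC z (mem_univ z)⟩

theorem integrable_mul_of_continuous' {g φ : Torus → ℂ} (hg : Integrable g) (h : Continuous φ) :
    Integrable fun z => g z * φ z := by
  obtain ⟨C, hC⟩ := exists_norm_bound h
  exact hg.mul_bdd h.aestronglyMeasurable (Filter.Eventually.of_forall hC)

theorem integrable_weight (hwi : Integrable w) : Integrable fun z : Torus => w z.1 :=
  hwi.comp_fst volume

theorem IsSmoothRep.integrable_weighted (hwi : Integrable w) {v : H1}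
    {φ : Torus → ℂ} (h : IsSmoothRep v φ) :
    Integrable fun z : Torus => w z.1 * ‖fn v z‖ ^ 2 := by
  obtain ⟨C, hC⟩ := exists_norm_bound h.test.continuous
  have h1 : Integrable fun z : Torus => w z.1 * ‖φ z‖ ^ 2 :=
    (integrable_weight hwi).mul_bdd (c := C ^ 2)
      (h.test.continuous.norm.pow 2).aestronglyMeasurable
      (Filter.Eventually.of_forall fun z => by
        rw [norm_pow, norm_norm]
        exact pow_le_pow_left₀ (norm_nonneg _) (hC z) 2)
  refine h1.congr ?_
  filter_upwards [h.fn_eq] with z hz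
  rw [hz]

theorem continuous_fn : Continuous fn := by
  unfold fn
  fun_prop

theorem continuous_wdx : Continuous wdx := by
  unfold wdx
  fun_prop

theorem continuous_wdy : Continuous wdy := by
  unfold wdy
  fun_prop

/-- The damping term is a bounded quadratic form on `H¹`. -/
theorem weighted_lintegral_le (hw : ∀ x, 0 ≤ w x) (hwm : Measurable w) (hwi : Integrable w)
    (v : H1) : ∫⁻ z : Torus, ENNReal.ofReal (w z.1 * ‖fn v z‖ ^ 2)
      ≤ ENNReal.ofReal ((1 / π + 4 * π) * (∫ x, w x) * ‖v‖ ^ 2) := by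
  obtain ⟨u, φ, hφ, hlim⟩ := exists_seq_smooth_tendsto v
  have hfn : Filter.Tendsto (fun n => fn (u n)) Filter.atTop (nhds (fn v)) :=
    (continuous_fn.tendsto v).comp hlim
  -- Convergence almost everywhere along a subsequence, followed by Fatou's lemma; working with `∫⁻`
  -- avoids presupposing that the limit is integrable.
  obtain ⟨ns, hns, hae⟩ := (tendstoInMeasure_of_tendsto_Lp hfn).exists_seq_tendsto_ae
  have hmeas : ∀ n, Measurable fun z : Torus =>
      ENNReal.ofReal (w z.1 * ‖fn (u (ns n)) z‖ ^ 2) := fun n =>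
    ((hwm.comp measurable_fst).mul
      ((Lp.stronglyMeasurable (fn (u (ns n)))).measurable.norm.pow_const 2)).ennreal_ofReal
  have h1 : ∫⁻ z : Torus, ENNReal.ofReal (w z.1 * ‖fn v z‖ ^ 2)
      ≤ ∫⁻ z : Torus, Filter.liminf
        (fun n => ENNReal.ofReal (w z.1 * ‖fn (u (ns n)) z‖ ^ 2)) Filter.atTop := by
    refine lintegral_mono_ae ?_
    filter_upwards [hae] with z hz
    refine le_of_eq (Filter.Tendsto.liminf_eq ?_).symm
    exact ENNReal.tendsto_ofReal ((hz.norm.pow 2).const_mul _)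
  refine h1.trans ((lintegral_liminf_le hmeas).trans ?_)
  have h2 : Filter.Tendsto (fun n => ENNReal.ofReal
      ((1 / π + 4 * π) * (∫ x, w x) * ‖u (ns n)‖ ^ 2)) Filter.atTop
      (nhds (ENNReal.ofReal ((1 / π + 4 * π) * (∫ x, w x) * ‖v‖ ^ 2))) :=
    ENNReal.tendsto_ofReal (((hlim.comp hns.tendsto_atTop).norm.pow 2).const_mul _)
  rw [← h2.liminf_eq]
  refine Filter.liminf_le_liminf (Filter.Eventually.of_forall fun n => ?_)
  rw [← ofReal_integral_eq_lintegral_ofReal ((hφ (ns n)).integrable_weighted hwi)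
    (Filter.Eventually.of_forall fun z => mul_nonneg (hw _) (sq_nonneg _))]
  exact ENNReal.ofReal_le_ofReal ((hφ (ns n)).weighted_integral_le hw hwi)

theorem integrable_weighted (hw : ∀ x, 0 ≤ w x) (hwm : Measurable w) (hwi : Integrable w)
    (v : H1) : Integrable fun z : Torus => w z.1 * ‖fn v z‖ ^ 2 := by
  refine ⟨((hwm.comp measurable_fst).mul
    ((Lp.stronglyMeasurable (fn v)).measurable.norm.pow_const 2)).aestronglyMeasurable, ?_⟩
  rw [hasFiniteIntegral_iff_ofReal (Filter.Eventually.of_forall fun z =>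
    mul_nonneg (hw _) (sq_nonneg _))]
  exact (weighted_lintegral_le hw hwm hwi v).trans_lt ENNReal.ofReal_lt_top

theorem weighted_integral_le (hw : ∀ x, 0 ≤ w x) (hwm : Measurable w) (hwi : Integrable w)
    (v : H1) : ∫ z : Torus, w z.1 * ‖fn v z‖ ^ 2 ≤ (1 / π + 4 * π) * (∫ x, w x) * ‖v‖ ^ 2 := by
  have h := weighted_lintegral_le hw hwm hwi v
  rw [← ofReal_integral_eq_lintegral_ofReal (integrable_weighted hw hwm hwi v)
    (Filter.Eventually.of_forall fun z => mul_nonneg (hw _) (sq_nonneg _))] at h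
  refine (ENNReal.ofReal_le_ofReal_iff ?_).1 h
  have : 0 ≤ ∫ x, w x := integral_nonneg hw
  have := pi_pos
  positivity

end Trace

/-! ### Dissipativity of the damped wave operator -/

section Dissipation

variable {W : Torus → ℝ} {u u' v v' : H1} {f f' : L2}

theorem HasDampedLaplacian.integrable_integrand (h : HasDampedLaplacian W u v f) {φ : Torus → ℂ}
    (hφ : IsTest φ) : Integrable fun z =>
      wdx u z * dx φ z + wdy u z * dy φ z + (W z : ℂ) * fn v z * φ z :=
  ((integrable_mul_of_continuous (wdx u) hφ.continuous_dx).add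
    (integrable_mul_of_continuous (wdy u) hφ.continuous_dy)).add
    (integrable_mul_of_continuous' h.1 hφ.continuous)

theorem HasDampedLaplacian.add (h : HasDampedLaplacian W u v f)
    (h' : HasDampedLaplacian W u' v' f') : HasDampedLaplacian W (u + u') (v + v') (f + f') := by
  have hv : fn (v + v') =ᵐ[volume] fn v + fn v' := Lp.coeFn_add (fn v) (fn v')
  have hx : wdx (u + u') =ᵐ[volume] wdx u + wdx u' := Lp.coeFn_add (wdx u) (wdx u')
  have hy : wdy (u + u') =ᵐ[volume] wdy u + wdy u' := Lp.coeFn_add (wdy u) (wdy u')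
  refine ⟨(h.1.add h'.1).congr ?_, fun φ hφ => ?_⟩
  · filter_upwards [hv] with z hz
    rw [hz]
    simp only [Pi.add_apply]
    ring
  · have e := integral_add (h.integrable_integrand hφ) (h'.integrable_integrand hφ)
    have e' := integral_add (integrable_mul_of_continuous f hφ.continuous)
      (integrable_mul_of_continuous f' hφ.continuous)
    rw [h.2 φ hφ, h'.2 φ hφ, ← e'] at e
    refine Eq.trans ?_ (e.trans ?_)
    · refine integral_congr_ae ?_
      filter_upwards [hv, hx, hy] with z h1 h2 h3
      rw [h1, h2, h3]
      simp only [Pi.add_apply]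
      ring
    · refine integral_congr_ae ?_
      filter_upwards [Lp.coeFn_add f f'] with z h1
      rw [h1]
      simp only [Pi.add_apply]
      ring

theorem HasDampedLaplacian.smul (h : HasDampedLaplacian W u v f) (c : ℂ) :
    HasDampedLaplacian W (c • u) (c • v) (c • f) := by
  have hv : fn (c • v) =ᵐ[volume] c • ⇑(fn v) := Lp.coeFn_smul c (fn v)
  have hx : wdx (c • u) =ᵐ[volume] c • ⇑(wdx u) := Lp.coeFn_smul c (wdx u)
  have hy : wdy (c • u) =ᵐ[volume] c • ⇑(wdy u) := Lp.coeFn_smul c (wdy u)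
  refine ⟨(h.1.const_mul c).congr ?_, fun φ hφ => ?_⟩
  · filter_upwards [hv] with z hz
    rw [hz]
    simp only [Pi.smul_apply, smul_eq_mul]
    ring
  · have e := congrArg (c * ·) (h.2 φ hφ)
    simp only [← integral_const_mul] at e
    refine Eq.trans ?_ (e.trans ?_)
    · refine integral_congr_ae ?_
      filter_upwards [hv, hx, hy] with z h1 h2 h3
      rw [h1, h2, h3]
      simp only [Pi.smul_apply, smul_eq_mul]
      ring
    · refine integral_congr_ae ?_
      filter_upwards [Lp.coeFn_smul c f] with z h1
      rw [h1]
      simp only [Pi.smul_apply, smul_eq_mul]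
      ring

theorem WaveOperator.sub {X X' Y Y' : EnergySpace} (h : WaveOperator W X Y)
    (h' : WaveOperator W X' Y') : WaveOperator W (X - X') (Y - Y') := by
  refine ⟨?_, ?_⟩
  · have e : fn (Y - Y').1 = fn Y.1 - fn Y'.1 := rfl
    rw [e, h.1, h'.1]
    rfl
  · have e := h.2.add (h'.2.smul (-1))
    have e1 : X.1 + (-1 : ℂ) • X'.1 = (X - X').1 := by
      rw [neg_one_smul, ← sub_eq_add_neg]; rfl
    have e2 : Y.1 + (-1 : ℂ) • Y'.1 = (Y - Y').1 := by
      rw [neg_one_smul, ← sub_eq_add_neg]; rfl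
    have e3 : -Y.2 + (-1 : ℂ) • -Y'.2 = -(Y - Y').2 := by
      rw [neg_one_smul, Prod.snd_sub]; abel
    rwa [e1, e2, e3] at e

/-- The weak equation tested with the conjugate of a smooth function, written with inner products.
-/
theorem HasDampedLaplacian.inner_smooth {v' : H1} {φ : Torus → ℂ}
    (h : HasDampedLaplacian W u v f) (hφ : IsSmoothRep v' φ) :
    inner ℂ (fn v') f = inner ℂ (wdx v') (wdx u) + inner ℂ (wdy v') (wdy u)
      + ∫ z, (W z : ℂ) * fn v z * (starRingEnd ℂ) (φ z) := by
  have hc := hφ.test.conj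
  rw [inner_smooth_left hφ.fn_eq, inner_smooth_left hφ.wdx_eq, inner_smooth_left hφ.wdy_eq,
    ← h.2 _ hc]
  have i1 := integrable_mul_of_continuous (wdx u) hc.continuous_dx
  have i2 := integrable_mul_of_continuous (wdy u) hc.continuous_dy
  have i3 := integrable_mul_of_continuous' h.1 hc.continuous
  simp_rw [dx_conj hφ.test, dy_conj hφ.test] at i1 i2 ⊢
  have e1 := integral_add (i1.add i2) i3
  have e2 := integral_add i1 i2
  simp only [Pi.add_apply] at e1 e2
  rw [← e2, ← e1]

/-- The damping dissipates energy. -/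
theorem HasDampedLaplacian.inner_le {w : S1 → ℝ} (hw : ∀ x, 0 ≤ w x) (hwm : Measurable w)
    (hwi : Integrable w) (h : HasDampedLaplacian (fun z => w z.1) u v f) :
    (inner ℂ (wdx v) (wdx u) + inner ℂ (wdy v) (wdy u)).re ≤ (inner ℂ (fn v) f).re := by
  obtain ⟨s, φ, hφ, hlim⟩ := exists_seq_smooth_tendsto v
  set M := (1 / π + 4 * π) * ∫ x, w x with hM
  have key : ∀ n, (inner ℂ (wdx (s n)) (wdx u) + inner ℂ (wdy (s n)) (wdy u)).re
      - 1 / 2 * (M * ‖v - s n‖ ^ 2) ≤ (inner ℂ (fn (s n)) f).re := by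
    intro n
    rw [h.inner_smooth (hφ n), Complex.add_re _ (∫ z : Torus, _)]
    have i3 := integrable_mul_of_continuous' h.1 (hφ n).test.conj.continuous
    have hre : (∫ z : Torus, (w z.1 : ℂ) * fn v z * (starRingEnd ℂ) (φ n z)).re
        = ∫ z : Torus, ((w z.1 : ℂ) * fn v z * (starRingEnd ℂ) (φ n z)).re :=
      (integral_re i3).symm
    have hle := weighted_integral_le hw hwm hwi (v - s n)
    -- Pointwise `2 Re(v conj φ) = |v|² + |φ|² - |v - φ|²`. Dropping the first two terms leaves an
    -- error governed by the damping form of `v - φ`, which tends to zero with the `H¹` distance.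
    have hlow : ∫ z : Torus, -(1 / 2) * (w z.1 * ‖fn (v - s n) z‖ ^ 2)
        ≤ ∫ z : Torus, ((w z.1 : ℂ) * fn v z * (starRingEnd ℂ) (φ n z)).re := by
      refine integral_mono_ae ((integrable_weighted hw hwm hwi _).const_mul _) i3.re ?_
      have hsub : fn (v - s n) =ᵐ[volume] fn v - fn (s n) := Lp.coeFn_sub (fn v) (fn (s n))
      filter_upwards [hsub, (hφ n).fn_eq] with z h1 h2
      rw [h1, Pi.sub_apply, h2, mul_assoc, Complex.re_ofReal_mul, ← Complex.normSq_eq_norm_sq,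
        Complex.normSq_sub]
      have h3 := Complex.normSq_nonneg (fn v z)
      have h4 := Complex.normSq_nonneg (φ n z)
      nlinarith [hw z.1, mul_nonneg (hw z.1) h3, mul_nonneg (hw z.1) h4]
    rw [integral_const_mul] at hlow
    rw [hre]
    linarith
  have t1 : Filter.Tendsto (fun n => (inner ℂ (wdx (s n)) (wdx u)
      + inner ℂ (wdy (s n)) (wdy u)).re - 1 / 2 * (M * ‖v - s n‖ ^ 2)) Filter.atTop
      (nhds ((inner ℂ (wdx v) (wdx u) + inner ℂ (wdy v) (wdy u)).re
        - 1 / 2 * (M * ‖v - v‖ ^ 2))) := by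
    have hc : Continuous fun s : H1 => (inner ℂ (wdx s) (wdx u)
      + inner ℂ (wdy s) (wdy u)).re - 1 / 2 * (M * ‖v - s‖ ^ 2) := by
      have := continuous_wdx
      have := continuous_wdy
      fun_prop
    exact (hc.tendsto v).comp hlim
  have t2 : Filter.Tendsto (fun n => (inner ℂ (fn (s n)) f).re) Filter.atTop
      (nhds (inner ℂ (fn v) f).re) := by
    have hc : Continuous fun s : H1 => (inner ℂ (fn s) f).re := by
      have := continuous_fn
      fun_prop
    exact (hc.tendsto v).comp hlim
  have := le_of_tendsto_of_tendsto' t1 t2 key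
  simpa using this

end Dissipation

/-! ### Uniqueness of solutions -/

section Uniqueness

variable {w : S1 → ℝ}

/-- The gradient terms of the two components cancel up to the sign of the damping; what remains is
`2 Re ⟨u, v⟩`, from the `L²` part of the `H¹` norm, and it is at most `‖u‖² + ‖v‖²`. -/
theorem WaveOperator.inner_le (hw : ∀ x, 0 ≤ w x) (hwm : Measurable w) (hwi : Integrable w)
    {X Y : EnergySpace} (h : WaveOperator (fun z => w z.1) X Y) :
    2 * (inner ℂ X.1 Y.1).re + 2 * (inner ℂ X.2 Y.2).re ≤ ‖X.1‖ ^ 2 + ‖X.2‖ ^ 2 := by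
  have hd := h.2.inner_le hw hwm hwi
  rw [h.1, inner_neg_right, Complex.neg_re, Complex.add_re] at hd
  have hs : ∀ f g : L2, (inner ℂ f g).re = (inner ℂ g f).re := fun f g => inner_re_symm (𝕜 := ℂ) f g
  have hcs : 2 * (inner ℂ (fn X.1) X.2).re ≤ ‖fn X.1‖ ^ 2 + ‖X.2‖ ^ 2 := by
    have h1 : (inner ℂ (fn X.1) X.2).re ≤ ‖fn X.1‖ * ‖X.2‖ := re_inner_le_norm (𝕜 := ℂ) _ _
    nlinarith [sq_nonneg (‖fn X.1‖ - ‖X.2‖)]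
  rw [inner_H1, h.1, Complex.add_re, Complex.add_re, norm_sq_H1, hs (wdx X.1), hs (wdy X.1)]
  have := sq_nonneg ‖wdx X.1‖
  have := sq_nonneg ‖wdy X.1‖
  linarith

theorem hasDerivWithinAt_sq_norm {D : ℝ → EnergySpace} {Y : EnergySpace} {s : Set ℝ} {t : ℝ}
    (h : HasDerivWithinAt D Y s t) :
    HasDerivWithinAt (fun t => ‖(D t).1‖ ^ 2 + ‖(D t).2‖ ^ 2)
      (2 * (inner ℂ (D t).1 Y.1).re + 2 * (inner ℂ (D t).2 Y.2).re) s t := by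
  have h1 : HasDerivWithinAt (fun t => (D t).1) Y.1 s t :=
    (ContinuousLinearMap.fst ℝ H1 L2).hasFDerivAt.comp_hasDerivWithinAt t h
  have h2 : HasDerivWithinAt (fun t => (D t).2) Y.2 s t :=
    (ContinuousLinearMap.snd ℝ H1 L2).hasFDerivAt.comp_hasDerivWithinAt t h
  have key : ∀ {F : Type} [NormedAddCommGroup F] [InnerProductSpace ℂ F] [NormedSpace ℝ F]
      {f : ℝ → F} {f' : F}, HasDerivWithinAt f f' s t →
      HasDerivWithinAt (fun t => ‖f t‖ ^ 2) (2 * (inner ℂ (f t) f').re) s t := by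
    intro F _ _ _ f f' hf
    have h := Complex.reCLM.hasFDerivAt.comp_hasDerivWithinAt t (hf.inner ℂ hf)
    have e : (Complex.reCLM ∘ fun t => inner ℂ (f t) (f t)) = fun t => ‖f t‖ ^ 2 := by
      funext t
      exact (norm_sq_eq_re_inner (𝕜 := ℂ) (f t)).symm
    rw [e] at h
    refine h.congr_deriv ?_
    have hs : (inner ℂ f' (f t)).re = (inner ℂ (f t) f').re := inner_re_symm (𝕜 := ℂ) _ _
    simp only [Complex.reCLM_apply, Complex.add_re, hs]
    ring
  exact (key h1).add (key h2)

/-- Grönwall: the squared norm `E` of the difference satisfies `E' ≤ E` and `E 0 = 0`, so `e^{-t} E`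
is nonincreasing and stays zero. The full norm is used, since the wave energy does not see
constants. -/
theorem IsSolution.eqOn (hw : ∀ x, 0 ≤ w x) (hwm : Measurable w) (hwi : Integrable w)
    {u₀ u₁ : H1} {U V : ℝ → EnergySpace} (hU : IsSolution (fun z => w z.1) u₀ u₁ U)
    (hV : IsSolution (fun z => w z.1) u₀ u₁ V) : EqOn V U (Ici 0) := by
  set D : ℝ → EnergySpace := fun t => V t - U t with hD
  have hder : ∀ t : ℝ, 0 ≤ t → ∃ Y, WaveOperator (fun z => w z.1) (D t) Y ∧
      HasDerivWithinAt D Y (Ici 0) t := by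
    intro t ht
    obtain ⟨Y, hY, hYd⟩ := hV.2 t ht
    obtain ⟨Y', hY', hYd'⟩ := hU.2 t ht
    exact ⟨Y - Y', hY.sub hY', hYd.sub hYd'⟩
  choose! Y hWY hdY using hder
  set E : ℝ → ℝ := fun t => ‖(D t).1‖ ^ 2 + ‖(D t).2‖ ^ 2 with hE
  have hdE : ∀ t : ℝ, 0 ≤ t → HasDerivWithinAt (fun t => exp (-t) * E t)
      (exp (-t) * -1 * E t + exp (-t)
        * (2 * (inner ℂ (D t).1 (Y t).1).re + 2 * (inner ℂ (D t).2 (Y t).2).re)) (Ici 0) t :=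
    fun t ht => ((hasDerivAt_neg t).exp.hasDerivWithinAt).mul (hasDerivWithinAt_sq_norm (hdY t ht))
  have hanti : AntitoneOn (fun t => exp (-t) * E t) (Ici 0) := by
    refine antitoneOn_of_hasDerivWithinAt_nonpos (convex_Ici 0)
      (fun t ht => (hdE t ht).continuousWithinAt)
      (fun t ht => (hdE t (interior_subset ht)).mono interior_subset) fun t ht => ?_
    have h1 := (hWY t (interior_subset ht)).inner_le hw hwm hwi
    have h2 := exp_pos (-t)
    simp only [hE]
    nlinarith
  intro t ht
  have h0 : D 0 = 0 := by rw [hD]; simp only; rw [hV.1, hU.1, sub_self]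
  have h1 := hanti self_mem_Ici ht ht
  have h2 : E 0 = 0 := by simp [hE, h0]
  simp only [h2, mul_zero] at h1
  have h3 : E t ≤ 0 := by
    by_contra! hpos
    exact absurd h1 (not_le.2 (mul_pos (exp_pos _) hpos))
  have h4 : ‖(D t).1‖ ^ 2 = 0 := by
    have := sq_nonneg ‖(D t).1‖
    have := sq_nonneg ‖(D t).2‖
    simp only [hE] at h3
    linarith
  have h5 : ‖(D t).2‖ ^ 2 = 0 := by
    have := sq_nonneg ‖(D t).1‖
    have := sq_nonneg ‖(D t).2‖
    simp only [hE] at h3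
    linarith
  have h6 : D t = 0 := Prod.ext (by simpa using h4) (by simpa using h5)
  exact sub_eq_zero.1 h6

end Uniqueness

/-! ### Functions of `|x|` on the circle -/

section Circle

theorem integrable_lift {E : Type*} [NormedAddCommGroup E] {G : S1 → E} (hG : Integrable G) :
    IntegrableOn (fun x : ℝ => G (x : S1)) (Ioc (-π) (-π + 2 * π)) :=
  (AddCircle.measurePreserving_mk (2 * π) (-π)).integrable_comp_of_integrable hG

theorem intervalIntegrable_lift {E : Type*} [NormedAddCommGroup E] {G : S1 → E}
    (hG : Integrable G) {a b : ℝ} (ha : -π ≤ a) (hab : a ≤ b) (hb : b ≤ π) :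
    IntervalIntegrable (fun x : ℝ => G (x : S1)) volume a b := by
  rw [intervalIntegrable_iff_integrableOn_Ioc_of_le hab]
  exact (integrable_lift hG).mono_set (Ioc_subset_Ioc ha (by linarith))

theorem integral_circle_eq {E : Type*} [NormedAddCommGroup E] [NormedSpace ℝ E] {G : S1 → E}
    (hG : Integrable G) :
    ∫ x, G x = ∫ x in (0 : ℝ)..π, (G ((x : ℝ) : S1) + G ((-x : ℝ) : S1)) := by
  have hpi := pi_pos
  have i1 := intervalIntegrable_lift hG (a := -π) (b := 0) le_rfl (by linarith) hpi.le
  have i2 := intervalIntegrable_lift hG (a := 0) (b := π) (by linarith) hpi.le le_rfl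
  have i3 : IntervalIntegrable (fun x : ℝ => G ((-x : ℝ) : S1)) volume 0 π := by
    have := (IntervalIntegrable.iff_comp_neg (by simp)).1 i1
    rw [neg_neg, neg_zero] at this
    exact this.symm
  rw [intervalIntegral.integral_add i2 i3,
    intervalIntegral.integral_comp_neg (fun x : ℝ => G (x : S1)), neg_zero, add_comm,
    intervalIntegral.integral_add_adjacent_intervals i1 i2,
    ← AddCircle.intervalIntegral_preimage (2 * π) (-π)]
  congr 1
  ring

theorem norm_coe_of_mem {x : ℝ} (hx : x ∈ Icc 0 π) : ‖(x : S1)‖ = x := by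
  rw [norm_coe_eq_abs x (by rw [abs_of_nonneg hx.1]; exact hx.2), abs_of_nonneg hx.1]

theorem norm_coe_neg_of_mem {x : ℝ} (hx : x ∈ Icc 0 π) : ‖((-x : ℝ) : S1)‖ = x := by
  rw [AddCircle.coe_neg, norm_neg, norm_coe_of_mem hx]

theorem integrable_comp_norm {E : Type*} [NormedAddCommGroup E] {f : ℝ → E}
    (hf : ∀ a b : ℝ, IntervalIntegrable f volume a b) (hm : StronglyMeasurable f) :
    Integrable fun x : S1 => f ‖x‖ := by
  have hpi := pi_pos
  have hm' : AEStronglyMeasurable (fun x : S1 => f ‖x‖) :=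
    (hm.comp_measurable continuous_norm.measurable).aestronglyMeasurable
  rw [← (AddCircle.measurePreserving_mk (2 * π) (-π)).integrable_comp hm']
  have hi : IntervalIntegrable (fun x : ℝ => f ‖(x : S1)‖) volume (-π) (-π + 2 * π) := by
    refine IntervalIntegrable.trans (b := 0) ?_ ?_
    · have h1 : IntervalIntegrable (fun x => f (-x)) volume (-π) 0 := by
        have := (IntervalIntegrable.iff_comp_neg (by simp)).1 (hf π 0)
        rwa [neg_zero] at this
      refine h1.congr fun x hx => ?_
      rw [uIoc_of_le (by linarith)] at hx
      rw [norm_coe_eq_abs x (by rw [abs_of_nonpos hx.2]; linarith [hx.1]), abs_of_nonpos hx.2]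
    · refine (hf 0 (-π + 2 * π)).congr fun x hx => ?_
      rw [uIoc_of_le (by linarith)] at hx
      rw [norm_coe_of_mem ⟨hx.1.le, by linarith [hx.2]⟩]
  rwa [intervalIntegrable_iff_integrableOn_Ioc_of_le (by linarith)] at hi

/-- The sign of the representative in `[-π, π)`. -/
def circleSign (x : S1) : ℂ := if 0 < (AddCircle.equivIco (2 * π) (-π) x : ℝ) then 1 else -1

theorem measurable_circleSign : Measurable circleSign := by
  refine Measurable.ite ?_ measurable_const measurable_const
  exact measurableSet_lt measurable_const
    (measurable_subtype_coe.comp (AddCircle.measurableEquivIco (2 * π) (-π)).measurable)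

theorem norm_circleSign (x : S1) : ‖circleSign x‖ = 1 := by
  unfold circleSign
  split_ifs <;> simp

theorem circleSign_coe {x : ℝ} (hx : x ∈ Ioo 0 π) : circleSign (x : S1) = 1 := by
  have h : x ∈ Ico (-π) (-π + 2 * π) := ⟨by linarith [hx.1, hx.2], by linarith [hx.2]⟩
  simp [circleSign, AddCircle.equivIco_coe_eq h, hx.1]

theorem circleSign_coe_neg {x : ℝ} (hx : x ∈ Ioo 0 π) : circleSign ((-x : ℝ) : S1) = -1 := by
  have h : -x ∈ Ico (-π) (-π + 2 * π) := ⟨by linarith [hx.1, hx.2], by linarith [hx.1, hx.2]⟩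
  simp only [circleSign, AddCircle.equivIco_coe_eq h]
  rw [if_neg (by linarith [hx.1])]

end Circle

/-! ### Integrals of tensor products -/

section Fubini

variable {a : S1 → ℂ} {b : S1 → ℂ} {ψ : Torus → ℂ}

theorem integrable_tensor_mul (ha : Integrable a) (hb : Continuous b) (hψ : Continuous ψ) :
    Integrable fun z : Torus => a z.1 * b z.2 * ψ z := by
  have h1 : Integrable fun z : Torus => a z.1 := ha.comp_fst volume
  exact integrable_mul_of_continuous' (integrable_mul_of_continuous' (φ := fun z => b z.2) h1
    (by fun_prop)) hψ

theorem integral_tensor_mul (ha : Integrable a) (hb : Continuous b) (hψ : Continuous ψ) :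
    ∫ z : Torus, a z.1 * b z.2 * ψ z = ∫ y, b y * ∫ x, a x * ψ (x, y) := by
  have hi := integrable_tensor_mul ha hb hψ
  rw [Measure.volume_eq_prod] at hi ⊢
  rw [integral_prod_symm _ hi]
  refine integral_congr_ae (Filter.Eventually.of_forall fun y => ?_)
  simp only
  rw [← integral_const_mul]
  congr 1
  funext x
  ring

theorem integral_tensor_mul' (ha : Integrable a) (hb : Continuous b) (hψ : Continuous ψ) :
    ∫ z : Torus, a z.1 * b z.2 * ψ z = ∫ x, a x * ∫ y, b y * ψ (x, y) := by
  have hi := integrable_tensor_mul ha hb hψ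
  rw [Measure.volume_eq_prod] at hi ⊢
  rw [integral_prod _ hi]
  refine integral_congr_ae (Filter.Eventually.of_forall fun x => ?_)
  simp only
  rw [← integral_const_mul]
  congr 1
  funext y
  ring

theorem IsTest.integral_fourier_mul_dy {φ : Torus → ℂ} (h : IsTest φ) (k : ℤ) (x : S1) :
    ∫ y : S1, fourier k y * dy φ (x, y) = -(Complex.I * k * ∫ y : S1, fourier k y * φ (x, y)) := by
  have h0 := ((isTest_monomial 0 k).mul h).integral_dy_eq_zero x
  simp_rw [dy_mul (isTest_monomial 0 k) h, dy_monomial] at h0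
  have hi : ∀ {g : S1 → ℂ}, Continuous g → Integrable g := fun {g} hg =>
    hg.integrable_of_hasCompactSupport (HasCompactSupport.of_compactSpace g)
  have hφ := h.continuous
  have hdφ := h.continuous_dy
  have e : ∀ y, monomial 0 k (x, y) = fourier k y := fun y => by simp [monomial]
  simp_rw [e] at h0
  rw [integral_add (hi (by fun_prop)) (hi (by fun_prop))] at h0
  rw [← integral_const_mul]
  simp_rw [mul_assoc] at h0 ⊢
  linear_combination h0

end Fubini

/-! ### Even reflection of a Neumann solution -/

section Folding

variable {q : ℝ → ℂ} {σ : ℝ} {Y Z : ℝ → ℂ}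

theorem integrable_even (hY : Continuous Y) : Integrable fun x : S1 => Y ‖x‖ :=
  integrable_comp_norm (fun _ _ => hY.intervalIntegrable _ _) hY.stronglyMeasurable

theorem integrable_odd (hZ : Continuous Z) : Integrable fun x : S1 => circleSign x * Z ‖x‖ :=
  (integrable_even hZ).bdd_mul (c := 1) measurable_circleSign.aestronglyMeasurable
    (Filter.Eventually.of_forall fun x => (norm_circleSign x).le)

theorem integrable_mul_slice {a : S1 → ℂ} (ha : Integrable a) {φ : Torus → ℂ} (h : Continuous φ)
    (y : S1) : Integrable fun x => a x * φ (x, y) := by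
  obtain ⟨C, hC⟩ := exists_norm_bound h
  exact ha.mul_bdd (c := C) (Continuous.aestronglyMeasurable (by fun_prop))
    (Filter.Eventually.of_forall fun x => hC _)

theorem hasDerivAt_neg_slice {φ : Torus → ℂ} (h : IsTest φ) (x : ℝ) (y : S1) :
    HasDerivAt (fun x : ℝ => φ (((-x : ℝ) : S1), y)) (-dx φ (((-x : ℝ) : S1), y)) x := by
  have := (h.hasDerivAt_dx (-x) y).scomp x (hasDerivAt_neg x)
  simpa [Function.comp_def] using this

/-- Folded onto `[0, π]`, the even function meets only the odd part of `φ`, which vanishes at `0`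
and, by periodicity, at `π`. Hence the integration by parts leaves no boundary term. -/
theorem integral_even_mul_dx (h : IsNeumannSolution q σ π Y Z) {φ : Torus → ℂ} (hφ : IsTest φ)
    (y : S1) : ∫ x : S1, Y ‖x‖ * dx φ (x, y) = -∫ x : S1, circleSign x * Z ‖x‖ * φ (x, y) := by
  have hpi := pi_pos
  have hY := h.cont
  have hZ := h.cont'
  have hφc := hφ.continuous
  have hdφc := hφ.continuous_dx
  have hmk : Continuous fun x : ℝ => (x : S1) := AddCircle.continuous_mk' (2 * π)
  have i1 := integrable_mul_slice (integrable_even hY) hdφc y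
  have i2 := integrable_mul_slice (integrable_odd hZ) hφc y
  rw [eq_neg_iff_add_eq_zero, ← integral_add i1 i2]
  refine (integral_circle_eq (i1.add i2)).trans ?_
  simp only [Pi.add_apply]
  have key := MeasureTheory.integral_eq_of_hasDerivAt_off_countable_of_le
    (fun x : ℝ => Y x * (φ ((x : S1), y) - φ (((-x : ℝ) : S1), y)))
    (fun x : ℝ => Z x * (φ ((x : S1), y) - φ (((-x : ℝ) : S1), y))
      + Y x * (dx φ ((x : S1), y) - -dx φ (((-x : ℝ) : S1), y))) hpi.le countable_empty
    (Continuous.continuousOn (by fun_prop)) (fun x hx =>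
      (h.deriv x hx.1).mul ((hφ.hasDerivAt_dx x y).sub (hasDerivAt_neg_slice hφ x y)))
    (Continuous.intervalIntegrable (by fun_prop) _ _)
  have hend : ((π : ℝ) : S1) = ((-π : ℝ) : S1) := by
    rw [← coe_neg_pi_add]; congr 1; ring
  rw [hend, neg_zero, sub_self, sub_self, mul_zero, mul_zero, sub_zero] at key
  rw [← key]
  refine intervalIntegral.integral_congr_ae ?_
  filter_upwards [Measure.ae_ne volume π] with x hxp hx
  rw [uIoc_of_le hpi.le] at hx
  have hx1 : x ∈ Ioo 0 π := ⟨hx.1, lt_of_le_of_ne hx.2 hxp⟩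
  have hx2 : x ∈ Icc 0 π := Ioo_subset_Icc_self hx1
  simp only [circleSign_coe hx1, circleSign_coe_neg hx1, norm_coe_of_mem hx2,
    norm_coe_neg_of_mem hx2]
  ring

/-- Here the even part of `φ` appears, and the boundary terms vanish because `Z` is zero at both
ends: this is where the two Neumann conditions are needed. -/
theorem integral_odd_mul_dx (h : IsNeumannSolution q σ π Y Z)
    (hq : ∀ a b : ℝ, IntervalIntegrable q volume a b) (hqm : StronglyMeasurable q) (h0 : Z 0 = 0)
    {φ : Torus → ℂ} (hφ : IsTest φ) (y : S1) :
    ∫ x : S1, circleSign x * Z ‖x‖ * dx φ (x, y) = -∫ x : S1, q ‖x‖ * Y ‖x‖ * φ (x, y) := by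
  have hpi := pi_pos
  have hY := h.cont
  have hZ := h.cont'
  have hφc := hφ.continuous
  have hdφc := hφ.continuous_dx
  have hmk : Continuous fun x : ℝ => (x : S1) := AddCircle.continuous_mk' (2 * π)
  have hqY : Integrable fun x : S1 => q ‖x‖ * Y ‖x‖ :=
    integrable_comp_norm (f := fun x => q x * Y x)
      (fun a b => (hq a b).mul_continuousOn hY.continuousOn) (hqm.mul hY.stronglyMeasurable)
  have i1 := integrable_mul_slice (integrable_odd hZ) hdφc y
  have i2 := integrable_mul_slice hqY hφc y
  rw [eq_neg_iff_add_eq_zero, ← integral_add i1 i2]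
  refine (integral_circle_eq (i1.add i2)).trans ?_
  simp only [Pi.add_apply]
  have key := MeasureTheory.integral_eq_of_hasDerivAt_off_countable_of_le
    (fun x : ℝ => Z x * (φ ((x : S1), y) + φ (((-x : ℝ) : S1), y)))
    (fun x : ℝ => q x * Y x * (φ ((x : S1), y) + φ (((-x : ℝ) : S1), y))
      + Z x * (dx φ ((x : S1), y) + -dx φ (((-x : ℝ) : S1), y))) hpi.le (countable_singleton σ)
    (Continuous.continuousOn (by fun_prop)) (fun x hx =>
      (h.deriv' x hx.1 hx.2).mul ((hφ.hasDerivAt_dx x y).add (hasDerivAt_neg_slice hφ x y)))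
    ((((hq _ _).mul_continuousOn hY.continuousOn).mul_continuousOn
      (Continuous.continuousOn (by fun_prop))).add
      (Continuous.intervalIntegrable (by fun_prop) _ _))
  rw [h0, h.deriv_right, zero_mul, zero_mul, sub_zero] at key
  rw [← key]
  refine intervalIntegral.integral_congr_ae ?_
  filter_upwards [Measure.ae_ne volume π] with x hxp hx
  rw [uIoc_of_le hpi.le] at hx
  have hx1 : x ∈ Ioo 0 π := ⟨hx.1, lt_of_le_of_ne hx.2 hxp⟩
  have hx2 : x ∈ Icc 0 π := Ioo_subset_Icc_self hx1
  simp only [circleSign_coe hx1, circleSign_coe_neg hx1, norm_coe_of_mem hx2,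
    norm_coe_neg_of_mem hx2]
  ring

end Folding

/-! ### Eigenmodes on the torus -/

section TensorMode

variable {a : S1 → ℂ} {k : ℤ}

theorem norm_fourier_apply (k : ℤ) (y : S1) : ‖fourier k y‖ = 1 := by
  rw [fourier_apply, Circle.norm_coe]

theorem memLp_tensor (ha : Measurable a) {C : ℝ} (hC : ∀ x, ‖a x‖ ≤ C) (k : ℤ) :
    MemLp (fun z : Torus => a z.1 * fourier k z.2) 2 (volume : Measure Torus) := by
  refine MemLp.of_bound (((ha.comp measurable_fst).mul
    ((fourier k).continuous.measurable.comp measurable_snd)).aestronglyMeasurable) C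
    (Filter.Eventually.of_forall fun z => ?_)
  rw [norm_mul, norm_fourier_apply, mul_one]
  exact hC _

theorem norm_sq_of_tensor {f : L2} (hf : f =ᵐ[volume] fun z : Torus => a z.1 * fourier k z.2) :
    ‖f‖ ^ 2 = 2 * π * ∫ x, ‖a x‖ ^ 2 := by
  rw [norm_sq_L2]
  have e : ∫ z : Torus, ‖f z‖ ^ 2 = ∫ z : Torus, ‖a z.1‖ ^ 2 * (fun _ : S1 => (1 : ℝ)) z.2 := by
    refine integral_congr_ae ?_
    filter_upwards [hf] with z hz
    rw [hz, norm_mul, norm_fourier_apply, mul_one, mul_one]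
  rw [e, Measure.volume_eq_prod, integral_prod_mul (fun x => ‖a x‖ ^ 2) (fun _ => (1 : ℝ)), integral_const,
    measureReal_def, AddCircle.measure_univ, ENNReal.toReal_ofReal (by positivity), smul_eq_mul]
  ring

end TensorMode

theorem exists_norm_comp_norm_le {Y : ℝ → ℂ} (hY : Continuous Y) : ∃ C, ∀ x : S1, ‖Y ‖x‖‖ ≤ C := by
  obtain ⟨C, hC⟩ := isCompact_univ.exists_bound_of_continuousOn
    (f := fun x : S1 => Y ‖x‖) (Continuous.continuousOn (by fun_prop))
  exact ⟨C, fun x => hC x (mem_univ x)⟩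

theorem integral_sq_norm_comp_norm {Y : ℝ → ℂ} (hY : Continuous Y) :
    ∫ x : S1, ‖Y ‖x‖‖ ^ 2 = 2 * ∫ x in (0 : ℝ)..π, ‖Y x‖ ^ 2 := by
  have hi : Integrable fun x : S1 => ‖Y ‖x‖‖ ^ 2 :=
    integrable_comp_norm (f := fun r => ‖Y r‖ ^ 2)
      (fun _ _ => Continuous.intervalIntegrable (by fun_prop) _ _)
      (Continuous.stronglyMeasurable (by fun_prop))
  rw [integral_circle_eq hi, ← intervalIntegral.integral_const_mul]
  refine intervalIntegral.integral_congr fun x hx => ?_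
  rw [uIcc_of_le pi_pos.le] at hx
  simp only [norm_coe_of_mem hx, norm_coe_neg_of_mem hx]
  ring

/-- The gradient of an eigenmode across the strip is controlled by its size. -/
theorem IsProfile.integral_sq_deriv_le {β : ℝ} {ω : ℝ → ℝ} (h : IsProfile β ω) {k : ℝ}
    (hk : 1 ≤ k) {s τ : ℂ} (hst : IsAdmissible k s τ) {Y Z : ℝ → ℂ}
    (hYZ : IsNeumannSolution (potential ω s τ) (π / 2) π Y Z) (h0 : Z 0 = 0) :
    ∫ x in (0 : ℝ)..π, ‖Z x‖ ^ 2 ≤ 4 * ∫ x in (0 : ℝ)..π, ‖Y x‖ ^ 2 := by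
  have hid := h.energy_identity hYZ le_rfl pi_pos.le
  rw [h0, zero_mul, neg_zero] at hid
  have hB : 0 ≤ ∫ x in (0 : ℝ)..π, ω x * ‖Y x‖ ^ 2 :=
    intervalIntegral.integral_nonneg pi_pos.le fun t _ => mul_nonneg (h.nonneg t) (sq_nonneg _)
  have hM : 0 ≤ ∫ x in (0 : ℝ)..π, ‖Y x‖ ^ 2 :=
    intervalIntegral.integral_nonneg pi_pos.le fun t _ => sq_nonneg _
  set A := ∫ x in (0 : ℝ)..π, ‖Z x‖ ^ 2
  set B := ∫ x in (0 : ℝ)..π, ω x * ‖Y x‖ ^ 2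
  set M := ∫ x in (0 : ℝ)..π, ‖Y x‖ ^ 2
  have hre := congrArg Complex.re hid
  have him := congrArg Complex.im hid
  simp only [Complex.mul_re, Complex.mul_im, Complex.sub_re, Complex.sub_im, Complex.I_re,
    Complex.I_im, Complex.ofReal_re, Complex.ofReal_im, Complex.zero_re, Complex.zero_im] at hre him
  have hs := hst.norm_sq_le
  have hs1 := abs_le.1 ((Complex.abs_re_le_norm (s ^ 2)).trans hs)
  have hs2 := abs_le.1 ((Complex.abs_im_le_norm (s ^ 2)).trans hs)
  have ht := abs_le.1 (hst.abs_im_le_inv (by linarith))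
  have hkk : 1 / k ≤ 1 := by
    rw [div_le_one (by linarith)]; exact hk
  have hτ := hst.le_re
  -- On `[0, π]` there is no boundary term: the imaginary part of the identity bounds the damping
  -- integral by `2M`, and then the real part gives `A ≤ 2M + B`.
  have hB2 : B ≤ 2 * M := by nlinarith
  nlinarith

/-- The mode is `Y(|x|) e^{iky}`, with weak derivatives `sign(x) Y'(|x|) e^{iky}` and `ik` times the
mode. The velocity `-iτu` and right-hand side `τ²u` are those of the time dependence `e^{-iτt}`. -/
theorem exists_torus_mode {β : ℝ} {ω : ℝ → ℝ} (h : IsProfile β ω) {k : ℕ} (hk : 1 ≤ k) {s τ : ℂ}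
    (hst : IsAdmissible k s τ) {Y Z : ℝ → ℂ}
    (hYZ : IsNeumannSolution (potential ω s τ) (π / 2) π Y Z) (h0 : Z 0 = 0) (hYπ : Y π ≠ 0) :
    ∃ u : H1, 0 < ‖fn u‖ ∧ ‖wdx u‖ ≤ 2 * ‖fn u‖ ∧ ‖wdy u‖ = k * ‖fn u‖ ∧
      HasDampedLaplacian (fun z => ω ‖z.1‖) u ((-Complex.I * τ) • u) (τ ^ 2 • fn u) := by
  have hY := hYZ.cont
  have hZ := hYZ.cont'
  obtain ⟨CY, hCY⟩ := exists_norm_comp_norm_le hY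
  obtain ⟨CZ, hCZ⟩ := exists_norm_comp_norm_le hZ
  have hYm : Measurable fun x : S1 => Y ‖x‖ := (Continuous.measurable (by fun_prop))
  have hZm : Measurable fun x : S1 => circleSign x * Z ‖x‖ :=
    measurable_circleSign.mul (Continuous.measurable (by fun_prop))
  have hCZ' : ∀ x : S1, ‖circleSign x * Z ‖x‖‖ ≤ CZ := fun x => by
    rw [norm_mul, norm_circleSign, one_mul]; exact hCZ x
  have mY := memLp_tensor hYm hCY k
  have mZ := memLp_tensor hZm hCZ' k
  have iY := integrable_even hY
  have iZ := integrable_odd hZ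
  have hωm : StronglyMeasurable ω := h.meas.stronglyMeasurable
  have iωY : Integrable fun x : S1 => (ω ‖x‖ : ℂ) * Y ‖x‖ :=
    integrable_comp_norm (f := fun x => (ω x : ℂ) * Y x)
      (fun a b => (intervalIntegrable_ofReal (h.int a b)).mul_continuousOn hY.continuousOn)
      ((Complex.continuous_ofReal.comp_stronglyMeasurable hωm).mul hY.stronglyMeasurable)
  have hqm : StronglyMeasurable (potential ω s τ) :=
    (stronglyMeasurable_const.add
      (stronglyMeasurable_const.mul (Complex.continuous_ofReal.comp_stronglyMeasurable hωm))).neg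
  have hqi := h.intervalIntegrable_potential s τ
  have iqY : Integrable fun x : S1 => potential ω s τ ‖x‖ * Y ‖x‖ :=
    integrable_comp_norm (f := fun x => potential ω s τ x * Y x)
      (fun a b => (hqi a b).mul_continuousOn hY.continuousOn) (hqm.mul hY.stronglyMeasurable)
  have he : Continuous fun y : S1 => fourier k y := (fourier (T := 2 * π) k).continuous
  have eY := mY.coeFn_toLp
  have eZ := mZ.coeFn_toLp
  have eY' : ((Complex.I * k) • mY.toLp : L2) =ᵐ[volume]
      fun z : Torus => Complex.I * k * (Y ‖z.1‖ * fourier k z.2) := by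
    filter_upwards [Lp.coeFn_smul (Complex.I * (k : ℂ)) mY.toLp, eY] with z h1 h2
    rw [h1, Pi.smul_apply, h2, smul_eq_mul]
  have weakx : ∀ φ : Torus → ℂ, IsTest φ → ∫ z : Torus, Y ‖z.1‖ * fourier k z.2 * dx φ z
      = -∫ z : Torus, circleSign z.1 * Z ‖z.1‖ * fourier k z.2 * φ z := by
    intro φ hφ
    rw [integral_tensor_mul iY he hφ.continuous_dx, integral_tensor_mul iZ he hφ.continuous,
      ← integral_neg]
    congr 1
    funext y
    rw [integral_even_mul_dx hYZ hφ y]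
    ring
  have weaky : ∀ φ : Torus → ℂ, IsTest φ → ∫ z : Torus, Y ‖z.1‖ * fourier k z.2 * dy φ z
      = -(Complex.I * k * ∫ z : Torus, Y ‖z.1‖ * fourier k z.2 * φ z) := by
    intro φ hφ
    rw [integral_tensor_mul' iY he hφ.continuous_dy, integral_tensor_mul' iY he hφ.continuous,
      ← integral_const_mul, ← integral_neg]
    congr 1
    funext x
    rw [hφ.integral_fourier_mul_dy]
    push_cast
    ring
  have weakxx : ∀ φ : Torus → ℂ, IsTest φ →
      ∫ z : Torus, circleSign z.1 * Z ‖z.1‖ * fourier k z.2 * dx φ z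
      = -∫ z : Torus, potential ω s τ ‖z.1‖ * Y ‖z.1‖ * fourier k z.2 * φ z := by
    intro φ hφ
    rw [integral_tensor_mul iZ he hφ.continuous_dx, integral_tensor_mul iqY he hφ.continuous,
      ← integral_neg]
    congr 1
    funext y
    rw [integral_odd_mul_dx hYZ hqi hqm h0 hφ y]
    ring
  set u : H1 := ⟨WithLp.toLp 2 ![mY.toLp, mZ.toLp, (Complex.I * (k : ℂ)) • mY.toLp], by
    refine ⟨fun φ hφ => ?_, fun φ hφ => ?_⟩
    · refine Eq.trans ?_ ((weakx φ hφ).trans (congrArg Neg.neg ?_))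
      · refine integral_congr_ae ?_
        filter_upwards [eY] with z hz using congrArg (· * dx φ z) hz
      · refine integral_congr_ae ?_
        filter_upwards [eZ] with z hz using (congrArg (· * φ z) hz).symm
    · refine Eq.trans ?_ ((weaky φ hφ).trans (congrArg Neg.neg ?_))
      · refine integral_congr_ae ?_
        filter_upwards [eY] with z hz using congrArg (· * dy φ z) hz
      · rw [← integral_const_mul]
        refine integral_congr_ae ?_
        filter_upwards [eY'] with z hz
        refine Eq.trans ?_ (congrArg (· * φ z) hz).symm
        ring⟩ with hu
  have hfn : fn u = mY.toLp := rfl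
  have hwdx : wdx u = mZ.toLp := rfl
  have hwdy : wdy u = (Complex.I * (k : ℂ)) • mY.toLp := rfl
  -- Nonvanishing at the single point `π` suffices by continuity.
  have hMpos : 0 < ∫ x in (0 : ℝ)..π, ‖Y x‖ ^ 2 := by
    refine intervalIntegral.integral_pos pi_pos (Continuous.continuousOn (by fun_prop))
      (fun _ _ => sq_nonneg _) ⟨π, ⟨pi_pos.le, le_rfl⟩, ?_⟩
    have := norm_pos_iff.2 hYπ
    positivity
  have nY : ‖fn u‖ ^ 2 = 2 * π * (2 * ∫ x in (0 : ℝ)..π, ‖Y x‖ ^ 2) := by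
    rw [hfn, norm_sq_of_tensor (a := fun x => Y ‖x‖) (k := k) eY, integral_sq_norm_comp_norm hY]
  have nZ : ‖wdx u‖ ^ 2 = 2 * π * (2 * ∫ x in (0 : ℝ)..π, ‖Z x‖ ^ 2) := by
    rw [hwdx, norm_sq_of_tensor (a := fun x => circleSign x * Z ‖x‖) (k := k) eZ, ← integral_sq_norm_comp_norm hZ]
    congr 2
    funext x
    rw [norm_mul, norm_circleSign, one_mul]
  have hpi := pi_pos
  refine ⟨u, ?_, ?_, ?_, ?_, fun φ hφ => ?_⟩
  · refine (norm_nonneg _).lt_of_ne fun h => ?_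
    rw [← h] at nY
    have : 0 < 2 * π * (2 * ∫ x in (0 : ℝ)..π, ‖Y x‖ ^ 2) := by positivity
    linarith
  · refine abs_le_of_sq_le_sq' ?_ (by positivity) |>.2
    have := h.integral_sq_deriv_le (by exact_mod_cast hk) hst hYZ h0
    rw [mul_pow, nY, nZ]
    nlinarith
  · rw [hwdy, norm_smul, norm_mul, Complex.norm_I, one_mul, Complex.norm_natCast, hfn]
  · have hv : fn ((-Complex.I * τ) • u) =ᵐ[volume]
        fun z => -Complex.I * τ * (Y ‖z.1‖ * fourier k z.2) := by
      filter_upwards [Lp.coeFn_smul (-Complex.I * τ) (fn u), eY] with z h1 h2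
      exact h1.trans (by rw [Pi.smul_apply, hfn, h2, smul_eq_mul])
    have := (integrable_tensor_mul iωY he (continuous_const (y := (1 : ℂ)))).const_mul
      (-Complex.I * τ)
    refine this.congr ?_
    filter_upwards [hv] with z hz
    rw [hz]
    ring
  · have hv : fn ((-Complex.I * τ) • u) =ᵐ[volume]
        fun z => -Complex.I * τ * (Y ‖z.1‖ * fourier k z.2) := by
      filter_upwards [Lp.coeFn_smul (-Complex.I * τ) (fn u), eY] with z h1 h2
      exact h1.trans (by rw [Pi.smul_apply, hfn, h2, smul_eq_mul])
    have j1 := integrable_tensor_mul iZ he hφ.continuous_dx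
    have j2 := (integrable_tensor_mul iY he hφ.continuous_dy).const_mul (Complex.I * k)
    have j3 := (integrable_tensor_mul iωY he hφ.continuous).const_mul (-Complex.I * τ)
    have j4 := (integrable_tensor_mul iY he hφ.continuous).const_mul (s ^ 2)
    have j5 := (integrable_tensor_mul iωY he hφ.continuous).const_mul (Complex.I * τ)
    have el : ∫ z : Torus, (wdx u z * dx φ z + wdy u z * dy φ z
        + ((ω ‖z.1‖ : ℝ) : ℂ) * fn ((-Complex.I * τ) • u) z * φ z)
        = ∫ z : Torus, (circleSign z.1 * Z ‖z.1‖ * fourier k z.2 * dx φ z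
          + Complex.I * k * (Y ‖z.1‖ * fourier k z.2 * dy φ z)
          + -Complex.I * τ * ((ω ‖z.1‖ : ℂ) * Y ‖z.1‖ * fourier k z.2 * φ z)) := by
      refine integral_congr_ae ?_
      filter_upwards [eZ, eY', hv] with z h1 h2 h3
      rw [hwdx, hwdy, h1, h2, h3]
      ring
    have er : ∫ z : Torus, (τ ^ 2 • fn u : L2) z * φ z
        = τ ^ 2 * ∫ z : Torus, Y ‖z.1‖ * fourier k z.2 * φ z := by
      rw [← integral_const_mul]
      refine integral_congr_ae ?_
      filter_upwards [Lp.coeFn_smul (τ ^ 2) (fn u), eY] with z h1 h2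
      rw [h1, Pi.smul_apply, hfn, h2, smul_eq_mul, mul_assoc]
    have eq : ∫ z : Torus, potential ω s τ ‖z.1‖ * Y ‖z.1‖ * fourier k z.2 * φ z
        = -(s ^ 2 * (∫ z : Torus, Y ‖z.1‖ * fourier k z.2 * φ z)
          + Complex.I * τ * ∫ z : Torus, (ω ‖z.1‖ : ℂ) * Y ‖z.1‖ * fourier k z.2 * φ z) := by
      rw [← integral_const_mul, ← integral_const_mul, ← integral_add j4 j5, ← integral_neg]
      congr 1
      funext z
      simp only [potential]
      ring
    have e1 := integral_add (j1.add j2) j3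
    have e2 := integral_add j1 j2
    simp only [Pi.add_apply] at e1 e2
    rw [el, er, e1, e2, integral_const_mul, integral_const_mul, weaky φ hφ, weakxx φ hφ, eq,
      hst.sq_eq]
    linear_combination (-(k : ℂ) ^ 2 * ∫ z : Torus, Y ‖z.1‖ * fourier k z.2 * φ z) * Complex.I_sq

/-! ### Separated solutions and the lower bound on the decay -/

/-- Separated solutions built on an eigenmode. -/
theorem isSolution_exp {W : Torus → ℝ} {u : H1} {l : ℂ}
    (h : HasDampedLaplacian W u (l • u) ((-l ^ 2) • fn u)) :
    IsSolution W u (l • u) fun t : ℝ => Complex.exp (l * t) • ((u, fn (l • u)) : EnergySpace) := by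
  refine ⟨by simp, fun t _ => ⟨(l * Complex.exp (l * t)) • ((u, fn (l • u)) : EnergySpace),
    ⟨?_, ?_⟩, ?_⟩⟩
  · have e1 : fn ((l * Complex.exp (l * t)) • u) = (l * Complex.exp (l * t)) • fn u := rfl
    have e2 : fn (l • u) = l • fn u := rfl
    simp only [Prod.smul_mk, e1, e2, smul_smul, mul_comm]
  · have h' := h.smul (Complex.exp (l * t))
    have e2 : fn (l • u) = l • fn u := rfl
    simp only [Prod.smul_mk, e2]
    convert h' using 1
    · rw [smul_smul, mul_comm l]
    · rw [smul_smul, smul_smul, ← neg_smul]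
      congr 1
      ring
  · have h1 : HasDerivAt (fun t : ℝ => Complex.exp (l * t)) (l * Complex.exp (l * t)) t := by
      have h2 : HasDerivAt (fun t : ℝ => l * (t : ℂ)) l t := by
        simpa using (Complex.ofRealCLM.hasDerivAt (x := t)).const_mul l
      simpa [mul_comm] using h2.cexp
    exact (h1.smul_const _).hasDerivWithinAt

theorem norm_exp_ge {τ : ℂ} {K t : ℝ} (ht : 0 ≤ t) (h : |τ.im| * t ≤ K) :
    exp (-K) ≤ ‖Complex.exp (-Complex.I * τ * t)‖ := by
  rw [Complex.norm_exp]
  refine exp_le_exp.2 ?_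
  have e : (-Complex.I * τ * t).re = τ.im * t := by
    simp [Complex.mul_re, Complex.mul_im]
  rw [e]
  nlinarith [neg_abs_le τ.im]

theorem gradNorm_sq_le {u : H1} {k : ℝ} (hk : 2 ≤ k) (hx : ‖wdx u‖ ≤ 2 * ‖fn u‖)
    (hy : ‖wdy u‖ = k * ‖fn u‖) : ‖wdx u‖ ^ 2 + ‖wdy u‖ ^ 2 ≤ (2 * k * ‖fn u‖) ^ 2 := by
  have h1 : ‖wdx u‖ ^ 2 ≤ (2 * ‖fn u‖) ^ 2 := by gcongr
  have h2 : 0 ≤ ‖fn u‖ ^ 2 * (k ^ 2 - 4) := mul_nonneg (sq_nonneg _) (by nlinarith)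
  have h3 := sq_nonneg ‖fn u‖
  rw [hy]
  linarith

theorem gradNorm_le {u : H1} {k : ℝ} (hk : 2 ≤ k) (hx : ‖wdx u‖ ≤ 2 * ‖fn u‖)
    (hy : ‖wdy u‖ = k * ‖fn u‖) : gradNorm u ≤ 2 * k * ‖fn u‖ := by
  rw [gradNorm, sqrt_le_left (by positivity)]
  exact gradNorm_sq_le hk hx hy

theorem norm_H1_le {u : H1} {k : ℝ} (hk : 2 ≤ k) (hx : ‖wdx u‖ ≤ 2 * ‖fn u‖)
    (hy : ‖wdy u‖ = k * ‖fn u‖) : ‖u‖ ≤ 3 * k * ‖fn u‖ := by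
  refine abs_le_of_sq_le_sq' ?_ (by positivity) |>.2
  have h1 := gradNorm_sq_le hk hx hy
  have h2 : 0 ≤ ‖fn u‖ ^ 2 * (k ^ 2 - 4) := mul_nonneg (sq_nonneg _) (by nlinarith)
  have h3 := sq_nonneg ‖fn u‖
  rw [norm_sq_H1]
  linarith

/-- The energy of a separated solution. -/
theorem le_sqrt_energy_exp {u : H1} {l : ℂ} {t a b : ℝ} (ha : 0 ≤ a)
    (hat : a ≤ ‖Complex.exp (l * t)‖) (hb : 0 ≤ b) (hbl : b ≤ ‖l‖) :
    1 / 2 * (a * (b * ‖fn u‖))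
      ≤ √(energy (Complex.exp (l * t) • ((u, fn (l • u)) : EnergySpace))) := by
  have e1 : (Complex.exp (l * t) • ((u, fn (l • u)) : EnergySpace)).2
      = Complex.exp (l * t) • l • fn u := rfl
  have e2 : ‖(Complex.exp (l * t) • ((u, fn (l • u)) : EnergySpace)).2‖
      = ‖Complex.exp (l * t)‖ * (‖l‖ * ‖fn u‖) := by
    rw [e1, norm_smul, norm_smul]
  have h3 : (a * (b * ‖fn u‖)) ^ 2 ≤ (‖Complex.exp (l * t)‖ * (‖l‖ * ‖fn u‖)) ^ 2 := by gcongr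
  have h4 := sq_nonneg (gradNorm (Complex.exp (l * t) • ((u, fn (l • u)) : EnergySpace)).1)
  have h5 := sq_nonneg (a * (b * ‖fn u‖))
  refine le_sqrt_of_sq_le ?_
  rw [energy, e2, mul_pow]
  linarith

/-- For an eigenmode of large frequency `k`, the quotient of the root of the energy at time `t₀` by
the norm of the data is at least `e^{-K} / (18 k)`, whereas the improved rate would bound it by `C
k^{-1 - ε/α}`. -/
theorem IsProfile.rateNotImprovable {β : ℝ} {ω : ℝ → ℝ} (h : IsProfile β ω) (hβ : -1 < β) :
    RateNotImprovable (fun z => ω ‖z.1‖) ((β + 2) / (β + 3)) := by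
  intro C hC ε hε
  obtain ⟨K, hK, hev⟩ := h.exists_eigenmode hβ
  have hβ2 : 0 < β + 2 := by linarith
  have hβ3 : 0 < β + 3 := by linarith
  set α := (β + 2) / (β + 3) with hα
  have hα0 : 0 < α := by positivity
  have hbig : ∀ᶠ k : ℝ in Filter.atTop, 18 * C * exp K < k ^ (ε / α) :=
    (tendsto_rpow_atTop (by positivity)).eventually_gt_atTop _
  obtain ⟨k, hk, hkbig, hk2⟩ := (tendsto_natCast_atTop_atTop (R := ℝ)).eventually
    (hev.and (hbig.and (Filter.eventually_ge_atTop 2))) |>.exists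
  obtain ⟨s, τ, Y, Z, hst, hYZ, hZ0, hYπ, him⟩ := hk
  obtain ⟨u, hu, hux, huy, hlap⟩ := exists_torus_mode h
    (by exact_mod_cast (by linarith : (1 : ℝ) ≤ k)) hst hYZ hZ0 hYπ
  have hk0 : (0 : ℝ) < k := by linarith
  set l : ℂ := -Complex.I * τ with hl
  have hl2 : -l ^ 2 = τ ^ 2 := by
    rw [hl, mul_pow, neg_sq, Complex.I_sq]; ring
  rw [← hl2] at hlap
  have hsol := isSolution_exp hlap
  -- The lifetime of the mode: `1 / α = (β + 3) / (β + 2)`, so `|Im τ| t₀ ≤ K`.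
  set t₀ : ℝ := (k : ℝ) ^ (1 / α) with ht₀
  have ht₀pos : 0 < t₀ := rpow_pos_of_pos hk0 _
  have hw : ∀ x : S1, 0 ≤ ω ‖x‖ := fun x => h.nonneg _
  have hwm : Measurable fun x : S1 => ω ‖x‖ := h.meas.comp measurable_norm
  have hwi : Integrable fun x : S1 => ω ‖x‖ :=
    integrable_comp_norm h.int h.meas.stronglyMeasurable
  refine ⟨t₀, ht₀pos, u, l • u, _, hlap, _, hsol,
    fun U₂ hU₂ => IsSolution.eqOn hw hwm hwi hsol hU₂, ?_⟩
  have hτl : ‖l‖ = ‖τ‖ := by rw [hl, norm_mul, norm_neg, Complex.norm_I, one_mul]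
  have hτ1 : (k : ℝ) ≤ ‖τ‖ := hst.le_re.trans (Complex.re_le_norm _)
  have hτ2 : ‖τ‖ ^ 2 ≤ 2 * (k : ℝ) ^ 2 := by
    rw [← norm_pow, hst.sq_eq]
    refine (norm_add_le _ _).trans ?_
    rw [norm_pow, Complex.norm_real, norm_of_nonneg hk0.le]
    nlinarith [hst.norm_sq_le]
  have hτ3 : ‖τ‖ ≤ 2 * k := abs_le_of_sq_le_sq' (by nlinarith) (by positivity) |>.2
  set n := ‖fn u‖ with hn
  have hdecay : exp (-K) ≤ ‖Complex.exp (l * t₀)‖ := by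
    refine norm_exp_ge ht₀pos.le ?_
    have e : (k : ℝ) ^ (-((β + 3) / (β + 2))) * t₀ = 1 := by
      rw [ht₀, ← rpow_add hk0, hα, one_div_div, neg_add_cancel, rpow_zero]
    calc |τ.im| * t₀ ≤ K * (k : ℝ) ^ (-((β + 3) / (β + 2))) * t₀ := by gcongr
      _ = K := by rw [mul_assoc, e, mul_one]
  have henergy : 1 / 2 * (exp (-K) * (k * n))
      ≤ √(energy (Complex.exp (l * t₀) • ((u, fn (l • u)) : EnergySpace))) :=
    le_sqrt_energy_exp (exp_pos _).le hdecay hk0.le (by rw [hτl]; exact hτ1)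
  have hnorm : ‖u‖ ≤ 3 * k * n := norm_H1_le hk2 hux huy
  have hgrad : gradNorm u ≤ 2 * k * n := gradNorm_le hk2 hux huy
  -- The three terms contribute at most `1`, `6` and `2` times `k² n`, using `2 ≤ k` and `‖τ‖ ≤ 2k`.
  have hdata : gradNorm u + ‖l • u‖ + ‖(-l ^ 2) • fn u‖ ≤ 9 * (k : ℝ) ^ 2 * n := by
    rw [norm_smul, norm_smul, norm_neg, norm_pow, hτl, ← hn]
    have h1 : ‖τ‖ * ‖u‖ ≤ (2 * k) * (3 * k * n) := by gcongr
    have h2 : ‖τ‖ ^ 2 * n ≤ 2 * (k : ℝ) ^ 2 * n := by gcongr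
    have h3 : 2 * k * n ≤ (k : ℝ) ^ 2 * n := by
      have : 2 * (k : ℝ) ≤ (k : ℝ) ^ 2 := by nlinarith
      gcongr
    linarith
  have hbr : bracket t₀ ^ (-α - ε) ≤ (k : ℝ) ^ (-1 - ε / α) := by
    have h1 : t₀ ≤ bracket t₀ := le_sqrt_of_sq_le (by linarith)
    refine (rpow_le_rpow_of_nonpos ht₀pos h1 (by linarith)).trans (le_of_eq ?_)
    rw [ht₀, ← rpow_mul hk0.le]
    congr 1
    field_simp
  have hpow : (k : ℝ) ^ (-1 - ε / α) = ((k : ℝ) * (k : ℝ) ^ (ε / α))⁻¹ := by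
    rw [← rpow_one_add' hk0.le (by positivity), ← rpow_neg hk0.le]
    congr 1
    ring
  have hkε : 0 < (k : ℝ) ^ (ε / α) := rpow_pos_of_pos hk0 _
  have hupper : C * bracket t₀ ^ (-α - ε) * (gradNorm u + ‖l • u‖ + ‖(-l ^ 2) • fn u‖)
      ≤ C * (k : ℝ) ^ (-1 - ε / α) * (9 * (k : ℝ) ^ 2 * n) := by
    have : 0 ≤ gradNorm u + ‖l • u‖ + ‖(-l ^ 2) • fn u‖ :=
      add_nonneg (add_nonneg (sqrt_nonneg _) (norm_nonneg _)) (norm_nonneg _)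
    gcongr
  have hlower : C * (k : ℝ) ^ (-1 - ε / α) * (9 * (k : ℝ) ^ 2 * n)
      < 1 / 2 * (exp (-K) * (k * n)) := by
    rw [hpow]
    have e1 : C * ((k : ℝ) * (k : ℝ) ^ (ε / α))⁻¹ * (9 * (k : ℝ) ^ 2 * n)
        = (9 * C / (k : ℝ) ^ (ε / α)) * (k * n) := by
      field_simp
    have e2 : 9 * C / (k : ℝ) ^ (ε / α) < 1 / 2 * exp (-K) := by
      rw [div_lt_iff₀ hkε, exp_neg]
      have := exp_pos K
      rw [← sub_pos] at hkbig ⊢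
      have e3 : 1 / 2 * (exp K)⁻¹ * (k : ℝ) ^ (ε / α) - 9 * C
          = 1 / 2 * (exp K)⁻¹ * ((k : ℝ) ^ (ε / α) - 18 * C * exp K) := by
        field_simp
        ring
      rw [e3]
      positivity
    rw [e1, ← mul_assoc (1 / 2 : ℝ)]
    gcongr
  exact hupper.trans_lt (hlower.trans_le henergy)

/-! ### The two dampings as profiles -/

theorem isProfile_pow {β : ℝ} (hβ : -1 < β) :
    IsProfile β fun r => if r ≤ π / 2 then 0 else (r - π / 2) ^ β where
  meas := Measurable.ite measurableSet_Iic measurable_const (by fun_prop)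
  nonneg r := by
    split_ifs with h
    · exact le_rfl
    · exact rpow_nonneg (by linarith) _
  zero r hr := if_pos hr.le
  cont r hr := continuousAt_shifted_rpow_ite hr
  int a b := intervalIntegrable_shifted_rpow_ite hβ a b
  lower := ⟨1, one_pos, fun x hx => by rw [if_neg (not_le.2 hx.1), one_mul]⟩
where
  continuousAt_shifted_rpow_ite {β r : ℝ} (hr : r ≠ π / 2) :
      ContinuousAt (fun r => if r ≤ π / 2 then 0 else (r - π / 2) ^ β) r := by
    rcases lt_or_gt_of_ne hr with h | h
    · refine continuousAt_const.congr (f := fun _ => (0 : ℝ)) ?_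
      filter_upwards [Iio_mem_nhds h] with x hx
      rw [if_pos (le_of_lt hx)]
    · refine ContinuousAt.congr (f := fun r => (r - π / 2) ^ β)
        ((continuousAt_id.sub continuousAt_const).rpow_const (Or.inl (sub_ne_zero.2 hr))) ?_
      filter_upwards [Ioi_mem_nhds h] with x hx
      rw [if_neg (not_le.2 hx)]
  intervalIntegrable_shifted_rpow_ite {β : ℝ} (hβ : -1 < β) (a b : ℝ) :
      IntervalIntegrable (fun r => if r ≤ π / 2 then 0 else (r - π / 2) ^ β) volume a b := by
    have h : IntervalIntegrable (fun r : ℝ => (r - π / 2) ^ β) volume a b := by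
      have := (intervalIntegral.intervalIntegrable_rpow' hβ (a := a - π / 2)
        (b := b - π / 2)).comp_sub_right (π / 2)
      simpa using this
    rw [intervalIntegrable_iff] at h ⊢
    refine (h.indicator (measurableSet_Ioi (a := π / 2))).congr
      (Filter.Eventually.of_forall fun x => ?_)
    by_cases hx : x ≤ π / 2
    · rw [indicator_of_notMem (by simpa using hx)]
      exact (if_pos hx).symm
    · rw [indicator_of_mem (by simpa using hx)]
      exact (if_neg hx).symm

/-- The added constant only increases the damping, so the lower bound by the power persists with
constant `1`. -/
theorem isProfile_pow_add_one {β : ℝ} (hβ : -1 < β) :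
    IsProfile β fun r => if π / 2 ≤ r then (r - π / 2) ^ β + 1 else 0 where
  meas := Measurable.ite measurableSet_Ici (by fun_prop) measurable_const
  nonneg r := by
    split_ifs with h
    · have := rpow_nonneg (by linarith : 0 ≤ r - π / 2) β
      linarith
    · exact le_rfl
  zero r hr := if_neg (not_le.2 hr)
  cont r hr := by
    rcases lt_or_gt_of_ne hr with h | h
    · refine continuousAt_const.congr (f := fun _ => (0 : ℝ)) ?_
      filter_upwards [Iio_mem_nhds h] with x hx
      rw [if_neg (not_le.2 hx)]
    · refine ContinuousAt.congr (f := fun r => (r - π / 2) ^ β + 1)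
        (((continuousAt_id.sub continuousAt_const).rpow_const
          (Or.inl (sub_ne_zero.2 hr))).add continuousAt_const) ?_
      filter_upwards [Ioi_mem_nhds h] with x hx
      rw [if_pos (le_of_lt hx)]
  int a b := by
    have h : IntervalIntegrable (fun r : ℝ => (r - π / 2) ^ β + 1) volume a b := by
      have := (intervalIntegral.intervalIntegrable_rpow' hβ (a := a - π / 2)
        (b := b - π / 2)).comp_sub_right (π / 2)
      simpa using this.add (intervalIntegrable_const (c := (1 : ℝ)))
    rw [intervalIntegrable_iff] at h ⊢
    refine (h.indicator (measurableSet_Ici (a := π / 2))).congr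
      (Filter.Eventually.of_forall fun x => ?_)
    by_cases hx : π / 2 ≤ x
    · rw [indicator_of_mem (by simpa using hx)]
      exact (if_pos hx).symm
    · rw [indicator_of_notMem (by simpa using hx)]
      exact (if_neg hx).symm
  lower := ⟨1, one_pos, fun x hx => by rw [if_pos hx.1.le, one_mul]; linarith⟩

theorem polynomiallyControlled_modelDamping {β : ℝ} :
    PolynomiallyControlled β 0 (modelDamping β (π / 2)) := by
  refine ⟨Measurable.ite (measurableSet_le measurable_norm measurable_const) measurable_const
    ((measurable_norm.sub_const _).pow_const _), 1, π / 2, one_pos, by positivity,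
    by linarith [pi_pos], Filter.Eventually.of_forall fun x => ?_⟩
  simp

end DampedWave

end

theorem theorem2 :
    (∀ β : ℝ, -1 < β →
      ∃ (θ : DampedWave.S1) (w : DampedWave.S1 → ℝ),
        DampedWave.PolynomiallyControlled β θ w ∧
        DampedWave.RateNotImprovable (fun z : DampedWave.Torus => w z.1)
          ((β + 2) / (β + 3))) ∧
    (∀ β : ℝ, -1 < β → β < 0 →
      DampedWave.RateNotImprovable (DampedWave.singularDamping β) ((β + 2) / (β + 3))) :=
  -- The model damping with edge at `π / 2`, centered at `0`, is the power profile evaluated at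
  -- `‖x‖`; the agreement is definitional.
  ⟨fun β hβ => ⟨0, DampedWave.modelDamping β (π / 2),
    DampedWave.polynomiallyControlled_modelDamping,
    (DampedWave.isProfile_pow hβ).rateNotImprovable hβ⟩,
    fun _ hβ _ => (DampedWave.isProfile_pow_add_one hβ).rateNotImprovable hβ⟩
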